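/- **Setting.** Databases carry a symmetric neighbouring relation. For laws $P,Q$ on a measurable space put $\delta(P\|Q)(\epsilon)=\sup_S\big(Q(S)-e^{\epsilon}P(S)\big)$, the supremum being over events $S$. Let $M$ be a randomized algorithm that takes a database $D$ and an auxiliary input $a$, with outputs in a countably generated measurable space. Its privacy curve $\delta_M(\epsilon)$, $\epsilon\in\mathbb R$, is the least $\delta\ge 0$ such that, for every fixed $a$, $\Pr[M(D,a)\in S]\le e^{\epsilon}\Pr[M(D',a)\in S]+\delta$ for all neighbours $D,D'$ and all events $S$. Let $(X,Y)$ be privacy loss random variables for $\delta_M$: $[-\infty,\infty]$-valued, with $\delta(X\|Y)=\delta_M$, with $\mathbb E[\phi(Y)]=\mathbb E[\phi(X)e^{X}]$ for every measurable $\phi:[-\infty,\infty]\to[0,1]$ vanishing at $\pm\infty$, and with $\Pr[Y=-\infty]=\Pr[X=\infty]=0$. For $k\ge 1$ let $M^{\circ k}$ be an adaptive composition of $M$ with itself $k$ times, in which the auxiliary input of each run is a measurable function of the outputs of the earlier runs. Let $\delta_{M^{\circ k}}=\delta_M\otimes\cdots\otimes\delta_M=\delta(X^{k}\|Y^{k})$,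 where $X^k$, $Y^k$ are vectors of $k$ independent copies. For a curve $\delta_A$ write $\epsilon_A(d)=\inf\{\epsilon\ge 0:\delta_A(\epsilon)\le d\}\in[0,\infty]$. **Model.** Programs run on a real RAM: exact real arithmetic $+,-,\times,/$, square root, exponential, logarithm and comparisons; indices with addition, truncated subtraction, halving and comparison; no rounding of reals to integers. Queries to the distribution function $t\mapsto\Pr[Y\le t]$ and to the truncated mean $t\mapsto\mathbb E[Y;\,-t<Y\le t]$ are allowed. Each operation costs one step. The output is a finite table of a function $\widetilde\delta:\mathbb R\to\mathbb R$ that is piecewise of the form $A-Be^{\epsilon}$, with sorted breakpoints. **Theorem.** There are one program and one absolute constant $C$ such that for all $M,X,Y,k$ and $M^{\circ k}$ as above: 1. $M^{\circ k}$ is $(\epsilon,\delta_{M^{\circ k}}(\epsilon))$-DP for every $\epsilon\in\mathbb R$. If some neighbours $D,D'$ satisfy $\delta(M(D',a)\|M(D,a))=\delta_M$ for every $a$, then $\delta_{M^{\circ k}}(\epsilon)$ is, for every $\epsilon$, the least $\delta\ge 0$ for which $M^{\circ k}$ is $(\epsilon,\delta)$-DP. 2. Let $\epsilon_{\rm error}>0$,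 $\delta_{\rm error}\in(0,1)$ and let $\epsilon_{\rm upper}\in\mathbb R$ satisfy $$\epsilon_{\rm upper}\ \ge\ \max\{\epsilon_{M^{\circ k}}(\delta_{\rm error}),\ \epsilon_M(\delta_{\rm error}/k)\}.$$ Given $k,\epsilon_{\rm error},\delta_{\rm error},\epsilon_{\rm upper}$ and query access to $Y$, the program halts and outputs $\widetilde\delta$ with $$\widetilde\delta(\epsilon+\epsilon_{\rm error})-\delta_{\rm error}\ \le\ \delta_{M^{\circ k}}(\epsilon)\ \le\ \widetilde\delta(\epsilon-\epsilon_{\rm error})+\delta_{\rm error}\qquad\text{for all }\epsilon\in\mathbb R .$$ Its number of steps is at most $C\,\frac Lh\log\frac Lh$, where $L=2+\epsilon_{\rm error}+\epsilon_{\rm upper}$ and $h=\epsilon_{\rm error}\big/\sqrt{\tfrac k2\log\tfrac{12}{\delta_{\rm error}}}$. In particular, if $k\ge2$, $\epsilon_{\rm upper}\ge1$, $\epsilon_{\rm error}\le\epsilon_{\rm upper}$, $\delta_{\rm error}\le\frac12$, $a\ge 0$ and $\epsilon_{\rm upper}\sqrt{\log(1/\delta_{\rm error})}/\epsilon_{\rm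 error}\le k^{a}$, it is at most $$C(1+a)\cdot\frac{\epsilon_{\rm upper}\,\sqrt k\,\log k\,\sqrt{\log(1/\delta_{\rm error})}}{\epsilon_{\rm error}} .$$ -/

import Mathlib

open MeasureTheory ProbabilityTheory

/-! ## Differential privacy -/

namespace DP

/-- The privacy curve `δ(P‖Q)(ε) = sup_S (Q(S) - e^ε P(S))` of a pair of probability measures,
the supremum being over all measurable events `S`. -/
noncomputable def privacyCurve {Ω : Type*} [MeasurableSpace Ω] (P Q : Measure Ω) (ε : ℝ) : ℝ :=
  ⨆ S : {S : Set Ω // MeasurableSet S}, (Q.real S.1 - Real.exp ε * P.real S.1)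

/-- `M` is `(ε, δ)`-DP with respect to the neighbouring relation `nbr` on databases;
`M D` is the law of the output on the database `D`. -/
def IsDP {𝒟 Ω : Type*} [MeasurableSpace Ω] (nbr : 𝒟 → 𝒟 → Prop) (M : 𝒟 → Measure Ω)
    (ε δ : ℝ) : Prop :=
  ∀ D D' : 𝒟, nbr D D' → ∀ S : Set Ω, MeasurableSet S →
    (M D).real S ≤ Real.exp ε * (M D').real S + δ

/-- The privacy curve of an algorithm: for each `ε`, the least `δ ≥ 0` for which it
is `(ε, δ)`-DP. -/
noncomputable def dpCurve {𝒟 Ω : Type*} [MeasurableSpace Ω] (nbr : 𝒟 → 𝒟 → Prop)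
    (M : 𝒟 → Measure Ω) (ε : ℝ) : ℝ :=
  sInf {δ : ℝ | 0 ≤ δ ∧ IsDP nbr M ε δ}

/-- The privacy curve of an algorithm `M(D, a)` with an auxiliary input `a`: for each `ε`, the
least `δ ≥ 0` such that `M(·, a)` is `(ε, δ)`-DP for every fixed `a`. -/
noncomputable def auxCurve {𝒟 A Ω : Type*} [MeasurableSpace A] [MeasurableSpace Ω]
    (nbr : 𝒟 → 𝒟 → Prop) (M : 𝒟 → Kernel A Ω) (ε : ℝ) : ℝ :=
  sInf {δ : ℝ | 0 ≤ δ ∧ ∀ a : A, IsDP nbr (fun D => M D a) ε δ}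

/-- Adaptive composition of `M` with itself on the database `D`: the law of the sequence of the
outputs of `n` runs of `M`, where the auxiliary input of each run is computed (by `pick`) from the
outputs of all the runs before it. -/
noncomputable def adaptiveComp {𝒟 A Ω : Type*} [MeasurableSpace A] [MeasurableSpace Ω]
    (M : 𝒟 → Kernel A Ω) (pick : ∀ n : ℕ, (Fin n → Ω) → A) (hpick : ∀ n, Measurable (pick n))
    (D : 𝒟) : (n : ℕ) → Measure (Fin n → Ω)
  | 0 => Measure.dirac Fin.elim0
  | n + 1 =>
    ((adaptiveComp M pick hpick D n) ⊗ₘ ((M D).comap (pick n) (hpick n))).map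
      (fun p => (Fin.snoc p.1 p.2 : Fin (n + 1) → Ω))

/-- `X`, `Y` (given by their laws on `[-∞, ∞]`) are privacy loss random variables for the privacy
curve `δ`. The field `change` says `Y(t) = e^t X(t)` for real `t`. -/
structure IsPRV (δ : ℝ → ℝ) (X Y : Measure EReal) : Prop where
  prob_left : IsProbabilityMeasure X
  prob_right : IsProbabilityMeasure Y
  curve : ∀ ε : ℝ, privacyCurve X Y ε = δ ε
  change : ∀ φ : EReal → ENNReal, Measurable φ → (∀ t, φ t ≤ 1) → φ ⊤ = 0 → φ ⊥ = 0 →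
    ∫⁻ t, φ t ∂Y = ∫⁻ t, φ t * ENNReal.ofReal (Real.exp t.toReal) ∂X
  right_bot : Y {⊥} = 0
  left_top : X {⊤} = 0

/-- The `k`-fold composition `δ ⊗ ⋯ ⊗ δ` of the privacy curve `δ = δ(X‖Y)` with itself: the
privacy curve of `k` independent copies of `X` against `k` independent copies of `Y`. -/
noncomputable def composedCurve (k : ℕ) (X Y : Measure EReal) (ε : ℝ) : ℝ :=
  privacyCurve (Measure.pi fun _ : Fin k => X) (Measure.pi fun _ : Fin k => Y) ε

/-- The inverse `ε(d)` of a privacy curve `δ(ε)`: the infimum of all `ε ≥ 0` with `δ(ε) ≤ d`,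
which is `∞` when there are none. -/
noncomputable def epsOf (δ : ℝ → ℝ) (d : ℝ) : EReal :=
  sInf ((fun ε : ℝ => (ε : EReal)) '' {ε : ℝ | 0 ≤ ε ∧ δ ε ≤ d})

end DP

/-! ## A real RAM

A small imperative language over natural-number registers (for counters and array indices), real
registers and arrays of reals. There is no rounding of a real to an integer, and indices have only
addition, truncated subtraction and halving. Each node of an expression that is evaluated and each
command that is executed costs one step. -/

namespace RealRAM

/-- What the program can ask about the random variable it is given: the value of the distribution
function at a point `t`, and the truncated mean `E[Y ; -t < Y ≤ t]`. -/
structure Oracle where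
  cdf : ℝ → ℝ
  truncMean : ℝ → ℝ

/-- The oracle for a random variable with law `Y` on `[-∞, ∞]`. -/
noncomputable def Oracle.ofLaw (Y : Measure EReal) : Oracle where
  cdf t := Y.real (Set.Iic (t : EReal))
  truncMean t := ∫ y in Set.Ioc (((-t : ℝ)) : EReal) (t : EReal), y.toReal ∂Y

/-- Contents of the natural-number registers, the real registers and the arrays. -/
structure State where
  nat : ℕ → ℕ
  real : ℕ → ℝ
  arr : ℕ → ℕ → ℝ

/-- Index expressions. -/
inductive NExp where
  | lit (n : ℕ)
  | var (i : ℕ)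
  | add (a b : NExp)
  | sub (a b : NExp)
  | half (a : NExp)

/-- Real expressions; `get a i` is the entry `i` of the array `a`. -/
inductive RExp where
  | lit (q : ℚ)
  | var (i : ℕ)
  | ofNat (a : NExp)
  | get (a : ℕ) (i : NExp)
  | add (a b : RExp)
  | sub (a b : RExp)
  | mul (a b : RExp)
  | div (a b : RExp)
  | sqrt (a : RExp)
  | exp (a : RExp)
  | log (a : RExp)
  | cdf (a : RExp)
  | truncMean (a : RExp)

/-- Tests. -/
inductive BExp where
  | ltN (a b : NExp)
  | ltR (a b : RExp)
  | not (a : BExp)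

/-- Programs. -/
inductive Cmd where
  | skip
  | setN (i : ℕ) (e : NExp)
  | setR (i : ℕ) (e : RExp)
  | store (a : ℕ) (i : NExp) (e : RExp)
  | seq (c₁ c₂ : Cmd)
  | ite (b : BExp) (c₁ c₂ : Cmd)
  | while (b : BExp) (c : Cmd)

def NExp.eval (s : State) : NExp → ℕ
  | .lit n => n
  | .var i => s.nat i
  | .add a b => a.eval s + b.eval s
  | .sub a b => a.eval s - b.eval s
  | .half a => a.eval s / 2

def NExp.cost : NExp → ℕ
  | .lit _ => 1
  | .var _ => 1
  | .add a b => a.cost + b.cost + 1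
  | .sub a b => a.cost + b.cost + 1
  | .half a => a.cost + 1

noncomputable def RExp.eval (O : Oracle) (s : State) : RExp → ℝ
  | .lit q => (q : ℝ)
  | .var i => s.real i
  | .ofNat a => (a.eval s : ℝ)
  | .get a i => s.arr a (i.eval s)
  | .add a b => a.eval O s + b.eval O s
  | .sub a b => a.eval O s - b.eval O s
  | .mul a b => a.eval O s * b.eval O s
  | .div a b => a.eval O s / b.eval O s
  | .sqrt a => Real.sqrt (a.eval O s)
  | .exp a => Real.exp (a.eval O s)
  | .log a => Real.log (a.eval O s)
  | .cdf a => O.cdf (a.eval O s)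
  | .truncMean a => O.truncMean (a.eval O s)

def RExp.cost : RExp → ℕ
  | .lit _ => 1
  | .var _ => 1
  | .ofNat a => a.cost + 1
  | .get _ i => i.cost + 1
  | .add a b => a.cost + b.cost + 1
  | .sub a b => a.cost + b.cost + 1
  | .mul a b => a.cost + b.cost + 1
  | .div a b => a.cost + b.cost + 1
  | .sqrt a => a.cost + 1
  | .exp a => a.cost + 1
  | .log a => a.cost + 1
  | .cdf a => a.cost + 1
  | .truncMean a => a.cost + 1

def BExp.eval (O : Oracle) (s : State) : BExp → Prop
  | .ltN a b => a.eval s < b.eval s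
  | .ltR a b => a.eval O s < b.eval O s
  | .not a => ¬ a.eval O s

def BExp.cost : BExp → ℕ
  | .ltN a b => a.cost + b.cost + 1
  | .ltR a b => a.cost + b.cost + 1
  | .not a => a.cost + 1

/-- `Exec O c s s' t`: the program `c`, started in the state `s`, halts in the state `s'` after
exactly `t` steps. -/
inductive Exec (O : Oracle) : Cmd → State → State → ℕ → Prop where
  | skip (s : State) : Exec O .skip s s 1
  | setN (i : ℕ) (e : NExp) (s : State) :
      Exec O (.setN i e) s { s with nat := Function.update s.nat i (e.eval s) } (e.cost + 1)
  | setR (i : ℕ) (e : RExp) (s : State) :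
      Exec O (.setR i e) s { s with real := Function.update s.real i (e.eval O s) } (e.cost + 1)
  | store (a : ℕ) (i : NExp) (e : RExp) (s : State) :
      Exec O (.store a i e) s
        { s with
          arr := Function.update s.arr a (Function.update (s.arr a) (i.eval s) (e.eval O s)) }
        (i.cost + e.cost + 1)
  | seq (c₁ c₂ : Cmd) (s s₁ s₂ : State) (t₁ t₂ : ℕ) :
      Exec O c₁ s s₁ t₁ → Exec O c₂ s₁ s₂ t₂ → Exec O (.seq c₁ c₂) s s₂ (t₁ + t₂ + 1)
  | ite_true (b : BExp) (c₁ c₂ : Cmd) (s s' : State) (t : ℕ) :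
      b.eval O s → Exec O c₁ s s' t → Exec O (.ite b c₁ c₂) s s' (b.cost + t + 1)
  | ite_false (b : BExp) (c₁ c₂ : Cmd) (s s' : State) (t : ℕ) :
      ¬ b.eval O s → Exec O c₂ s s' t → Exec O (.ite b c₁ c₂) s s' (b.cost + t + 1)
  | while_false (b : BExp) (c : Cmd) (s : State) :
      ¬ b.eval O s → Exec O (.while b c) s s (b.cost + 1)
  | while_true (b : BExp) (c : Cmd) (s s₁ s₂ : State) (t₁ t₂ : ℕ) :
      b.eval O s → Exec O c s s₁ t₁ → Exec O (.while b c) s₁ s₂ t₂ →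
        Exec O (.while b c) s s₂ (b.cost + t₁ + t₂ + 1)

/-- The initial state: the number `k` of compositions in natural-number register 0, the numbers
`ε_error`, `δ_error`, `ε_upper` in real registers 0, 1, 2, and zero everywhere else. -/
def State.input (k : ℕ) (εerr δerr εup : ℝ) : State where
  nat i := if i = 0 then k else 0
  real i := if i = 0 then εerr else if i = 1 then δerr else if i = 2 then εup else 0
  arr _ _ := 0

/-- The number of breakpoints that the program leaves in natural-number register 0. -/
def State.numBreaks (s : State) : ℕ := s.nat 0

/-- The breakpoints, in array 0, are sorted. -/
def State.Sorted (s : State) : Prop :=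
  ∀ i j : ℕ, i ≤ j → j < s.numBreaks → s.arr 0 i ≤ s.arr 0 j

/-- The curve that the program has output, as a table of a function which is piecewise of the form
`ε ↦ A - B e^ε`: with breakpoints `x_0 ≤ ⋯ ≤ x_{n-1}` in array 0, the coefficients on the
interval `x_{j-1} ≤ ε < x_j` are the entries `j` of array 1 (for `A`) and of array 2 (for `B`),
where `x_{-1} = -∞` and `x_n = ∞`. -/
noncomputable def State.outputCurve (s : State) (ε : ℝ) : ℝ :=
  let j := Nat.card {i : ℕ // i < s.numBreaks ∧ s.arr 0 i ≤ ε}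
  s.arr 1 j - s.arr 2 j * Real.exp ε

end RealRAM

/-! Composition. `hockey P Q a b` is the integral of (b − a dP/dQ)⁺ against Q, which is the supremum
of b Q(S) − a P(S) over events. A privacy curve is its value at a = e^ε, b = 1, and by homogeneity
the curve controls it at all finite (a, b). Appending a run to a process with likelihood ratio ℓ
replaces a by a ℓ(x) inside an integral over the earlier outputs x (`hockey_compProd_le` and,
conversely, `lintegral_hockey_le_hockey_compProd`). The double integral of (b − a p q)⁺ is symmetric
in the two factors (`lintegral_hockey_swap`), so the runs can be exchanged one at a time for
coordinates of X against Y, in either direction. This gives part 1.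

Approximation. Since e^{-t} is a version of dX/dY (`IsPRV.lik_ae_eq`), the composed curve at ε is 1
− E min(1, e^{ε − ΣYᵢ}) with Yᵢ independent copies of Y. The program cuts a window (−Hh, Hh] into n
= 2H cells of length h and moves every Yᵢ in it to the left end of its cell plus a common shift,
chosen so that the rounding error has mean zero. Each error lies in an interval of length h, so
Hoeffding bounds the total by ε_error outside probability δ_error/6 for h = ε_error/√(k/2 ·
log(12/δ_error)) (`measureReal_sum_roundErr_le`, `exp_hoeffding`). The centring is what makes h
scale as 1/√k. The law of the rounded sum is computed as a cyclic convolution power. Truncation and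
wraparound matter only if a coordinate or the sum leaves the window. Large losses are rare by the
assumption on ε_upper and a Markov bound; very negative ones by the duality between ε and −ε that
symmetric neighbours provide (`tail_bounds`). The resulting errors are below δ_error/2 in one
direction and below 3δ_error/2 in the other; the term δ_error/2 in the output balances them
(`IsTable.approx`).

Program. The transform is treated as polynomial arithmetic: after a stage the data are the residues
of the input polynomial modulo the factors X^m − ζ_b of X^n − 1, and an inverse stage is the Chinese
remainder theorem for X^{2m} − ζ_b = (X^m − ζ_{2b})(X^m − ζ_{2b+1}) (`FFT.dvd_strand_sub_pow`).
Twiddle factors need only real square roots. As n is of order L/h and k < n², the transforms and the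
repeated squarings both cost O(n log n) (`wp_composePRV`, `steps_le`). -/

namespace DP

open scoped ENNReal

/-! ### The hockey-stick divergence: variational form, homogeneity, fibrewise bounds. -/

section Hockey

variable {α Ω : Type*} [MeasurableSpace α] [MeasurableSpace Ω]

/-- The scaled hockey-stick divergence `sup_S (b Q(S) - a P(S))`, as an integral. -/
noncomputable def hockey (P Q : Measure Ω) (a b : ℝ≥0∞) : ℝ≥0∞ :=
  ∫⁻ x, (b - a * P.rnDeriv Q x) ∂Q

theorem mul_measure_le_hockey (P Q : Measure Ω) (a b : ℝ≥0∞)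
    (S : Set Ω) : b * Q S ≤ hockey P Q a b + a * P S := by
  have hm : Measurable fun x => a * P.rnDeriv Q x := (Measure.measurable_rnDeriv P Q).const_mul a
  calc b * Q S = ∫⁻ _ in S, b ∂Q := by simp
    _ ≤ ∫⁻ x in S, ((b - a * P.rnDeriv Q x) + a * P.rnDeriv Q x) ∂Q :=
        lintegral_mono fun x => le_tsub_add
    _ = ∫⁻ x in S, (b - a * P.rnDeriv Q x) ∂Q + ∫⁻ x in S, a * P.rnDeriv Q x ∂Q :=
        lintegral_add_right _ hm
    _ ≤ hockey P Q a b + a * P S := by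
        gcongr
        · exact setLIntegral_le_lintegral _ _
        · rw [lintegral_const_mul _ (Measure.measurable_rnDeriv P Q)]
          gcongr
          exact Measure.setLIntegral_rnDeriv_le S

/-- The Neyman–Pearson event: off the singular part of `P`, the supremum is attained where a dP/dQ <
b. Any version `l` of the density is allowed, because for kernels a jointly measurable version has
to replace the fibrewise derivative. -/
theorem hockey_add_le_of_support (P Q : Measure Ω) [IsFiniteMeasure P] [IsFiniteMeasure Q]
    (a b : ℝ≥0∞) {l : Ω → ℝ≥0∞} (hl : Measurable l) (hlQ : l =ᵐ[Q] P.rnDeriv Q)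
    {N : Set Ω} (hN : MeasurableSet N) (hQN : Q Nᶜ = 0) (hPN : P.singularPart Q N = 0) :
    hockey P Q a b + a * P (N ∩ {x | a * l x < b}) ≤ b * Q (N ∩ {x | a * l x < b}) := by
  set S := N ∩ {x | a * l x < b} with hSdef
  have hS : MeasurableSet S := hN.inter (measurableSet_lt (hl.const_mul a) measurable_const)
  have h1 : hockey P Q a b = ∫⁻ x in S, (b - a * l x) ∂Q := by
    rw [← lintegral_indicator hS, hockey]
    apply lintegral_congr_ae
    have hN' : ∀ᵐ x ∂Q, x ∈ N := by
      rw [ae_iff]; exact hQN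
    filter_upwards [hlQ, hN'] with x hx hxN
    by_cases h : x ∈ S
    · rw [Set.indicator_of_mem h, hx]
    · rw [Set.indicator_of_notMem h, ← hx]
      have : ¬ a * l x < b := fun h' => h ⟨hxN, h'⟩
      exact tsub_eq_zero_of_le (not_lt.1 this)
  have h2 : P S = ∫⁻ x in S, l x ∂Q := by
    conv_lhs => rw [← Measure.rnDeriv_add_singularPart P Q]
    rw [Measure.add_apply, withDensity_apply _ hS,
      measure_mono_null Set.inter_subset_left hPN, add_zero]
    exact (setLIntegral_congr_fun_ae hS (hlQ.mono fun x hx _ => hx)).symm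
  rw [h1, h2, ← lintegral_const_mul _ hl, ← lintegral_add_right _ (hl.const_mul a)]
  calc _ ≤ ∫⁻ _ in S, b ∂Q := by
        apply setLIntegral_mono measurable_const
        intro x hx
        exact (tsub_add_cancel_of_le hx.2.le).le
    _ = b * Q S := by simp

theorem exists_hockey_add_le (P Q : Measure Ω) [IsFiniteMeasure P] [IsFiniteMeasure Q]
    (a b : ℝ≥0∞) : ∃ S, MeasurableSet S ∧ hockey P Q a b + a * P S ≤ b * Q S := by
  have h := Measure.mutuallySingular_singularPart P Q
  have hm := Measure.measurable_rnDeriv P Q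
  refine ⟨_, ?_, hockey_add_le_of_support P Q a b hm (Filter.EventuallyEq.refl _ _)
    h.measurableSet_nullSet h.measure_compl_nullSet h.measure_nullSet⟩
  exact h.measurableSet_nullSet.inter (measurableSet_lt (hm.const_mul a) measurable_const)

theorem hockey_le_iff (P Q : Measure Ω) [IsFiniteMeasure P] [IsFiniteMeasure Q]
    {a b c : ℝ≥0∞} (ha : a ≠ ∞) :
    hockey P Q a b ≤ c ↔ ∀ S, MeasurableSet S → b * Q S ≤ c + a * P S := by
  constructor
  · intro h S _
    exact (mul_measure_le_hockey P Q a b S).trans (by gcongr)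
  · intro h
    obtain ⟨S, hS, h'⟩ := exists_hockey_add_le P Q a b
    exact (ENNReal.add_le_add_iff_right (ENNReal.mul_ne_top ha (measure_ne_top P S))).1
      (h'.trans (h S hS))

theorem hockey_map_equiv (P Q : Measure α) [IsFiniteMeasure P] [IsFiniteMeasure Q] (e : α ≃ᵐ Ω)
    {a b : ℝ≥0∞} (ha : a ≠ ∞) : hockey (P.map e) (Q.map e) a b = hockey P Q a b := by
  apply le_antisymm
  · rw [hockey_le_iff _ _ ha]
    intro S _
    rw [e.map_apply, e.map_apply]
    exact mul_measure_le_hockey P Q a b _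
  · rw [hockey_le_iff _ _ ha]
    intro S _
    have := mul_measure_le_hockey (P.map e) (Q.map e) a b (e.symm ⁻¹' S)
    rwa [e.map_apply, e.map_apply, ← Set.preimage_comp, e.symm_comp_self, Set.preimage_id] at this

theorem hockey_le_mul (P Q : Measure Ω) [IsProbabilityMeasure Q] (a b : ℝ≥0∞) :
    hockey P Q a b ≤ b := by
  calc hockey P Q a b ≤ ∫⁻ _, b ∂Q := lintegral_mono fun x => tsub_le_self
    _ = b := by simp

theorem hockey_smul (P Q : Measure Ω) {a b c : ℝ≥0∞} (hc : c ≠ ∞) :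
    hockey P Q (c * a) (c * b) = c * hockey P Q a b := by
  have hm : Measurable fun x => b - a * P.rnDeriv Q x :=
    measurable_const.sub ((Measure.measurable_rnDeriv P Q).const_mul a)
  rw [hockey, hockey, ← lintegral_const_mul _ hm]
  refine lintegral_congr fun x => ?_
  rw [mul_assoc, ENNReal.mul_sub fun _ _ => hc]

theorem bddAbove_privacyCurve (P Q : Measure Ω) [IsProbabilityMeasure Q] (ε : ℝ) :
    BddAbove (Set.range fun S : {S : Set Ω // MeasurableSet S} =>
      (Q.real S.1 - Real.exp ε * P.real S.1)) := by
  refine ⟨1, ?_⟩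
  rintro _ ⟨S, rfl⟩
  have h1 : Q.real S.1 ≤ 1 := measureReal_le_one
  have h2 : 0 ≤ Real.exp ε * P.real S.1 := by positivity
  simp only
  linarith

theorem privacyCurve_nonneg (P Q : Measure Ω) [IsProbabilityMeasure Q] (ε : ℝ) :
    0 ≤ privacyCurve P Q ε :=
  (by simp : (0:ℝ) ≤ Q.real (∅ : Set Ω) - Real.exp ε * P.real (∅ : Set Ω)).trans
    (le_ciSup (bddAbove_privacyCurve P Q ε) ⟨∅, MeasurableSet.empty⟩)

theorem le_privacyCurve (P Q : Measure Ω) [IsProbabilityMeasure Q] (ε : ℝ) {S : Set Ω}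
    (hS : MeasurableSet S) : Q.real S - Real.exp ε * P.real S ≤ privacyCurve P Q ε :=
  le_ciSup (bddAbove_privacyCurve P Q ε) ⟨S, hS⟩

theorem privacyCurve_le_iff (P Q : Measure Ω) [IsProbabilityMeasure Q] {ε c : ℝ} :
    privacyCurve P Q ε ≤ c ↔ ∀ S, MeasurableSet S → Q.real S - Real.exp ε * P.real S ≤ c := by
  constructor
  · intro h S hS
    exact (le_privacyCurve P Q ε hS).trans h
  · intro h
    have : Nonempty {S : Set Ω // MeasurableSet S} := ⟨⟨∅, MeasurableSet.empty⟩⟩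
    exact ciSup_le fun S => h S.1 S.2

theorem ofReal_privacyCurve (P Q : Measure Ω) [IsProbabilityMeasure P] [IsProbabilityMeasure Q]
    (ε : ℝ) : ENNReal.ofReal (privacyCurve P Q ε) = hockey P Q (ENNReal.ofReal (Real.exp ε)) 1 := by
  have key : ∀ (S : Set Ω) (c : ℝ), 0 ≤ c → (1 * Q S ≤ ENNReal.ofReal c +
      ENNReal.ofReal (Real.exp ε) * P S ↔ Q.real S - Real.exp ε * P.real S ≤ c) := by
    intro S c hc
    rw [one_mul, ← ofReal_measureReal (μ := Q) (s := S), ← ofReal_measureReal (μ := P) (s := S),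
      ← ENNReal.ofReal_mul (Real.exp_pos ε).le, ← ENNReal.ofReal_add hc (by positivity),
      ENNReal.ofReal_le_ofReal_iff (by positivity)]
    constructor <;> intro h <;> linarith
  have hD : hockey P Q (ENNReal.ofReal (Real.exp ε)) 1 ≠ ∞ :=
    ((hockey_le_mul P Q _ 1).trans_lt ENNReal.one_lt_top).ne
  apply le_antisymm
  · rw [← ENNReal.ofReal_toReal hD]
    apply ENNReal.ofReal_le_ofReal
    rw [privacyCurve_le_iff]
    intro S _
    rw [← key S _ ENNReal.toReal_nonneg, ENNReal.ofReal_toReal hD]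
    exact mul_measure_le_hockey P Q _ 1 S
  · rw [hockey_le_iff _ _ ENNReal.ofReal_ne_top]
    intro S hS
    rw [key S _ (privacyCurve_nonneg P Q ε)]
    exact le_privacyCurve P Q ε hS

/-- A curve sees the pairs (a, b) with a/b = e^ε; homogeneity supplies the others, the degenerate a
= 0 and b = 0 apart. All a are needed because composition multiplies a by a likelihood ratio, which
may vanish. -/
theorem hockey_le_of_privacyCurve_le {P Q : Measure Ω} {X Y : Measure α} [IsProbabilityMeasure P]
    [IsProbabilityMeasure Q] [IsProbabilityMeasure X] [IsProbabilityMeasure Y]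
    (h : ∀ ε, privacyCurve P Q ε ≤ privacyCurve X Y ε) {a b : ℝ≥0∞} (ha : a ≠ ∞) (hb : b ≠ ∞) :
    hockey P Q a b ≤ hockey X Y a b := by
  rcases eq_or_ne b 0 with rfl | hb0
  · exact (hockey_le_mul P Q a 0).trans zero_le
  rcases eq_or_ne a 0 with rfl | ha0
  · simp [hockey]
  set r := a / b
  have hr0 : r ≠ 0 := (ENNReal.div_pos ha0 hb).ne'
  have hrt : r ≠ ∞ := ENNReal.div_ne_top ha hb0
  have hpos : 0 < r.toReal := ENNReal.toReal_pos hr0 hrt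
  have hr : ENNReal.ofReal (Real.exp (Real.log r.toReal)) = r := by
    rw [Real.exp_log hpos, ENNReal.ofReal_toReal hrt]
  have e1 : a = b * r := by rw [mul_comm]; exact (ENNReal.div_mul_cancel hb0 hb).symm
  have := ENNReal.ofReal_le_ofReal (h (Real.log r.toReal))
  rw [ofReal_privacyCurve, ofReal_privacyCurve, hr] at this
  calc hockey P Q a b = b * hockey P Q r 1 := by rw [← hockey_smul P Q hb, mul_one, ← e1]
    _ ≤ b * hockey X Y r 1 := by gcongr
    _ = hockey X Y a b := by rw [← hockey_smul X Y hb, mul_one, ← e1]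

/-- Both sides are the double integral of (b − a p(x) q(t))⁺, p and q being the two densities, so
Tonelli applies. This lets one factor of a composition be replaced while the other is held fixed. -/
theorem lintegral_hockey_swap (P Q : Measure α) (X Y : Measure Ω) [IsFiniteMeasure Q]
    [IsFiniteMeasure Y] (a b : ℝ≥0∞) :
    ∫⁻ x, hockey X Y (a * P.rnDeriv Q x) b ∂Q = ∫⁻ t, hockey P Q (a * X.rnDeriv Y t) b ∂Y := by
  simp only [hockey]
  rw [lintegral_lintegral_swap]
  · refine lintegral_congr fun t => lintegral_congr fun x => ?_
    rw [mul_right_comm]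
  · apply Measurable.aemeasurable
    apply Measurable.sub measurable_const
    exact (((Measure.measurable_rnDeriv P Q).comp measurable_fst).const_mul a).mul
      ((Measure.measurable_rnDeriv X Y).comp measurable_snd)

theorem measurable_hockey {β : Type*} [MeasurableSpace β] (X Y : Measure Ω) [SFinite Y]
    {f : β → ℝ≥0∞} (hf : Measurable f) (b : ℝ≥0∞) : Measurable fun x => hockey X Y (f x) b := by
  apply Measurable.lintegral_prod_right'
    (f := fun p : β × Ω => b - f p.1 * X.rnDeriv Y p.2)
  exact measurable_const.sub ((hf.comp measurable_fst).mul
      ((Measure.measurable_rnDeriv X Y).comp measurable_snd))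

/-- Any event is bounded fibre by fibre, with a multiplied by the density at x. Dropping the
singular part of `P` is harmless, since it only lowers the subtracted term. -/
theorem hockey_compProd_le (P Q : Measure α) [IsProbabilityMeasure P] [IsProbabilityMeasure Q]
    (κ η : Kernel α Ω) [IsMarkovKernel κ] [IsMarkovKernel η]
    {β : Type*} [MeasurableSpace β] (X Y : Measure β) [IsFiniteMeasure X] [IsFiniteMeasure Y]
    (h : ∀ x, ∀ a b : ℝ≥0∞, a ≠ ∞ → b ≠ ∞ → hockey (κ x) (η x) a b ≤ hockey X Y a b)
    {a b : ℝ≥0∞} (ha : a ≠ ∞) (hb : b ≠ ∞) :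
    hockey (P ⊗ₘ κ) (Q ⊗ₘ η) a b ≤ ∫⁻ x, hockey X Y (a * P.rnDeriv Q x) b ∂Q := by
  rw [hockey_le_iff _ _ ha]
  intro S hS
  have hG := measurable_hockey X Y ((Measure.measurable_rnDeriv P Q).const_mul a) b
  have hκ : Measurable fun x => κ x (Prod.mk x ⁻¹' S) := Kernel.measurable_kernel_prodMk_left hS
  have hη : Measurable fun x => η x (Prod.mk x ⁻¹' S) := Kernel.measurable_kernel_prodMk_left hS
  have hℓ := Measure.measurable_rnDeriv P Q
  rw [Measure.compProd_apply hS, Measure.compProd_apply hS]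
  calc b * ∫⁻ x, η x (Prod.mk x ⁻¹' S) ∂Q = ∫⁻ x, b * η x (Prod.mk x ⁻¹' S) ∂Q :=
        (lintegral_const_mul _ hη).symm
    _ ≤ ∫⁻ x, (hockey X Y (a * P.rnDeriv Q x) b +
          a * (P.rnDeriv Q x * κ x (Prod.mk x ⁻¹' S))) ∂Q := by
        apply lintegral_mono_ae
        filter_upwards [Measure.rnDeriv_lt_top P Q] with x hx
        rw [← mul_assoc]
        exact (mul_measure_le_hockey (κ x) (η x) _ b _).trans
          (add_le_add_left (h x _ _ (ENNReal.mul_ne_top ha hx.ne) hb) _)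
    _ = ∫⁻ x, hockey X Y (a * P.rnDeriv Q x) b ∂Q +
          a * ∫⁻ x, P.rnDeriv Q x * κ x (Prod.mk x ⁻¹' S) ∂Q := by
        rw [lintegral_add_left hG]
        congr 1
        exact lintegral_const_mul _ (hℓ.mul hκ)
    _ ≤ _ := by
        refine add_le_add_right (mul_le_mul_right ?_ a) _
        exact (lintegral_withDensity_eq_lintegral_mul _ hℓ hκ).symm.trans_le
          (lintegral_mono' (Measure.withDensity_rnDeriv_le P Q) le_rfl)

/-- The optimal events of the fibres are glued into one measurable event. Joint measurability comes
from `Kernel.rnDeriv`, and this is where a countably generated output space enters. -/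
theorem lintegral_hockey_le_hockey_compProd [MeasurableSpace.CountablyGenerated Ω]
    (P Q : Measure α) [IsProbabilityMeasure P] [IsProbabilityMeasure Q]
    (κ η : Kernel α Ω) [IsMarkovKernel κ] [IsMarkovKernel η] {a b : ℝ≥0∞} (ha : a ≠ ∞) :
    ∫⁻ x, hockey (κ x) (η x) (a * P.rnDeriv Q x) b ∂Q ≤ hockey (P ⊗ₘ κ) (Q ⊗ₘ η) a b := by
  have h := Measure.mutuallySingular_singularPart P Q
  have hℓ := Measure.measurable_rnDeriv P Q
  have hr := Kernel.measurable_rnDeriv κ η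
  set N := h.nullSet
  have hN : MeasurableSet N := h.measurableSet_nullSet
  set R : Set (α × Ω) := {p | a * P.rnDeriv Q p.1 * Kernel.rnDeriv κ η p.1 p.2 < b}
  have hR : MeasurableSet R :=
    measurableSet_lt (((hℓ.comp measurable_fst).const_mul a).mul hr) measurable_const
  -- Over `N` every slice is a Neyman–Pearson event. `N` discards the singular part of `P`, and the
  -- complement of `mutuallySingularSet` discards the singular parts of the fibres.
  set S : Set (α × Ω) := Prod.fst ⁻¹' N ∩ ((Kernel.mutuallySingularSet κ η)ᶜ ∩ R) with hSdef
  have hS : MeasurableSet S := (measurable_fst hN).inter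
    ((Kernel.measurableSet_mutuallySingularSet κ η).compl.inter hR)
  have hκ : Measurable fun x => κ x (Prod.mk x ⁻¹' S) := Kernel.measurable_kernel_prodMk_left hS
  have hη : Measurable fun x => η x (Prod.mk x ⁻¹' S) := Kernel.measurable_kernel_prodMk_left hS
  have hP : ∫⁻ x, κ x (Prod.mk x ⁻¹' S) ∂P =
      ∫⁻ x, P.rnDeriv Q x * κ x (Prod.mk x ⁻¹' S) ∂Q := by
    conv_lhs => rw [← Measure.rnDeriv_add_singularPart P Q]
    rw [lintegral_add_measure, lintegral_withDensity_eq_lintegral_mul _ hℓ hκ]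
    have : ∫⁻ x, κ x (Prod.mk x ⁻¹' S) ∂(P.singularPart Q) = 0 := by
      rw [lintegral_eq_zero_iff hκ]
      have h0 : ∀ᵐ x ∂(P.singularPart Q), x ∉ N := by
        rw [ae_iff]; simpa only [not_not, Set.ofPred_mem_eq] using h.measure_nullSet
      filter_upwards [h0] with x hx
      have : Prod.mk x ⁻¹' S = ∅ := by
        ext y; simp [hSdef, hx]
      simp [this]
    rw [this, add_zero]; rfl
  have hfin : a * (P ⊗ₘ κ) S ≠ ∞ := ENNReal.mul_ne_top ha (measure_ne_top _ _)
  rw [← ENNReal.add_le_add_iff_right hfin]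
  refine le_trans ?_ (mul_measure_le_hockey _ _ a b S)
  rw [Measure.compProd_apply hS, Measure.compProd_apply hS, hP,
    ← lintegral_const_mul _ hη]
  refine le_of_eq_of_le (b := ∫⁻ x, (hockey (κ x) (η x) (a * P.rnDeriv Q x) b +
    a * (P.rnDeriv Q x * κ x (Prod.mk x ⁻¹' S))) ∂Q) ?_ ?_
  · refine Eq.trans ?_ (lintegral_add_right _ ((hℓ.mul hκ).const_mul a)).symm
    congr 1
    exact (lintegral_const_mul _ (hℓ.mul hκ)).symm
  apply lintegral_mono_ae
  have hN' : ∀ᵐ x ∂Q, x ∈ N := by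
    rw [ae_iff]; exact h.measure_compl_nullSet
  filter_upwards [hN'] with x hx
  have hpre : Prod.mk x ⁻¹' S = (Kernel.mutuallySingularSetSlice κ η x)ᶜ ∩
      {y | a * P.rnDeriv Q x * Kernel.rnDeriv κ η x y < b} := by
    ext y
    simp only [hSdef, Set.mem_preimage, Set.mem_inter_iff, hx, true_and, Set.mem_compl_iff]
    rfl
  rw [← mul_assoc, hpre]
  apply hockey_add_le_of_support (κ x) (η x) (a * P.rnDeriv Q x) b
    (hr.comp measurable_prodMk_left) Kernel.rnDeriv_eq_rnDeriv_measure
    (Kernel.measurableSet_mutuallySingularSetSlice κ η x).compl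
  · rw [compl_compl]; exact Kernel.measure_mutuallySingularSetSlice κ η x
  · rw [← Kernel.singularPart_eq_singularPart_measure]
    exact Kernel.singularPart_compl_mutuallySingularSetSlice κ η x

end Hockey

/-! ### Product laws and adaptive compositions, one coordinate at a time. -/

section Composition

/-- Appending the last coordinate, as a measurable equivalence. -/
def snocEquiv (Ω : Type*) [MeasurableSpace Ω] (n : ℕ) :
    ((Fin n → Ω) × Ω) ≃ᵐ (Fin (n + 1) → Ω) :=
  MeasurableEquiv.prodComm.trans
    (MeasurableEquiv.piFinSuccAbove (fun _ : Fin (n + 1) => Ω) (Fin.last n)).symm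

theorem snocEquiv_apply {Ω : Type*} [MeasurableSpace Ω] (n : ℕ) (p : (Fin n → Ω) × Ω) :
    snocEquiv Ω n p = (Fin.snoc p.1 p.2 : Fin (n + 1) → Ω) := by
  change Fin.insertNth (α := fun _ => Ω) (Fin.last n) p.2 p.1 = _
  rw [Fin.insertNth_last']

theorem pi_succ_eq_map {Ω : Type*} [MeasurableSpace Ω] (X : Measure Ω) [SigmaFinite X] (n : ℕ) :
    (Measure.pi fun _ : Fin (n + 1) => X) =
      ((Measure.pi fun _ : Fin n => X).prod X).map (snocEquiv Ω n) := by
  have h := (measurePreserving_piFinSuccAbove (fun _ : Fin (n + 1) => X) (Fin.last n)).symm.map_eq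
  rw [← h, snocEquiv, MeasurableEquiv.coe_trans,
    ← Measure.map_map (MeasurableEquiv.measurable _) (MeasurableEquiv.measurable _)]
  congr 1
  exact (Measure.prod_swap (μ := (Measure.pi fun _ : Fin n => X)) (ν := X)).symm

variable {𝒟 A Ω : Type*} [MeasurableSpace A] [MeasurableSpace Ω]

theorem adaptiveComp_succ (M : 𝒟 → Kernel A Ω) (pick : ∀ n : ℕ, (Fin n → Ω) → A)
    (hpick : ∀ n, Measurable (pick n)) (D : 𝒟) (n : ℕ) :
    adaptiveComp M pick hpick D (n + 1) =
      (adaptiveComp M pick hpick D n ⊗ₘ ((M D).comap (pick n) (hpick n))).map (snocEquiv Ω n) := by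
  rw [adaptiveComp]
  congr 1
  ext p : 1
  exact (snocEquiv_apply n p).symm

instance isProbabilityMeasure_adaptiveComp (M : 𝒟 → Kernel A Ω) [∀ D, IsMarkovKernel (M D)]
    (pick : ∀ n : ℕ, (Fin n → Ω) → A) (hpick : ∀ n, Measurable (pick n)) (D : 𝒟) (n : ℕ) :
    IsProbabilityMeasure (adaptiveComp M pick hpick D n) := by
  induction n with
  | zero => rw [adaptiveComp]; infer_instance
  | succ n ih =>
    rw [adaptiveComp_succ]
    exact Measure.isProbabilityMeasure_map (snocEquiv Ω n).measurable.aemeasurable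

/-- Base case of the inductions, with no runs at all: the only events are the empty one and the
whole space, and every pair of probability measures has these to offer. -/
theorem hockey_le_of_unique {Ω₁ Ω₂ : Type*} [MeasurableSpace Ω₁] [MeasurableSpace Ω₂]
    (P Q : Measure Ω₁) (P' Q' : Measure Ω₂) [IsProbabilityMeasure P] [IsProbabilityMeasure Q]
    [IsProbabilityMeasure P'] [IsProbabilityMeasure Q'] [Subsingleton Ω₁]
    {a b : ℝ≥0∞} (ha : a ≠ ∞) : hockey P Q a b ≤ hockey P' Q' a b := by
  rw [hockey_le_iff _ _ ha]
  intro S _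
  rcases Set.eq_empty_or_nonempty S with rfl | hS
  · simp
  · have : S = Set.univ := Subsingleton.eq_univ_of_nonempty hS
    subst this
    simpa using mul_measure_le_hockey P' Q' a b Set.univ

/-- For constant kernels the two fibrewise bounds coincide. The swap puts the first `n` coordinates
inside the integral, so that an induction hypothesis can be applied to them at a rescaled `a`. -/
theorem hockey_pi_succ {Ω : Type*} [MeasurableSpace Ω] [MeasurableSpace.CountablyGenerated Ω]
    (X Y : Measure Ω) [IsProbabilityMeasure X] [IsProbabilityMeasure Y] (n : ℕ)
    {a b : ℝ≥0∞} (ha : a ≠ ∞) (hb : b ≠ ∞) :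
    hockey (Measure.pi fun _ : Fin (n + 1) => X) (Measure.pi fun _ : Fin (n + 1) => Y) a b =
      ∫⁻ t, hockey (Measure.pi fun _ : Fin n => X) (Measure.pi fun _ : Fin n => Y)
        (a * X.rnDeriv Y t) b ∂Y := by
  rw [pi_succ_eq_map, pi_succ_eq_map, hockey_map_equiv _ _ _ ha, ← lintegral_hockey_swap]
  set P := Measure.pi fun _ : Fin n => X
  set Q := Measure.pi fun _ : Fin n => Y
  rw [← Measure.compProd_const, ← Measure.compProd_const]
  apply le_antisymm
  · exact hockey_compProd_le P Q _ _ X Y (fun x a b _ _ => by simp) ha hb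
  · simpa using lintegral_hockey_le_hockey_compProd P Q (Kernel.const _ X) (Kernel.const _ Y)
      (a := a) (b := b) ha

/-- A hybrid argument: the last run is traded for a coordinate of X against Y, then the swap brings
the earlier runs inside and the induction hypothesis applies with `a` times the likelihood ratio of
that coordinate. Hence the generalization over `a`. -/
theorem hockey_adaptiveComp_le (M : 𝒟 → Kernel A Ω) [∀ D, IsMarkovKernel (M D)]
    (pick : ∀ n : ℕ, (Fin n → Ω) → A) (hpick : ∀ n, Measurable (pick n)) (D D' : 𝒟)
    {Ω' : Type*} [MeasurableSpace Ω'] [MeasurableSpace.CountablyGenerated Ω'] (X Y : Measure Ω')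
    [IsProbabilityMeasure X] [IsProbabilityMeasure Y]
    (h : ∀ x, ∀ a b : ℝ≥0∞, a ≠ ∞ → b ≠ ∞ → hockey (M D' x) (M D x) a b ≤ hockey X Y a b)
    (n : ℕ) {a b : ℝ≥0∞} (ha : a ≠ ∞) (hb : b ≠ ∞) :
    hockey (adaptiveComp M pick hpick D' n) (adaptiveComp M pick hpick D n) a b ≤
      hockey (Measure.pi fun _ : Fin n => X) (Measure.pi fun _ : Fin n => Y) a b := by
  induction n generalizing a with
  | zero => exact hockey_le_of_unique _ _ _ _ ha
  | succ n ih =>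
    rw [adaptiveComp_succ, adaptiveComp_succ, hockey_map_equiv _ _ _ ha, hockey_pi_succ X Y n ha hb]
    refine (hockey_compProd_le _ _ _ _ X Y (fun x a b ha hb => ?_) ha hb).trans ?_
    · rw [Kernel.comap_apply, Kernel.comap_apply]
      exact h _ a b ha hb
    · rw [lintegral_hockey_swap]
      apply lintegral_mono_ae
      filter_upwards [Measure.rnDeriv_lt_top X Y] with t ht
      exact ih (ENNReal.mul_ne_top ha ht.ne)

/-- The same exchange in the other order: the earlier runs are traded first, by the induction
hypothesis, and the last one after the swap. -/
theorem le_hockey_adaptiveComp [MeasurableSpace.CountablyGenerated Ω]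
    (M : 𝒟 → Kernel A Ω) [∀ D, IsMarkovKernel (M D)]
    (pick : ∀ n : ℕ, (Fin n → Ω) → A) (hpick : ∀ n, Measurable (pick n)) (D D' : 𝒟)
    {Ω' : Type*} [MeasurableSpace Ω'] [MeasurableSpace.CountablyGenerated Ω'] (X Y : Measure Ω')
    [IsProbabilityMeasure X] [IsProbabilityMeasure Y]
    (h : ∀ x, ∀ a b : ℝ≥0∞, a ≠ ∞ → b ≠ ∞ → hockey X Y a b ≤ hockey (M D' x) (M D x) a b)
    (n : ℕ) {a b : ℝ≥0∞} (ha : a ≠ ∞) (hb : b ≠ ∞) :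
    hockey (Measure.pi fun _ : Fin n => X) (Measure.pi fun _ : Fin n => Y) a b ≤
      hockey (adaptiveComp M pick hpick D' n) (adaptiveComp M pick hpick D n) a b := by
  induction n generalizing a with
  | zero => exact hockey_le_of_unique _ _ _ _ ha
  | succ n ih =>
    rw [adaptiveComp_succ, adaptiveComp_succ, hockey_map_equiv _ _ _ ha, hockey_pi_succ X Y n ha hb]
    refine le_trans ?_ (lintegral_hockey_le_hockey_compProd _ _ _ _ ha)
    calc _ ≤ ∫⁻ t, hockey (adaptiveComp M pick hpick D' n) (adaptiveComp M pick hpick D n)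
            (a * X.rnDeriv Y t) b ∂Y := by
          apply lintegral_mono_ae
          filter_upwards [Measure.rnDeriv_lt_top X Y] with t ht
          exact ih (ENNReal.mul_ne_top ha ht.ne)
      _ ≤ _ := by
          rw [← lintegral_hockey_swap]
          apply lintegral_mono_ae
          filter_upwards [Measure.rnDeriv_lt_top (adaptiveComp M pick hpick D' n)
            (adaptiveComp M pick hpick D n)] with x hx
          rw [Kernel.comap_apply, Kernel.comap_apply]
          exact h _ _ b (ENNReal.mul_ne_top ha hx.ne) hb

end Composition

end DP

namespace DP

open scoped ENNReal

/-- The likelihood ratio `e^{-t}` of privacy loss random variables. -/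
noncomputable def lik (t : EReal) : ℝ≥0∞ := EReal.exp (-t)

theorem measurable_lik : Measurable lik := EReal.measurable_exp.comp measurable_neg

/-! ### The likelihood ratio of privacy loss random variables. -/

section PRV

variable {δ : ℝ → ℝ} {X Y : Measure EReal}

/-- Inverts dY = e^t dX on the real points. At +∞ the factor `lik` is 0, so an atom of `Y` there
disappears, and `Y` has none at −∞. -/
theorem IsPRV.withDensity_lik (h : IsPRV δ X Y) :
    Y.withDensity lik = X.restrict {⊥, ⊤}ᶜ := by
  set R : Set EReal := {⊥, ⊤}ᶜ with hRdef
  have hR : MeasurableSet R := ((measurableSet_singleton _).insert _).compl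
  have hw : Measurable EReal.exp := EReal.measurable_exp
  have h1 : Y.restrict R = (X.restrict R).withDensity EReal.exp := by
    ext S hS
    rw [Measure.restrict_apply hS, withDensity_apply _ hS, Measure.restrict_restrict hS]
    have hSR := hS.inter hR
    have := h.change ((S ∩ R).indicator fun _ => 1) (measurable_const.indicator hSR)
      (fun t => Set.indicator_le_self' (fun _ _ => zero_le) t |>.trans le_rfl)
      (by simp [hRdef]) (by simp [hRdef])
    rw [lintegral_indicator hSR] at this
    simp only [lintegral_const, one_mul, Measure.restrict_apply, MeasurableSet.univ,
      Set.univ_inter] at this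
    rw [this, ← lintegral_indicator hSR]
    refine lintegral_congr fun t => ?_
    by_cases ht : t ∈ S ∩ R
    · rw [Set.indicator_of_mem ht, Set.indicator_of_mem ht, one_mul]
      have ht' := ht.2
      induction t with
      | bot => simp [hRdef] at ht'
      | top => simp [hRdef] at ht'
      | coe x => simp
    · rw [Set.indicator_of_notMem ht, Set.indicator_of_notMem ht, zero_mul]
  have hwR : ∀ᵐ t ∂(X.restrict R), t ∈ R := ae_restrict_mem hR
  have h2 : (Y.restrict R).withDensity lik = X.restrict R := by
    have : lik = fun t => (EReal.exp t)⁻¹ := by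
      ext t; exact EReal.exp_neg t
    rw [h1, this]
    apply withDensity_inv_same hw
    · filter_upwards [hwR] with t ht h0
      rw [EReal.exp_eq_zero_iff] at h0
      simp [hRdef, h0] at ht
    · filter_upwards [hwR] with t ht h0
      rw [EReal.exp_eq_top_iff] at h0
      simp [hRdef, h0] at ht
  have h3 : (Y.restrict Rᶜ).withDensity lik = 0 := by
    rw [withDensity_eq_zero_iff measurable_lik.aemeasurable]
    have hb : ∀ᵐ t ∂(Y.restrict Rᶜ), t ≠ ⊥ :=
      ae_restrict_of_ae (by rw [ae_iff]; simpa using h.right_bot)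
    filter_upwards [ae_restrict_mem hR.compl, hb] with t ht htb
    rw [hRdef, compl_compl] at ht
    rcases ht with ht | ht
    · exact absurd ht htb
    · rw [Set.mem_singleton_iff.1 ht]; simp [lik]
  ext S hS
  have e1 : (Y.withDensity lik) S =
      (Y.restrict R).withDensity lik S + (Y.restrict Rᶜ).withDensity lik S := by
    rw [withDensity_apply _ hS, withDensity_apply _ hS, withDensity_apply _ hS,
      ← lintegral_add_measure, ← Measure.restrict_add, Measure.restrict_add_restrict_compl hR]
  rw [e1, h2, h3]; simp

/-- What is left of `X` sits at −∞, where `Y` has no mass; it is the singular part. -/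
theorem IsPRV.lik_ae_eq (h : IsPRV δ X Y) : lik =ᵐ[Y] X.rnDeriv Y := by
  have := h.prob_right
  refine Measure.eq_rnDeriv (s := X.restrict {⊥, ⊤}) measurable_lik ?_ ?_
  · refine ⟨{⊥}ᶜ, (measurableSet_singleton _).compl, ?_, ?_⟩
    · rw [Measure.restrict_apply (measurableSet_singleton _).compl]
      refine measure_mono_null ?_ h.left_top
      rintro t ⟨h1, h2⟩
      rcases h2 with h2 | h2
      · exact absurd h2 h1
      · exact h2
    · rw [compl_compl]; exact h.right_bot
  · rw [h.withDensity_lik]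
    exact (Measure.restrict_add_restrict_compl ((measurableSet_singleton _).insert _)).symm

theorem IsPRV.lintegral_lik_le (h : IsPRV δ X Y) : ∫⁻ t, lik t ∂Y ≤ 1 := by
  have := h.prob_left
  have h1 := congrArg (fun μ : Measure EReal => μ Set.univ) h.withDensity_lik
  simp only [withDensity_apply _ MeasurableSet.univ, Measure.restrict_univ] at h1
  rw [h1]
  exact (Measure.restrict_apply_le _ _).trans prob_le_one

theorem IsPRV.hockey_eq (h : IsPRV δ X Y) (a b : ℝ≥0∞) :
    hockey X Y a b = ∫⁻ t, (b - a * lik t) ∂Y :=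
  lintegral_congr_ae (h.lik_ae_eq.mono fun t ht => by simp only [ht])

/-- The likelihood ratio of the vectors of independent copies. -/
noncomputable def likProd {k : ℕ} (y : Fin k → EReal) : ℝ≥0∞ := ∏ i, lik (y i)

theorem measurable_likProd {k : ℕ} : Measurable (likProd (k := k)) :=
  Finset.measurable_fun_prod _ fun i _ => measurable_lik.comp (measurable_pi_apply i)

/-- The derivative of the product measures is never computed: the recursion `hockey_pi_succ`
multiplies `a` by one factor e^{-t} per coordinate. -/
theorem IsPRV.hockey_pi_eq (h : IsPRV δ X Y) (k : ℕ) {a b : ℝ≥0∞} (ha : a ≠ ∞) (hb : b ≠ ∞) :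
    hockey (Measure.pi fun _ : Fin k => X) (Measure.pi fun _ : Fin k => Y) a b =
      ∫⁻ y, (b - a * likProd y) ∂(Measure.pi fun _ : Fin k => Y) := by
  have := h.prob_left
  have := h.prob_right
  induction k generalizing a with
  | zero =>
    have e : (Measure.pi fun _ : Fin 0 => X) = Measure.pi fun _ : Fin 0 => Y := by
      rw [Measure.pi_of_empty, Measure.pi_of_empty]
    rw [e, hockey]
    apply lintegral_congr_ae
    filter_upwards [Measure.rnDeriv_self (Measure.pi fun _ : Fin 0 => Y)] with y hy
    simp [hy, likProd]
  | succ n ih =>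
    rw [hockey_pi_succ X Y n ha hb, pi_succ_eq_map Y n, lintegral_map_equiv,
      lintegral_prod_symm]
    · apply lintegral_congr_ae
      filter_upwards [h.lik_ae_eq, Measure.rnDeriv_lt_top X Y] with t ht ht'
      rw [ih (ENNReal.mul_ne_top ha ht'.ne), ← ht]
      refine lintegral_congr fun y => ?_
      simp only [snocEquiv_apply, likProd, Fin.prod_univ_castSucc, Fin.snoc_castSucc,
        Fin.snoc_last]
      rw [mul_assoc, mul_comm (lik t)]
    · exact (measurable_const.sub ((measurable_likProd.comp
        (snocEquiv EReal n).measurable).const_mul a)).aemeasurable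

theorem IsPRV.ofReal_composedCurve (h : IsPRV δ X Y) (k : ℕ) (ε : ℝ) :
    ENNReal.ofReal (composedCurve k X Y ε) =
      ∫⁻ y, (1 - ENNReal.ofReal (Real.exp ε) * likProd y) ∂(Measure.pi fun _ : Fin k => Y) := by
  have := h.prob_left
  have := h.prob_right
  rw [composedCurve, ofReal_privacyCurve, h.hockey_pi_eq k ENNReal.ofReal_ne_top ENNReal.one_ne_top]

theorem IsPRV.ofReal_curve (h : IsPRV δ X Y) (ε : ℝ) :
    ENNReal.ofReal (δ ε) = ∫⁻ t, (1 - ENNReal.ofReal (Real.exp ε) * lik t) ∂Y := by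
  have := h.prob_left
  have := h.prob_right
  rw [← h.curve, ofReal_privacyCurve, h.hockey_eq]

theorem lintegral_prod_pi {k : ℕ} (Y : Measure EReal) [IsProbabilityMeasure Y]
    (f : Fin k → EReal → ℝ≥0∞) (hf : ∀ i, Measurable (f i)) :
    ∫⁻ y, ∏ i, f i (y i) ∂(Measure.pi fun _ : Fin k => Y) = ∏ i, ∫⁻ t, f i t ∂Y := by
  have hind : iIndepFun (fun i (y : Fin k → EReal) => f i (y i)) (Measure.pi fun _ : Fin k => Y) :=
    iIndepFun_pi fun i => (hf i).aemeasurable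
  rw [lintegral_prod_eq_prod_lintegral_of_indepFun _ _ hind
    fun i => (hf i).comp (measurable_pi_apply i)]
  refine Finset.prod_congr rfl fun i _ => ?_
  exact (measurePreserving_eval (fun _ : Fin k => Y) i).lintegral_comp (hf i)

theorem IsPRV.lintegral_likProd_le (h : IsPRV δ X Y) (k : ℕ) :
    ∫⁻ y, likProd y ∂(Measure.pi fun _ : Fin k => Y) ≤ 1 := by
  have := h.prob_right
  simp only [likProd]
  rw [lintegral_prod_pi Y (fun _ => lik) fun _ => measurable_lik]
  exact Finset.prod_le_one' fun _ _ => h.lintegral_lik_le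

/-- By independence the integral factorizes, and each other coordinate contributes at most 1. It
serves to bound the part where a single coordinate leaves the window. -/
theorem IsPRV.setLIntegral_likProd_le (h : IsPRV δ X Y) {k : ℕ} (i : Fin k) {S : Set EReal}
    (hS : MeasurableSet S) :
    ∫⁻ y in {y | y i ∈ S}, likProd y ∂(Measure.pi fun _ : Fin k => Y) ≤ ∫⁻ t in S, lik t ∂Y := by
  classical
  have := h.prob_right
  have hS' : MeasurableSet {y : Fin k → EReal | y i ∈ S} := measurable_pi_apply i hS
  rw [← lintegral_indicator hS', ← lintegral_indicator hS]
  set f : Fin k → EReal → ℝ≥0∞ := fun j => if j = i then S.indicator lik else lik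
  have hf : ∀ j, Measurable (f j) := by
    intro j
    by_cases hj : j = i
    · simp only [f, hj, if_true]; exact measurable_lik.indicator hS
    · simp only [f, hj, if_false]; exact measurable_lik
  have e : ∀ y : Fin k → EReal, {y | y i ∈ S}.indicator likProd y = ∏ j, f j (y j) := by
    intro y
    by_cases hy : y i ∈ S
    · rw [Set.indicator_of_mem (show y ∈ {y : Fin k → EReal | y i ∈ S} from hy), likProd]
      refine Finset.prod_congr rfl fun j _ => ?_
      by_cases hj : j = i
      · subst hj; simp [f, hy]
      · simp [f, hj]
    · rw [Set.indicator_of_notMem (show y ∉ {y : Fin k → EReal | y i ∈ S} from hy)]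
      exact (Finset.prod_eq_zero (Finset.mem_univ i) (by simp [f, hy])).symm
  simp_rw [e]
  rw [lintegral_prod_pi Y f hf, ← Finset.mul_prod_erase _ _ (Finset.mem_univ i)]
  have h1 : ∫⁻ t, f i t ∂Y = ∫⁻ t, S.indicator lik t ∂Y := by simp [f]
  rw [h1]
  refine mul_le_of_le_one_right' (Finset.prod_le_one' fun j hj => ?_)
  have : j ≠ i := Finset.ne_of_mem_erase hj
  simp only [f, this, if_false]
  exact h.lintegral_lik_le

end PRV

/-! ### Duality between ε and −ε for symmetric neighbours. -/

section Duality

variable {Ω : Type*} [MeasurableSpace Ω]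

theorem privacyCurve_antitone (P Q : Measure Ω) [IsProbabilityMeasure Q] :
    Antitone (privacyCurve P Q) := by
  intro ε ε' h
  rw [privacyCurve_le_iff]
  intro S hS
  refine le_trans ?_ (le_privacyCurve P Q ε hS)
  have : Real.exp ε * P.real S ≤ Real.exp ε' * P.real S := by gcongr
  linarith

/-- Complementing the event and dividing by e^ε exchanges the two measures. -/
theorem privacyCurve_neg_le (P Q : Measure Ω) [IsProbabilityMeasure P] [IsProbabilityMeasure Q]
    (ε : ℝ) :
    privacyCurve P Q (-ε) ≤ 1 - Real.exp (-ε) + Real.exp (-ε) * privacyCurve Q P ε := by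
  rw [privacyCurve_le_iff]
  intro S hS
  have h := le_privacyCurve Q P ε hS.compl
  rw [probReal_compl_eq_one_sub hS, probReal_compl_eq_one_sub hS] at h
  have h2 := mul_le_mul_of_nonneg_left h (Real.exp_pos (-ε)).le
  have h3 : Real.exp (-ε) * Real.exp ε = 1 := by rw [← Real.exp_add]; simp
  have : Real.exp (-ε) * (1 - P.real S - Real.exp ε * (1 - Q.real S)) =
    Real.exp (-ε) - Real.exp (-ε) * P.real S - 1 + Q.real S := by
    linear_combination (Q.real S - 1) * h3
  linarith

theorem hockey_pi_mono {Ω' : Type*} [MeasurableSpace Ω'] [MeasurableSpace.CountablyGenerated Ω]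
    [MeasurableSpace.CountablyGenerated Ω'] (P Q : Measure Ω) (X Y : Measure Ω')
    [IsProbabilityMeasure P] [IsProbabilityMeasure Q] [IsProbabilityMeasure X]
    [IsProbabilityMeasure Y]
    (h : ∀ a b : ℝ≥0∞, a ≠ ∞ → b ≠ ∞ → hockey P Q a b ≤ hockey X Y a b)
    (n : ℕ) {a b : ℝ≥0∞} (ha : a ≠ ∞) (hb : b ≠ ∞) :
    hockey (Measure.pi fun _ : Fin n => P) (Measure.pi fun _ : Fin n => Q) a b ≤
      hockey (Measure.pi fun _ : Fin n => X) (Measure.pi fun _ : Fin n => Y) a b := by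
  induction n generalizing a with
  | zero => exact hockey_le_of_unique _ _ _ _ ha
  | succ n ih =>
    rw [hockey_pi_succ P Q n ha hb, hockey_pi_succ X Y n ha hb]
    calc _ ≤ ∫⁻ t, hockey (Measure.pi fun _ : Fin n => X) (Measure.pi fun _ : Fin n => Y)
            (a * P.rnDeriv Q t) b ∂Q := by
          apply lintegral_mono_ae
          filter_upwards [Measure.rnDeriv_lt_top P Q] with t ht
          exact ih (ENNReal.mul_ne_top ha ht.ne)
      _ ≤ _ := by
          rw [← lintegral_hockey_swap (Measure.pi fun _ : Fin n => X) _ P Q,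
            ← lintegral_hockey_swap (Measure.pi fun _ : Fin n => X) _ X Y]
          apply lintegral_mono_ae
          filter_upwards [Measure.rnDeriv_lt_top (Measure.pi fun _ : Fin n => X)
            (Measure.pi fun _ : Fin n => Y)] with t ht
          exact h _ _ (ENNReal.mul_ne_top ha ht.ne) hb

theorem privacyCurve_mono_of_hockey_le {Ω' : Type*} [MeasurableSpace Ω'] {P Q : Measure Ω}
    {X Y : Measure Ω'} [IsProbabilityMeasure P] [IsProbabilityMeasure Q] [IsProbabilityMeasure X]
    [IsProbabilityMeasure Y]
    (h : ∀ a b : ℝ≥0∞, a ≠ ∞ → b ≠ ∞ → hockey P Q a b ≤ hockey X Y a b) (ε : ℝ) :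
    privacyCurve P Q ε ≤ privacyCurve X Y ε := by
  rw [← ENNReal.ofReal_le_ofReal_iff (privacyCurve_nonneg X Y ε), ofReal_privacyCurve,
    ofReal_privacyCurve]
  exact h _ _ ENNReal.ofReal_ne_top ENNReal.one_ne_top

variable {𝒟 A : Type*} [MeasurableSpace A]

theorem isDP_auxCurve {nbr : 𝒟 → 𝒟 → Prop} (M : 𝒟 → Kernel A Ω) [∀ D, IsMarkovKernel (M D)]
    (ε : ℝ) (a : A) : IsDP nbr (fun D => M D a) ε (auxCurve nbr M ε) := by
  intro D D' hD S hS
  have hne : {δ : ℝ | 0 ≤ δ ∧ ∀ a : A, IsDP nbr (fun D => M D a) ε δ}.Nonempty := by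
    refine ⟨1, zero_le_one, fun a D D' _ S _ => ?_⟩
    have h1 : (M D a).real S ≤ 1 := measureReal_le_one
    have h2 : 0 ≤ Real.exp ε * (M D' a).real S := by positivity
    simp only
    linarith
  have : (M D a).real S - Real.exp ε * (M D' a).real S ≤ auxCurve nbr M ε := by
    refine le_csInf hne fun δ hδ => ?_
    have := hδ.2 a D D' hD S hS
    linarith
  linarith

theorem auxCurve_le {nbr : 𝒟 → 𝒟 → Prop} {M : 𝒟 → Kernel A Ω} {ε c : ℝ} (hc : 0 ≤ c)
    (h : ∀ a : A, IsDP nbr (fun D => M D a) ε c) : auxCurve nbr M ε ≤ c :=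
  csInf_le ⟨0, fun _ hδ => hδ.1⟩ ⟨hc, h⟩

/-- Complementary events again, with symmetry of `nbr` to exchange the two databases. The hypothesis
`h0` makes the bound nonnegative, as the definition of the curve requires; for ε < 0 it would fail
if there were no neighbours. -/
theorem auxCurve_neg_le {nbr : 𝒟 → 𝒟 → Prop} (hnbr : ∀ D D', nbr D D' → nbr D' D)
    (M : 𝒟 → Kernel A Ω) [∀ D, IsMarkovKernel (M D)] {ε : ℝ}
    (h0 : 1 - Real.exp ε ≤ auxCurve nbr M ε) :
    auxCurve nbr M (-ε) ≤ 1 - Real.exp (-ε) + Real.exp (-ε) * auxCurve nbr M ε := by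
  have h3 : Real.exp (-ε) * Real.exp ε = 1 := by rw [← Real.exp_add]; simp
  apply auxCurve_le
  · have := mul_le_mul_of_nonneg_left h0 (Real.exp_pos (-ε)).le
    rw [mul_sub, h3] at this
    linarith
  · intro a D D' hD S hS
    have h := isDP_auxCurve M ε a D' D (hnbr _ _ hD) Sᶜ hS.compl
    simp only at h ⊢
    rw [probReal_compl_eq_one_sub hS, probReal_compl_eq_one_sub hS] at h
    have h2 := mul_le_mul_of_nonneg_left h (Real.exp_pos (-ε)).le
    have : Real.exp (-ε) * (Real.exp ε * (1 - (M D a).real S) + auxCurve nbr M ε) =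
        1 - (M D a).real S + Real.exp (-ε) * auxCurve nbr M ε := by
      linear_combination (1 - (M D a).real S) * h3
    linarith

theorem one_sub_exp_le_privacyCurve (P Q : Measure Ω) [IsProbabilityMeasure P]
    [IsProbabilityMeasure Q] (ε : ℝ) : 1 - Real.exp ε ≤ privacyCurve P Q ε := by
  simpa using le_privacyCurve P Q ε MeasurableSet.univ

/-- The duality of the pair at −ε and that of the curve at ε undo each other's factors, so the pair
dominates its own reversal. -/
theorem IsPRV.privacyCurve_swap_le {nbr : 𝒟 → 𝒟 → Prop} (hnbr : ∀ D D', nbr D D' → nbr D' D)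
    {M : 𝒟 → Kernel A Ω} [∀ D, IsMarkovKernel (M D)] {X Y : Measure EReal}
    (h : IsPRV (auxCurve nbr M) X Y) (ε : ℝ) : privacyCurve Y X ε ≤ privacyCurve X Y ε := by
  have := h.prob_left
  have := h.prob_right
  have h1 := privacyCurve_neg_le Y X (-ε)
  rw [neg_neg, h.curve] at h1
  have h3 := auxCurve_neg_le hnbr M (ε := ε)
    (by rw [← h.curve]; exact one_sub_exp_le_privacyCurve X Y ε)
  rw [h.curve]
  have h4 : Real.exp ε * Real.exp (-ε) = 1 := by rw [← Real.exp_add]; simp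
  have h5 := mul_le_mul_of_nonneg_left h3 (Real.exp_pos ε).le
  have : Real.exp ε * (1 - Real.exp (-ε) + Real.exp (-ε) * auxCurve nbr M ε) =
    Real.exp ε - 1 + auxCurve nbr M ε := by
    linear_combination (auxCurve nbr M ε - 1) * h4
  linarith

/-- Domination of the reversed pair survives the passage to powers (`hockey_pi_mono`), so the
composed curve inherits the duality. -/
theorem IsPRV.composedCurve_neg_le {nbr : 𝒟 → 𝒟 → Prop} (hnbr : ∀ D D', nbr D D' → nbr D' D)
    {M : 𝒟 → Kernel A Ω} [∀ D, IsMarkovKernel (M D)] {X Y : Measure EReal}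
    (h : IsPRV (auxCurve nbr M) X Y) (k : ℕ) (ε : ℝ) :
    composedCurve k X Y (-ε) ≤
      1 - Real.exp (-ε) + Real.exp (-ε) * composedCurve k X Y ε := by
  have := h.prob_left
  have := h.prob_right
  refine (privacyCurve_neg_le _ _ ε).trans ?_
  gcongr
  apply privacyCurve_mono_of_hockey_le
  intro a b ha hb
  exact hockey_pi_mono Y X X Y (fun a b ha hb => hockey_le_of_privacyCurve_le
    (h.privacyCurve_swap_le hnbr) ha hb) k ha hb

end Duality

/-! ### Tails of the likelihood ratio, read off from the curve. -/

section Tails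

variable {Ω : Type*} [MeasurableSpace Ω] {Q : Measure Ω} [IsProbabilityMeasure Q]
  {l : Ω → ℝ≥0∞} {c : ℝ → ℝ}

/-- Markov: on this event, of large privacy loss, the integrand (1 − e^ε l)⁺ is at least 1 −
e^{ε−w}. -/
theorem measureReal_lt_exp_neg_le (hl : Measurable l) {ε w : ℝ} (hc0 : 0 ≤ c ε)
    (hc : ENNReal.ofReal (c ε) = ∫⁻ x, (1 - ENNReal.ofReal (Real.exp ε) * l x) ∂Q) (hw : ε ≤ w) :
    Q.real {x | l x < ENNReal.ofReal (Real.exp (-w))} * (1 - Real.exp (ε - w)) ≤ c ε := by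
  have hS : MeasurableSet {x | l x < ENNReal.ofReal (Real.exp (-w))} :=
    measurableSet_lt hl measurable_const
  have h1 : 0 ≤ 1 - Real.exp (ε - w) := by
    have : Real.exp (ε - w) ≤ 1 := Real.exp_le_one_iff.2 (by linarith)
    linarith
  rw [← ENNReal.ofReal_le_ofReal_iff hc0, hc, ENNReal.ofReal_mul measureReal_nonneg,
    ofReal_measureReal, mul_comm, ← setLIntegral_const]
  refine (setLIntegral_mono' hS fun x hx => ?_).trans (setLIntegral_le_lintegral _ _)
  rw [ENNReal.ofReal_sub _ (Real.exp_pos _).le, ENNReal.ofReal_one]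
  gcongr
  rw [sub_eq_add_neg, Real.exp_add, ENNReal.ofReal_mul (Real.exp_pos _).le]
  gcongr
  exact le_of_lt hx

/-- A large ratio means a very negative loss, which the curve at ε does not see directly. With r =
e^{-ε}, the identity (1 − rl)⁺ + rl = 1 + (rl − 1)⁺ bounds it through the curve at −ε, and `hneg`
leads back to ε. -/
theorem measureReal_exp_lt_le (hl : Measurable l) (hl1 : ∫⁻ x, l x ∂Q ≤ 1)
    (hc0 : ∀ ε, 0 ≤ c ε)
    (hc : ∀ ε, ENNReal.ofReal (c ε) = ∫⁻ x, (1 - ENNReal.ofReal (Real.exp ε) * l x) ∂Q) {ε w : ℝ}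
    (hneg : c (-ε) ≤ 1 - Real.exp (-ε) + Real.exp (-ε) * c ε) (hw : ε ≤ w) :
    Q.real {x | ENNReal.ofReal (Real.exp w) < l x} * (Real.exp w - Real.exp ε) ≤ c ε := by
  have hS : MeasurableSet {x | ENNReal.ofReal (Real.exp w) < l x} :=
    measurableSet_lt measurable_const hl
  set r := ENNReal.ofReal (Real.exp (-ε))
  have hm1 : Measurable fun x => r * l x := hl.const_mul r
  have e1 : ∫⁻ x, (1 - r * l x) ∂Q + ∫⁻ x, r * l x ∂Q = 1 + ∫⁻ x, (r * l x - 1) ∂Q := by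
    have : (1 : ℝ≥0∞) = ∫⁻ _, 1 ∂Q := by simp
    nth_rw 2 [this]
    rw [← lintegral_add_right _ hm1, ← lintegral_add_left measurable_const]
    refine lintegral_congr fun x => ?_
    rcases le_total (r * l x) 1 with h | h
    · rw [tsub_add_cancel_of_le h, tsub_eq_zero_of_le h, add_zero]
    · rw [tsub_eq_zero_of_le h, zero_add, add_tsub_cancel_of_le h]
  have e2 : ENNReal.ofReal (Real.exp (w - ε) - 1) * Q {x | ENNReal.ofReal (Real.exp w) < l x} ≤
      ∫⁻ x, (r * l x - 1) ∂Q := by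
    rw [← setLIntegral_const]
    refine (setLIntegral_mono' hS fun x hx => ?_).trans (setLIntegral_le_lintegral _ _)
    rw [ENNReal.ofReal_sub _ zero_le_one, ENNReal.ofReal_one]
    gcongr
    rw [show w - ε = -ε + w by ring, Real.exp_add, ENNReal.ofReal_mul (Real.exp_pos _).le]
    gcongr
    exact le_of_lt hx
  have e3 : ∫⁻ x, r * l x ∂Q ≤ r := by
    rw [lintegral_const_mul _ hl]
    exact mul_le_of_le_one_right' hl1
  rw [← hc] at e1
  have e4 : 1 + ENNReal.ofReal (Real.exp (w - ε) - 1) *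
      Q {x | ENNReal.ofReal (Real.exp w) < l x} ≤ ENNReal.ofReal (c (-ε)) + r :=
    (add_le_add_right e2 1).trans (e1.symm.le.trans (add_le_add_right e3 _))
  have hpos : 0 ≤ Real.exp (w - ε) - 1 := by
    have : 1 ≤ Real.exp (w - ε) := Real.one_le_exp (by linarith)
    linarith
  rw [← ofReal_measureReal, ← ENNReal.ofReal_mul hpos, ← ENNReal.ofReal_one,
    ← ENNReal.ofReal_add zero_le_one (by positivity), ← ENNReal.ofReal_add (hc0 _) (Real.exp_pos _).le,
    ENNReal.ofReal_le_ofReal_iff (by have := hc0 (-ε); positivity)] at e4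
  have e5 : (Real.exp (w - ε) - 1) * Q.real {x | ENNReal.ofReal (Real.exp w) < l x} ≤
    Real.exp (-ε) * c ε := by linarith
  have e6 := mul_le_mul_of_nonneg_left e5 (Real.exp_pos ε).le
  have h4 : Real.exp ε * Real.exp (-ε) = 1 := by rw [← Real.exp_add]; simp
  have h5 : Real.exp ε * Real.exp (w - ε) = Real.exp w := by rw [← Real.exp_add]; congr 1; ring
  calc _ = Real.exp ε * ((Real.exp (w - ε) - 1) *
        Q.real {x | ENNReal.ofReal (Real.exp w) < l x}) := by rw [← h5]; ring
    _ ≤ _ := e6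
    _ = c ε := by rw [← mul_assoc, h4, one_mul]

end Tails

/-! ### Privacy of the adaptive composition; inverse curves. -/

section Main

variable {𝒟 A Ω : Type*} [MeasurableSpace A] [MeasurableSpace Ω]

theorem isDP_adaptiveComp (nbr : 𝒟 → 𝒟 → Prop) (M : 𝒟 → Kernel A Ω) [∀ D, IsMarkovKernel (M D)]
    {X Y : Measure EReal} (h : IsPRV (auxCurve nbr M) X Y) (k : ℕ)
    (pick : ∀ n : ℕ, (Fin n → Ω) → A) (hpick : ∀ n, Measurable (pick n)) (ε : ℝ) :
    IsDP nbr (fun D => adaptiveComp M pick hpick D k) ε (composedCurve k X Y ε) := by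
  have := h.prob_left
  have := h.prob_right
  intro D D' hD S hS
  have h1 : privacyCurve (adaptiveComp M pick hpick D' k) (adaptiveComp M pick hpick D k) ε ≤
      composedCurve k X Y ε := by
    apply privacyCurve_mono_of_hockey_le
    intro a b ha hb
    refine hockey_adaptiveComp_le M pick hpick D D' X Y (fun x a b ha hb => ?_) k ha hb
    refine hockey_le_of_privacyCurve_le (fun ε => ?_) ha hb
    rw [h.curve, privacyCurve_le_iff]
    intro S hS
    have := isDP_auxCurve M ε x D D' hD S hS
    simp only at this
    linarith
  have := le_privacyCurve (adaptiveComp M pick hpick D' k) (adaptiveComp M pick hpick D k) ε hS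
  simp only
  linarith

theorem dpCurve_adaptiveComp [MeasurableSpace.CountablyGenerated Ω] (nbr : 𝒟 → 𝒟 → Prop)
    (M : 𝒟 → Kernel A Ω) [∀ D, IsMarkovKernel (M D)]
    {X Y : Measure EReal} (h : IsPRV (auxCurve nbr M) X Y) (k : ℕ)
    (pick : ∀ n : ℕ, (Fin n → Ω) → A) (hpick : ∀ n, Measurable (pick n))
    {D D' : 𝒟} (hD : nbr D D')
    (hworst : ∀ (a : A) (ε : ℝ), privacyCurve (M D' a) (M D a) ε = auxCurve nbr M ε) (ε : ℝ) :
    dpCurve nbr (fun D => adaptiveComp M pick hpick D k) ε = composedCurve k X Y ε := by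
  have := h.prob_left
  have := h.prob_right
  have hmem : composedCurve k X Y ε ∈
      {δ : ℝ | 0 ≤ δ ∧ IsDP nbr (fun D => adaptiveComp M pick hpick D k) ε δ} :=
    ⟨privacyCurve_nonneg _ _ ε, isDP_adaptiveComp nbr M h k pick hpick ε⟩
  apply le_antisymm
  · exact csInf_le ⟨0, fun _ hδ => hδ.1⟩ hmem
  · refine le_csInf ⟨_, hmem⟩ fun δ hδ => ?_
    calc composedCurve k X Y ε
        ≤ privacyCurve (adaptiveComp M pick hpick D' k) (adaptiveComp M pick hpick D k) ε := by
          apply privacyCurve_mono_of_hockey_le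
          intro a b ha hb
          refine le_hockey_adaptiveComp M pick hpick D D' X Y (fun x a b ha hb => ?_) k ha hb
          refine hockey_le_of_privacyCurve_le (fun ε => ?_) ha hb
          rw [h.curve, hworst]
      _ ≤ δ := by
          rw [privacyCurve_le_iff]
          intro S hS
          have := hδ.2 D D' hD S hS
          simp only at this
          linarith

/-- The infimum in `epsOf` is not known to be attained, so the bound is claimed only strictly beyond
`εup`. -/
theorem le_of_epsOf_le {δ : ℝ → ℝ} (hδ : Antitone δ) {d εup ε : ℝ}
    (h : epsOf δ d ≤ (εup : EReal)) (hε : εup < ε) : δ ε ≤ d := by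
  have h1 : epsOf δ d < (ε : EReal) := h.trans_lt (by exact_mod_cast hε)
  obtain ⟨_, ⟨e, he, rfl⟩, hlt⟩ := sInf_lt_iff.1 h1
  have : e < ε := EReal.coe_lt_coe_iff.1 hlt
  exact (hδ this.le).trans he.2

theorem nonneg_of_epsOf_le {δ : ℝ → ℝ} {d εup : ℝ} (h : epsOf δ d ≤ (εup : EReal)) : 0 ≤ εup := by
  have : (0 : EReal) ≤ epsOf δ d := by
    refine le_sInf ?_
    rintro _ ⟨e, he, rfl⟩
    exact EReal.coe_nonneg.2 he.1
  exact_mod_cast this.trans h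

end Main

end DP

/-! ### A program logic for total correctness with step counts. -/

namespace RealRAM

/-- The program `c` halts when started in `s`, in a state and after a number of steps
satisfying `Q`. -/
def wp (O : Oracle) (c : Cmd) (Q : State → ℕ → Prop) (s : State) : Prop :=
  ∃ s' t, Exec O c s s' t ∧ Q s' t

variable {O : Oracle} {Q Q' : State → ℕ → Prop} {s : State}

theorem wp.mono {c : Cmd} (h : wp O c Q s) (hQ : ∀ s' t, Q s' t → Q' s' t) : wp O c Q' s := by
  obtain ⟨s', t, he, hq⟩ := h
  exact ⟨s', t, he, hQ _ _ hq⟩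

@[simp] theorem wp_skip : wp O .skip Q s ↔ Q s 1 := by
  constructor
  · rintro ⟨s', t, he, hq⟩
    cases he
    exact hq
  · intro h
    exact ⟨_, _, .skip s, h⟩

@[simp] theorem wp_setN {i : ℕ} {e : NExp} : wp O (.setN i e) Q s ↔
    Q { s with nat := Function.update s.nat i (e.eval s) } (e.cost + 1) := by
  constructor
  · rintro ⟨s', t, he, hq⟩
    cases he
    exact hq
  · intro h
    exact ⟨_, _, .setN i e s, h⟩

@[simp] theorem wp_setR {i : ℕ} {e : RExp} : wp O (.setR i e) Q s ↔
    Q { s with real := Function.update s.real i (e.eval O s) } (e.cost + 1) := by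
  constructor
  · rintro ⟨s', t, he, hq⟩
    cases he
    exact hq
  · intro h
    exact ⟨_, _, .setR i e s, h⟩

@[simp] theorem wp_store {a : ℕ} {i : NExp} {e : RExp} : wp O (.store a i e) Q s ↔
    Q { s with
        arr := Function.update s.arr a (Function.update (s.arr a) (i.eval s) (e.eval O s)) } (i.cost + e.cost + 1) := by
  constructor
  · rintro ⟨s', t, he, hq⟩
    cases he
    exact hq
  · intro h
    exact ⟨_, _, .store a i e s, h⟩

@[simp] theorem wp_seq {c₁ c₂ : Cmd} : wp O (.seq c₁ c₂) Q s ↔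
    wp O c₁ (fun s₁ t₁ => wp O c₂ (fun s₂ t₂ => Q s₂ (t₁ + t₂ + 1)) s₁) s := by
  constructor
  · rintro ⟨s', t, he, hq⟩
    cases he with
    | seq _ _ _ s₁ _ t₁ t₂ h₁ h₂ => exact ⟨s₁, t₁, h₁, s', t₂, h₂, hq⟩
  · rintro ⟨s₁, t₁, h₁, s₂, t₂, h₂, hq⟩
    exact ⟨_, _, .seq _ _ _ _ _ _ _ h₁ h₂, hq⟩

theorem wp_ite_true {b : BExp} {c₁ c₂ : Cmd} (hb : b.eval O s) :
    wp O (.ite b c₁ c₂) Q s ↔ wp O c₁ (fun s' t => Q s' (b.cost + t + 1)) s := by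
  constructor
  · rintro ⟨s', t, he, hq⟩
    cases he with
    | ite_true _ _ _ _ _ t _ h => exact ⟨s', t, h, hq⟩
    | ite_false _ _ _ _ _ t hb' h => exact absurd hb hb'
  · rintro ⟨s', t, h, hq⟩
    exact ⟨_, _, .ite_true _ _ _ _ _ _ hb h, hq⟩

theorem wp_ite_false {b : BExp} {c₁ c₂ : Cmd} (hb : ¬ b.eval O s) :
    wp O (.ite b c₁ c₂) Q s ↔ wp O c₂ (fun s' t => Q s' (b.cost + t + 1)) s := by
  constructor
  · rintro ⟨s', t, he, hq⟩
    cases he with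
    | ite_true _ _ _ _ _ t hb' h => exact absurd hb' hb
    | ite_false _ _ _ _ _ t _ h => exact ⟨s', t, h, hq⟩
  · rintro ⟨s', t, h, hq⟩
    exact ⟨_, _, .ite_false _ _ _ _ _ _ hb h, hq⟩

theorem wp_ite {b : BExp} {c₁ c₂ : Cmd} : wp O (.ite b c₁ c₂) Q s ↔
    (b.eval O s → wp O c₁ (fun s' t => Q s' (b.cost + t + 1)) s) ∧
      (¬ b.eval O s → wp O c₂ (fun s' t => Q s' (b.cost + t + 1)) s) := by
  by_cases hb : b.eval O s
  · simp [wp_ite_true hb, hb]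
  · simp [wp_ite_false hb, hb]

/-- A list of commands, executed one after the other. -/
def block : List Cmd → Cmd
  | [] => .skip
  | [c] => c
  | c :: c' :: cs => .seq c (block (c' :: cs))

/-- The natural-number registers that a program may write. -/
def Cmd.natW : Cmd → List ℕ
  | .skip => []
  | .setN i _ => [i]
  | .setR _ _ => []
  | .store _ _ _ => []
  | .seq c₁ c₂ => c₁.natW ++ c₂.natW
  | .ite _ c₁ c₂ => c₁.natW ++ c₂.natW
  | .while _ c => c.natW

/-- The real registers that a program may write. -/
def Cmd.realW : Cmd → List ℕ
  | .skip => []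
  | .setN _ _ => []
  | .setR i _ => [i]
  | .store _ _ _ => []
  | .seq c₁ c₂ => c₁.realW ++ c₂.realW
  | .ite _ c₁ c₂ => c₁.realW ++ c₂.realW
  | .while _ c => c.realW

/-- The arrays that a program may write. -/
def Cmd.arrW : Cmd → List ℕ
  | .skip => []
  | .setN _ _ => []
  | .setR _ _ => []
  | .store a _ _ => [a]
  | .seq c₁ c₂ => c₁.arrW ++ c₂.arrW
  | .ite _ c₁ c₂ => c₁.arrW ++ c₂.arrW
  | .while _ c => c.arrW

/-- The states `s` and `s'` agree on everything that `c` does not write. -/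
structure Agree (c : Cmd) (s s' : State) : Prop where
  nat : ∀ i, i ∉ c.natW → s'.nat i = s.nat i
  real : ∀ i, i ∉ c.realW → s'.real i = s.real i
  arr : ∀ a, a ∉ c.arrW → s'.arr a = s.arr a

theorem Agree.refl (c : Cmd) (s : State) : Agree c s s :=
  ⟨fun _ _ => rfl, fun _ _ => rfl, fun _ _ => rfl⟩

theorem Agree.trans {c : Cmd} {s s' s'' : State} (h : Agree c s s') (h' : Agree c s' s'') :
    Agree c s s'' :=
  ⟨fun i hi => (h'.nat i hi).trans (h.nat i hi), fun i hi => (h'.real i hi).trans (h.real i hi),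
    fun i hi => (h'.arr i hi).trans (h.arr i hi)⟩

/-- The frame rule. Write sets are lists computed from the syntax, so for a concrete program its
side conditions are settled by `decide`. -/
theorem Exec.agree {c : Cmd} {s s' : State} {t : ℕ} (h : Exec O c s s' t) : Agree c s s' := by
  induction h with
  | skip s => exact .refl _ _
  | setN i e s =>
    refine ⟨fun j hj => ?_, fun _ _ => rfl, fun _ _ => rfl⟩
    have : j ≠ i := by simpa [Cmd.natW] using hj
    simp [this]
  | setR i e s =>
    refine ⟨fun _ _ => rfl, fun j hj => ?_, fun _ _ => rfl⟩
    have : j ≠ i := by simpa [Cmd.realW] using hj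
    simp [this]
  | store a i e s =>
    refine ⟨fun _ _ => rfl, fun _ _ => rfl, fun j hj => ?_⟩
    have : j ≠ a := by simpa [Cmd.arrW] using hj
    simp [this]
  | seq c₁ c₂ s s₁ s₂ t₁ t₂ h₁ h₂ ih₁ ih₂ =>
    refine ⟨fun i hi => ?_, fun i hi => ?_, fun i hi => ?_⟩
    · simp only [Cmd.natW, List.mem_append, not_or] at hi
      rw [ih₂.nat i hi.2, ih₁.nat i hi.1]
    · simp only [Cmd.realW, List.mem_append, not_or] at hi
      rw [ih₂.real i hi.2, ih₁.real i hi.1]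
    · simp only [Cmd.arrW, List.mem_append, not_or] at hi
      rw [ih₂.arr i hi.2, ih₁.arr i hi.1]
  | ite_true b c₁ c₂ s s' t hb h ih =>
    refine ⟨fun i hi => ?_, fun i hi => ?_, fun i hi => ?_⟩
    · simp only [Cmd.natW, List.mem_append, not_or] at hi
      exact ih.nat i hi.1
    · simp only [Cmd.realW, List.mem_append, not_or] at hi
      exact ih.real i hi.1
    · simp only [Cmd.arrW, List.mem_append, not_or] at hi
      exact ih.arr i hi.1
  | ite_false b c₁ c₂ s s' t hb h ih =>
    refine ⟨fun i hi => ?_, fun i hi => ?_, fun i hi => ?_⟩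
    · simp only [Cmd.natW, List.mem_append, not_or] at hi
      exact ih.nat i hi.2
    · simp only [Cmd.realW, List.mem_append, not_or] at hi
      exact ih.real i hi.2
    · simp only [Cmd.arrW, List.mem_append, not_or] at hi
      exact ih.arr i hi.2
  | while_false b c s hb => exact .refl _ _
  | while_true b c s s₁ s₂ t₁ t₂ hb h₁ h₂ ih₁ ih₂ =>
    exact Agree.trans ⟨ih₁.nat, ih₁.real, ih₁.arr⟩ ih₂

theorem wp.agree {c : Cmd} (h : wp O c Q s) : wp O c (fun s' t => Q s' t ∧ Agree c s s') s := by
  obtain ⟨s', t, he, hq⟩ := h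
  exact ⟨s', t, he, hq, he.agree⟩

/-- Counted loops. -/
theorem wp_while (b : BExp) (c : Cmd) (I : ℕ → State → Prop) (N T : ℕ)
    (h0 : I 0 s)
    (hstep : ∀ j, j < N → ∀ s', Agree c s s' → I j s' →
      b.eval O s' ∧ wp O c (fun s'' t => I (j + 1) s'' ∧ t ≤ T) s')
    (hend : ∀ s', Agree c s s' → I N s' → ¬ b.eval O s') :
    wp O (.while b c) (fun s' t => I N s' ∧ Agree c s s' ∧ t ≤ (N + 1) * (T + b.cost + 1)) s := by
  -- Induction on the number `m` of iterations still to come; the extra unit in `m + 1` pays for the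
  -- last, failing test.
  have main : ∀ m j, j + m = N → ∀ s', Agree c s s' → I j s' →
      wp O (.while b c) (fun s'' t => I N s'' ∧ Agree c s s'' ∧ t ≤ (m + 1) * (T + b.cost + 1))
        s' := by
    intro m
    induction m with
    | zero =>
      intro j hj s' ha hI
      rw [add_zero] at hj
      subst hj
      refine ⟨s', _, .while_false b c s' (hend s' ha hI), hI, ha, ?_⟩
      omega
    | succ m ih =>
      intro j hj s' ha hI
      obtain ⟨hb, s₁, t₁, he₁, hI₁, ht₁⟩ := hstep j (by omega) s' ha hI
      obtain ⟨s₂, t₂, he₂, hI₂, ha₂, ht₂⟩ := ih (j + 1) (by omega) s₁ (ha.trans he₁.agree) hI₁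
      refine ⟨s₂, _, .while_true b c s' s₁ s₂ t₁ t₂ hb he₁ he₂, hI₂, ha₂, ?_⟩
      have : (m + 1 + 1) * (T + b.cost + 1) = (m + 1) * (T + b.cost + 1) + (T + b.cost + 1) := by
        ring
      omega
  exact main N 0 (by omega) s (.refl _ _) h0

end RealRAM

/-! ### The fast Fourier transform as arithmetic modulo X^m − ζ. -/

namespace FFT

open Polynomial

/-- Twiddle factors in bit-reversed order: `ζ (2 b)` is a square root of `ζ b`. -/
structure IsTwiddle (n : ℕ) (ζ : ℕ → ℂ) : Prop where
  zero : ζ 0 = 1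
  sq : ∀ b, 2 * b < n → ζ (2 * b) ^ 2 = ζ b
  neg : ∀ b, 2 * b + 1 < n → ζ (2 * b + 1) = - ζ (2 * b)
  conj : ∀ b, b < n → ζ b * (starRingEnd ℂ) (ζ b) = 1

/-- The array after `t` stages of the constant-geometry fast Fourier transform. -/
noncomputable def fft (ζ : ℕ → ℂ) (H : ℕ) (a : ℕ → ℂ) : ℕ → ℕ → ℂ
  | 0 => a
  | t + 1 => fun x => fft ζ H a t (x / 2) + ζ (x % 2 ^ (t + 1)) * fft ζ H a t (x / 2 + H)

/-- The `b`-th of `B` interleaved polynomials with `m` coefficients each. -/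
noncomputable def strand (B m : ℕ) (a : ℕ → ℂ) (b : ℕ) : ℂ[X] :=
  ∑ j ∈ Finset.range m, C (a (j * B + b)) * X ^ j

theorem strand_double (B m : ℕ) (a : ℕ → ℂ) (b : ℕ) :
    strand B (2 * m) a b = strand B m a b + X ^ m * strand B m (fun x => a (x + m * B)) b := by
  rw [strand, two_mul, Finset.sum_range_add, strand, strand, Finset.mul_sum]
  congr 1
  refine Finset.sum_congr rfl fun j _ => ?_
  rw [show (m + j) * B + b = j * B + b + m * B by ring, pow_add]
  ring

/-- Strand `b` is lo + X^m hi; modulo X^m − ζ_q it becomes lo + ζ_q hi, which is what the butterfly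
writes. So a stage passes from a residue modulo X^{2m} − ζ_b to its residues modulo the two factors.
-/
theorem sub_dvd_strand_sub {B m : ℕ} {ζ a a' : ℕ → ℂ}
    (h : ∀ x, x < 2 * (m * B) → a' x = a (x / 2) + ζ (x % (2 * B)) * a (x / 2 + m * B))
    {b q : ℕ} (hq : q < 2 * B) (hb : q / 2 = b) :
    X ^ m - C (ζ q) ∣ strand B (2 * m) a b - strand (2 * B) m a' q := by
  have e : strand (2 * B) m a' q =
      strand B m a b + C (ζ q) * strand B m (fun x => a (x + m * B)) b := by
    rw [strand, strand, strand, Finset.mul_sum, ← Finset.sum_add_distrib]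
    refine Finset.sum_congr rfl fun j hj => ?_
    have hj' := Finset.mem_range.1 hj
    have h1 : (j * (2 * B) + q) / 2 = j * B + b := by
      rw [show j * (2 * B) + q = 2 * (j * B) + q by ring]; omega
    have h2 : (j * (2 * B) + q) % (2 * B) = q := by
      rw [mul_comm, Nat.mul_add_mod, Nat.mod_eq_of_lt hq]
    have h3 : j * (2 * B) + q < 2 * (m * B) := by
      have : (j + 1) * (2 * B) ≤ m * (2 * B) := Nat.mul_le_mul_right _ hj'
      nlinarith
    rw [h _ h3, h1, h2, C_add, C_mul]
    ring
  rw [e, strand_double]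
  exact ⟨strand B m (fun x => a (x + m * B)) b, by ring⟩

/-- One stage of the inverse transform. -/
theorem dvd_strand_sub_pow {n B m k : ℕ} {ζ a a' c c' : ℕ → ℂ} (hζ : IsTwiddle n ζ)
    (hn : 2 * (m * B) = n) (hm : 0 < m)
    (ha : ∀ x, x < n → a' x = a (x / 2) + ζ (x % (2 * B)) * a (x / 2 + m * B))
    (hlo : ∀ y, y < m * B → c y = (c' (2 * y) + c' (2 * y + 1)) / 2)
    (hhi : ∀ y, y < m * B → c (y + m * B) =
      (c' (2 * y) - c' (2 * y + 1)) * (starRingEnd ℂ) (ζ (2 * y % (2 * B))) / 2)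
    (h : ∀ q, q < 2 * B → X ^ m - C (ζ q) ∣ strand (2 * B) m c' q - strand (2 * B) m a' q ^ k)
    {b : ℕ} (hb : b < B) :
    X ^ (2 * m) - C (ζ b) ∣ strand B (2 * m) c b - strand B (2 * m) a b ^ k := by
  have hBn : 2 * B ≤ n := by
    rw [← hn]; nlinarith
  -- The inverse butterfly is inverted by the forward one, since the conjugate of ζ is its inverse.
  -- Hence `c'` relates to `c` as `a'` does to `a`.
  have hc : ∀ x, x < 2 * (m * B) → c' x = c (x / 2) + ζ (x % (2 * B)) * c (x / 2 + m * B) := by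
    intro x hx
    have hy : x / 2 < m * B := by omega
    have hr : 2 * (x / 2) % (2 * B) < 2 * B := Nat.mod_lt _ (by omega)
    have hz := hζ.conj _ (hr.trans_le hBn)
    have hev : 2 * (x / 2) % (2 * B) = 2 * (x / 2 % B) := Nat.mul_mod_mul_left _ _ _
    rw [hlo _ hy, hhi _ hy]
    rcases Nat.mod_two_eq_zero_or_one x with h2 | h2
    · have hx2 : 2 * (x / 2) = x := by omega
      rw [hx2] at hz ⊢
      linear_combination (-(c' x - c' (x + 1)) / 2) * hz
    · have hx2 : x = 2 * (x / 2) + 1 := by omega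
      have hmod : x % (2 * B) = 2 * (x / 2 % B) + 1 := by
        have hlt : x / 2 % B < B := Nat.mod_lt _ (by omega)
        conv_lhs => rw [hx2, Nat.add_mod, hev]
        rw [Nat.mod_eq_of_lt (show 1 < 2 * B by omega), Nat.mod_eq_of_lt (by omega)]
      have hneg := hζ.neg (x / 2 % B) (by
        have hlt : x / 2 % B < B := Nat.mod_lt _ (by omega)
        omega)
      rw [hmod, hneg]
      rw [hev] at hz ⊢
      rw [← hx2]
      linear_combination ((c' (2 * (x / 2)) - c' x) / 2) * hz
  have key : ∀ q, q < 2 * B → q / 2 = b →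
      X ^ m - C (ζ q) ∣ strand B (2 * m) c b - strand B (2 * m) a b ^ k := by
    intro q hq hqb
    have h1 := sub_dvd_strand_sub hc hq hqb
    have h2 := (sub_dvd_strand_sub (fun x hx => ha x (hn ▸ hx)) hq hqb).trans
      (sub_dvd_pow_sub_pow _ _ k)
    have := (dvd_sub (dvd_add h1 (h q hq)) h2)
    convert this using 1
    ring
  have h0 := key (2 * b) (by omega) (by omega)
  have h1 := key (2 * b + 1) (by omega) (by omega)
  rw [hζ.neg b (by omega)] at h1
  have hne : ζ (2 * b) ≠ 0 := by
    intro h0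
    have := hζ.conj (2 * b) (by omega)
    rw [h0, zero_mul] at this
    exact zero_ne_one this
  -- The factors differ by the nonzero constant 2ζ_{2b}, so the two congruences combine into one
  -- modulo their product X^{2m} − ζ_b.
  have hco : IsCoprime (X ^ m - C (ζ (2 * b))) (X ^ m - C (-ζ (2 * b))) := by
    refine ⟨-C ((2 * ζ (2 * b))⁻¹), C ((2 * ζ (2 * b))⁻¹), ?_⟩
    have : C ((2 * ζ (2 * b))⁻¹) * (2 * C (ζ (2 * b))) = (1 : ℂ[X]) := by
      rw [show (2 : ℂ[X]) = C 2 from rfl, ← C_mul, ← C_mul, inv_mul_cancel₀ (by simpa using hne),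
        C_1]
    rw [C_neg]
    linear_combination this
  have := hco.mul_dvd h0 h1
  convert this using 1
  rw [← hζ.sq b (by omega), C_pow, C_neg]
  ring

/-- As `g` is periodic, the linear functional X^d ↦ g(d) vanishes on the ideal of X^n − 1, so it may
be evaluated on the expanded power instead. The convolution is only ever tested against periodic
functions, and no formula for its coefficients is needed. -/
theorem sum_mul_periodic {n k : ℕ} {a c : ℕ → ℂ}
    (h : (X ^ n - 1 : ℂ[X]) ∣ strand 1 n c 0 - strand 1 n a 0 ^ k)
    (g : ℕ → ℂ) (hg : ∀ d, g (d + n) = g d) :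
    ∑ j ∈ Finset.range n, c j * g j =
      ∑ f : Fin k → Fin n, (∏ i, a (f i)) * g (∑ i, (f i : ℕ)) := by
  set Λ : ℂ[X] →ₗ[ℂ] ℂ := (Polynomial.basisMonomials ℂ).constr ℂ g
  have hΛ : ∀ d, Λ (X ^ d) = g d := by
    intro d
    have := (Polynomial.basisMonomials ℂ).constr_basis ℂ g d
    rw [Polynomial.coe_basisMonomials] at this
    rw [← monomial_one_right_eq_X_pow]
    exact this
  have hC : ∀ (r : ℂ) (d : ℕ), Λ (C r * X ^ d) = r * g d := by
    intro r d
    rw [← smul_eq_C_mul, map_smul, hΛ, smul_eq_mul]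
  have hz : ∀ p : ℂ[X], Λ ((X ^ n - 1) * p) = 0 := by
    intro p
    induction p using Polynomial.induction_on' with
    | add p q hp hq => rw [mul_add, map_add, hp, hq, add_zero]
    | monomial d r =>
      rw [← C_mul_X_pow_eq_monomial, show (X ^ n - 1) * (C r * X ^ d) =
        C r * X ^ (d + n) - C r * X ^ d by rw [pow_add]; ring, map_sub, hC, hC, hg, sub_self]
  obtain ⟨p, hp⟩ := h
  have e := congrArg Λ (sub_eq_iff_eq_add.1 hp)
  rw [map_add, hz, zero_add] at e
  have e1 : Λ (strand 1 n c 0) = ∑ j ∈ Finset.range n, c j * g j := by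
    rw [strand, map_sum]
    refine Finset.sum_congr rfl fun j _ => ?_
    rw [hC]; simp
  rw [← e1, e]
  have e2 : strand 1 n a 0 ^ k =
      ∑ f : Fin k → Fin n, C (∏ i, a (f i)) * X ^ (∑ i, (f i : ℕ)) := by
    have : strand 1 n a 0 = ∑ j : Fin n, C (a j) * X ^ (j : ℕ) := by
      rw [strand, Finset.sum_range]; simp
    rw [this]
    have h2 : (∑ j : Fin n, C (a j) * X ^ (j : ℕ)) ^ k =
        ∏ _i : Fin k, ∑ j : Fin n, C (a j) * X ^ (j : ℕ) := by simp
    rw [h2, Finset.prod_univ_sum, Fintype.piFinset_univ]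
    refine Finset.sum_congr rfl fun f _ => ?_
    rw [Finset.prod_mul_distrib, Finset.prod_pow_eq_pow_sum, map_prod]
  rw [e2, map_sum]
  exact Finset.sum_congr rfl fun f _ => hC _ _

end FFT

/-! ### Notation for expressions, their values and costs. -/

namespace RealRAM

instance : Add NExp := ⟨.add⟩
instance : Sub NExp := ⟨.sub⟩
instance : Add RExp := ⟨.add⟩
instance : Sub RExp := ⟨.sub⟩
instance : Mul RExp := ⟨.mul⟩
instance : Div RExp := ⟨.div⟩

/-- A natural-number register. -/
abbrev nv (i : ℕ) : NExp := .var i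
/-- A natural-number constant. -/
abbrev nl (i : ℕ) : NExp := .lit i
/-- A real register. -/
abbrev rv (i : ℕ) : RExp := .var i
/-- A rational constant. -/
abbrev rl (q : ℚ) : RExp := .lit q

section Eval

variable (O : Oracle) (s : State)

@[simp] theorem NExp.eval_add (a b : NExp) : (a + b).eval s = a.eval s + b.eval s := rfl
@[simp] theorem NExp.eval_sub (a b : NExp) : (a - b).eval s = a.eval s - b.eval s := rfl
@[simp] theorem NExp.eval_half (a : NExp) : (NExp.half a).eval s = a.eval s / 2 := rfl
@[simp] theorem NExp.eval_var (i : ℕ) : (NExp.var i).eval s = s.nat i := rfl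
@[simp] theorem NExp.eval_lit (i : ℕ) : (NExp.lit i).eval s = i := rfl
@[simp] theorem NExp.cost_add (a b : NExp) : (a + b).cost = a.cost + b.cost + 1 := rfl
@[simp] theorem NExp.cost_sub (a b : NExp) : (a - b).cost = a.cost + b.cost + 1 := rfl
@[simp] theorem NExp.cost_half (a : NExp) : (NExp.half a).cost = a.cost + 1 := rfl
@[simp] theorem NExp.cost_var (i : ℕ) : (NExp.var i).cost = 1 := rfl
@[simp] theorem NExp.cost_lit (i : ℕ) : (NExp.lit i).cost = 1 := rfl
@[simp] theorem RExp.eval_add (a b : RExp) : (a + b).eval O s = a.eval O s + b.eval O s := rfl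
@[simp] theorem RExp.eval_sub (a b : RExp) : (a - b).eval O s = a.eval O s - b.eval O s := rfl
@[simp] theorem RExp.eval_mul (a b : RExp) : (a * b).eval O s = a.eval O s * b.eval O s := rfl
@[simp] theorem RExp.eval_div (a b : RExp) : (a / b).eval O s = a.eval O s / b.eval O s := rfl
@[simp] theorem RExp.eval_sqrt (a : RExp) : (RExp.sqrt a).eval O s = √(a.eval O s) := rfl
@[simp] theorem RExp.eval_exp (a : RExp) : (RExp.exp a).eval O s = Real.exp (a.eval O s) := rfl
@[simp] theorem RExp.eval_log (a : RExp) : (RExp.log a).eval O s = Real.log (a.eval O s) := rfl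
@[simp] theorem RExp.eval_cdf (a : RExp) : (RExp.cdf a).eval O s = O.cdf (a.eval O s) := rfl
@[simp] theorem RExp.eval_truncMean (a : RExp) :
    (RExp.truncMean a).eval O s = O.truncMean (a.eval O s) := rfl
@[simp] theorem RExp.eval_var (i : ℕ) : (RExp.var i).eval O s = s.real i := rfl
@[simp] theorem RExp.eval_lit (q : ℚ) : (RExp.lit q).eval O s = q := rfl
@[simp] theorem RExp.eval_ofNat (a : NExp) : (RExp.ofNat a).eval O s = (a.eval s : ℝ) := rfl
@[simp] theorem RExp.eval_get (a : ℕ) (i : NExp) :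
    (RExp.get a i).eval O s = s.arr a (i.eval s) := rfl
@[simp] theorem RExp.cost_add (a b : RExp) : (a + b).cost = a.cost + b.cost + 1 := rfl
@[simp] theorem RExp.cost_sub (a b : RExp) : (a - b).cost = a.cost + b.cost + 1 := rfl
@[simp] theorem RExp.cost_mul (a b : RExp) : (a * b).cost = a.cost + b.cost + 1 := rfl
@[simp] theorem RExp.cost_div (a b : RExp) : (a / b).cost = a.cost + b.cost + 1 := rfl
@[simp] theorem RExp.cost_sqrt (a : RExp) : (RExp.sqrt a).cost = a.cost + 1 := rfl
@[simp] theorem RExp.cost_exp (a : RExp) : (RExp.exp a).cost = a.cost + 1 := rfl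
@[simp] theorem RExp.cost_log (a : RExp) : (RExp.log a).cost = a.cost + 1 := rfl
@[simp] theorem RExp.cost_cdf (a : RExp) : (RExp.cdf a).cost = a.cost + 1 := rfl
@[simp] theorem RExp.cost_truncMean (a : RExp) : (RExp.truncMean a).cost = a.cost + 1 := rfl
@[simp] theorem RExp.cost_var (i : ℕ) : (RExp.var i).cost = 1 := rfl
@[simp] theorem RExp.cost_lit (q : ℚ) : (RExp.lit q).cost = 1 := rfl
@[simp] theorem RExp.cost_ofNat (a : NExp) : (RExp.ofNat a).cost = a.cost + 1 := rfl
@[simp] theorem RExp.cost_get (a : ℕ) (i : NExp) : (RExp.get a i).cost = i.cost + 1 := rfl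
@[simp] theorem BExp.eval_ltN (a b : NExp) :
    (BExp.ltN a b).eval O s ↔ a.eval s < b.eval s := Iff.rfl
@[simp] theorem BExp.eval_ltR (a b : RExp) :
    (BExp.ltR a b).eval O s ↔ a.eval O s < b.eval O s := Iff.rfl
@[simp] theorem BExp.eval_not (a : BExp) : (BExp.not a).eval O s ↔ ¬ a.eval O s := Iff.rfl
@[simp] theorem BExp.cost_ltN (a b : NExp) : (BExp.ltN a b).cost = a.cost + b.cost + 1 := rfl
@[simp] theorem BExp.cost_ltR (a b : RExp) : (BExp.ltR a b).cost = a.cost + b.cost + 1 := rfl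
@[simp] theorem BExp.cost_not (a : BExp) : (BExp.not a).cost = a.cost + 1 := rfl

end Eval

/-! ### The program

Natural-number registers: 0 the number of compositions, 1 the size `n` of the transform, 2 half of
it, 3 a loop counter, 4 the index of a twiddle factor, 5 the number of strands, 6 the offset of the
current segment, 7 an exponent, 8 an index. Real registers: 0, 1, 2 the input, 3 the mesh size, 7
the shift. Arrays: 3 and 4 real and imaginary parts of the data, 5 and 6 of the twiddle factors. -/

/-- Mesh size and size of the transform. -/
def cmdSize : Cmd := block [
  .setR 3 (rv 0 / .sqrt (.ofNat (nv 0) / rl 2 * .log (rl 12 / rv 1))),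
  .setN 1 (nl 1),
  .while (.ltR (.ofNat (nv 1) * rv 3) (rl 8 * (rl 2 + rv 0 + rv 2))) (.setN 1 (nv 1 + nv 1)),
  .setN 2 (.half (nv 1))]

/-- Two new twiddle factors. -/
def cmdTwiddleStep : Cmd := block [
  .setR 8 (.sqrt (rl 2 + rl 2 * .get 5 (nv 3))),
  .store 5 (nv 3 + nv 3) ((rl 1 + .get 5 (nv 3)) / rv 8),
  .store 6 (nv 3 + nv 3) (.get 6 (nv 3) / rv 8),
  .store 5 (nv 3 + nv 3 + nl 1) (rl 0 - .get 5 (nv 3 + nv 3)),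
  .store 6 (nv 3 + nv 3 + nl 1) (rl 0 - .get 6 (nv 3 + nv 3)),
  .setN 3 (nv 3 + nl 1)]

/-- The table of the twiddle factors. -/
def cmdTwiddle : Cmd := block [
  .store 5 (nl 0) (rl 1), .store 6 (nl 0) (rl 0),
  .store 5 (nl 1) (rl (-1)), .store 6 (nl 1) (rl 0),
  .store 5 (nl 2) (rl 0), .store 6 (nl 2) (rl 1),
  .store 5 (nl 3) (rl 0), .store 6 (nl 3) (rl (-1)),
  .setN 3 (nl 2),
  .while (.ltN (nv 3) (nv 2)) cmdTwiddleStep]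

/-- One cell of the discretization. -/
def cmdCell : Cmd := block [
  .setR 4 (.ofNat (nv 3) * rv 3),
  .ite (.ltN (nv 3) (nv 2)) .skip (.setR 4 (rv 4 - .ofNat (nv 1) * rv 3)),
  .setR 8 (.cdf (rv 4 + rv 3) - .cdf (rv 4)),
  .store 3 (nv 3) (rv 8),
  .store 4 (nv 3) (rl 0),
  .setR 5 (rv 5 + rv 8),
  .setR 6 (rv 6 + rv 8 * rv 4),
  .setN 3 (nv 3 + nl 1)]

/-- The discretization, and the total shift of the composition. -/
def cmdDiscretize : Cmd := block [
  .setN 3 (nl 0), .setR 5 (rl 0), .setR 6 (rl 0),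
  .while (.ltN (nv 3) (nv 1)) cmdCell,
  .setR 7 (.ofNat (nv 0) * ((.truncMean (.ofNat (nv 2) * rv 3) - rv 6) / rv 5))]

/-- One entry of a stage of the Fourier transform. -/
def cmdForwardStep : Cmd := block [
  .setN 8 (nv 6 + .half (nv 3)),
  .store 3 (nv 6 + nv 1 + nv 3) (.get 3 (nv 8) +
    (.get 5 (nv 4) * .get 3 (nv 8 + nv 2) - .get 6 (nv 4) * .get 4 (nv 8 + nv 2))),
  .store 4 (nv 6 + nv 1 + nv 3) (.get 4 (nv 8) +
    (.get 5 (nv 4) * .get 4 (nv 8 + nv 2) + .get 6 (nv 4) * .get 3 (nv 8 + nv 2))),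
  .setN 4 (nv 4 + nl 1),
  .ite (.ltN (nv 4) (nv 5)) .skip (.setN 4 (nl 0)),
  .setN 3 (nv 3 + nl 1)]

/-- A stage of the Fourier transform. -/
def cmdForwardStage : Cmd := block [
  .setN 5 (nv 5 + nv 5), .setN 3 (nl 0), .setN 4 (nl 0),
  .while (.ltN (nv 3) (nv 1)) cmdForwardStep,
  .setN 6 (nv 6 + nv 1)]

/-- The Fourier transform. -/
def cmdForward : Cmd := block [
  .setN 6 (nl 0), .setN 5 (nl 1),
  .while (.ltN (nv 5) (nv 1)) cmdForwardStage]

/-- One step of fast exponentiation. -/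
def cmdPowStep : Cmd := block [
  .setN 8 (.half (nv 7)),
  .ite (.ltN (nv 8 + nv 8) (nv 7))
    (block [
      .setR 4 (rv 10 * rv 8 - rv 11 * rv 9),
      .setR 11 (rv 10 * rv 9 + rv 11 * rv 8),
      .setR 10 (rv 4)])
    .skip,
  .setR 4 (rv 8 * rv 8 - rv 9 * rv 9),
  .setR 9 (rv 8 * rv 9 + rv 9 * rv 8),
  .setR 8 (rv 4),
  .setN 7 (nv 8)]

/-- The power of one entry. -/
def cmdPowEntry : Cmd := block [
  .setR 8 (.get 3 (nv 6 + nv 3)), .setR 9 (.get 4 (nv 6 + nv 3)),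
  .setR 10 (rl 1), .setR 11 (rl 0), .setN 7 (nv 0),
  .while (.ltN (nl 0) (nv 7)) cmdPowStep,
  .store 3 (nv 6 + nv 1 + nv 3) (rv 10),
  .store 4 (nv 6 + nv 1 + nv 3) (rv 11),
  .setN 3 (nv 3 + nl 1)]

/-- The powers of all entries. -/
def cmdPow : Cmd := block [
  .setN 3 (nl 0),
  .while (.ltN (nv 3) (nv 1)) cmdPowEntry,
  .setN 6 (nv 6 + nv 1)]

/-- Two entries of a stage of the inverse Fourier transform. -/
def cmdInverseStep : Cmd := block [
  .setN 8 (nv 6 + nv 3 + nv 3),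
  .setR 8 (.get 3 (nv 8) - .get 3 (nv 8 + nl 1)),
  .setR 9 (.get 4 (nv 8) - .get 4 (nv 8 + nl 1)),
  .store 3 (nv 6 + nv 1 + nv 3) ((.get 3 (nv 8) + .get 3 (nv 8 + nl 1)) / rl 2),
  .store 4 (nv 6 + nv 1 + nv 3) ((.get 4 (nv 8) + .get 4 (nv 8 + nl 1)) / rl 2),
  .store 3 (nv 6 + nv 1 + nv 3 + nv 2) ((rv 8 * .get 5 (nv 4) + rv 9 * .get 6 (nv 4)) / rl 2),
  .store 4 (nv 6 + nv 1 + nv 3 + nv 2) ((rv 9 * .get 5 (nv 4) - rv 8 * .get 6 (nv 4)) / rl 2),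
  .setN 4 (nv 4 + nl 2),
  .ite (.ltN (nv 4) (nv 5)) .skip (.setN 4 (nl 0)),
  .setN 3 (nv 3 + nl 1)]

/-- A stage of the inverse Fourier transform. -/
def cmdInverseStage : Cmd := block [
  .setN 3 (nl 0), .setN 4 (nl 0),
  .while (.ltN (nv 3) (nv 2)) cmdInverseStep,
  .setN 6 (nv 6 + nv 1),
  .setN 5 (.half (nv 5))]

/-- The inverse Fourier transform. -/
def cmdInverse : Cmd := .while (.ltN (nl 1) (nv 5)) cmdInverseStage

/-- Subtraction of one mesh size from the shift. -/
def cmdShiftStep : Cmd := block [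
  .setR 7 (rv 7 - rv 3),
  .ite (.ltN (nl 0) (nv 8)) .skip (.setN 8 (nv 1)),
  .setN 8 (nv 8 - nl 1)]

/-- Reduction of the shift. -/
def cmdShift : Cmd := block [
  .while (.not (.ltR (rv 7) (.ofNat (nv 1) * rv 3))) (.setR 7 (rv 7 - .ofNat (nv 1) * rv 3)),
  .setN 8 (nv 2),
  .while (.not (.ltR (rv 7) (rv 3))) cmdShiftStep,
  .setR 7 (rv 7 - .ofNat (nv 2) * rv 3)]

/-- One term of the sum of the coefficients of the exponential. -/
def cmdTotalStep : Cmd := block [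
  .setR 13 (rv 13 + .get 3 (nv 6 + nv 4) * .exp (rl 0 - rv 4)),
  .setR 4 (rv 4 + rv 3),
  .setN 4 (nv 4 + nl 1),
  .ite (.ltN (nv 4) (nv 1)) .skip (.setN 4 (nl 0)),
  .setN 3 (nv 3 + nl 1)]

/-- The sum of the coefficients of the exponential. -/
def cmdTotal : Cmd := block [
  .setN 4 (nv 8), .setN 3 (nl 0), .setR 13 (rl 0), .setR 4 (rv 7),
  .while (.ltN (nv 3) (nv 1)) cmdTotalStep]

/-- One entry of the output. -/
def cmdOutputStep : Cmd := block [
  .store 0 (nv 3) (rv 7), .store 1 (nv 3) (rv 12), .store 2 (nv 3) (rv 13),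
  .setR 8 (.get 3 (nv 6 + nv 8)),
  .setR 12 (rv 12 - rv 8),
  .setR 13 (rv 13 - rv 8 * .exp (rl 0 - rv 7)),
  .setR 7 (rv 7 + rv 3),
  .setN 8 (nv 8 + nl 1),
  .ite (.ltN (nv 8) (nv 1)) .skip (.setN 8 (nl 0)),
  .setN 3 (nv 3 + nl 1)]

/-- The output. -/
def cmdOutput : Cmd := block [
  .setR 12 (rl 1 + rv 1 / rl 2), .setN 3 (nl 0),
  .while (.ltR (rv 7) (rv 2)) cmdOutputStep,
  .setN 0 (nv 3)]

/-- The numerical composition of privacy curves. -/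
def composePRV : Cmd := block [cmdSize, cmdTwiddle, cmdDiscretize, cmdForward, cmdPow, cmdInverse,
  cmdShift, cmdTotal, cmdOutput]

end RealRAM

/-! ### Correctness of the transforms and of the entrywise powers. -/

namespace RealRAM

variable {O : Oracle} {s : State}

/-- The segment of length `m` at `o` of the data holds `f`. -/
def State.Seg (s : State) (o m : ℕ) (f : ℕ → ℂ) : Prop :=
  ∀ y < m, s.arr 3 (o + y) = (f y).re ∧ s.arr 4 (o + y) = (f y).im

/-- The table of twiddle factors holds `ζ`. -/
def State.Twid (s : State) (m : ℕ) (ζ : ℕ → ℂ) : Prop :=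
  ∀ y < m, s.arr 5 y = (ζ y).re ∧ s.arr 6 y = (ζ y).im

theorem State.Seg.congr {s s' : State} {o m : ℕ} {f : ℕ → ℂ} (h : s.Seg o m f)
    (h3 : s'.arr 3 = s.arr 3) (h4 : s'.arr 4 = s.arr 4) : s'.Seg o m f := by
  intro y hy
  rw [h3, h4]
  exact h y hy

theorem State.Twid.congr {s s' : State} {m : ℕ} {f : ℕ → ℂ} (h : s.Twid m f)
    (h5 : s'.arr 5 = s.arr 5) (h6 : s'.arr 6 = s.arr 6) : s'.Twid m f := by
  intro y hy
  rw [h5, h6]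
  exact h y hy

/-- Writing an entry outside a segment. -/
theorem State.Seg.update {s s' : State} {o m p : ℕ} {u v : ℝ} {f : ℕ → ℂ} (h : s.Seg o m f)
    (h3 : s'.arr 3 = Function.update (s.arr 3) p u)
    (h4 : s'.arr 4 = Function.update (s.arr 4) p v) (hp : o + m ≤ p ∨ p < o) : s'.Seg o m f := by
  intro y hy
  have : o + y ≠ p := by omega
  rw [h3, h4, Function.update_of_ne this, Function.update_of_ne this]
  exact h y hy

/-- Writing the next entry of a segment. -/
theorem State.Seg.push {s s' : State} {o m : ℕ} {u v : ℝ} {f : ℕ → ℂ} (h : s.Seg o m f)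
    (h3 : s'.arr 3 = Function.update (s.arr 3) (o + m) u)
    (h4 : s'.arr 4 = Function.update (s.arr 4) (o + m) v) (hu : u = (f m).re)
    (hv : v = (f m).im) : s'.Seg o (m + 1) f := by
  intro y hy
  rw [h3, h4]
  rcases eq_or_ne y m with rfl | hym
  · simp [hu, hv]
  · have : o + y ≠ o + m := by omega
    rw [Function.update_of_ne this, Function.update_of_ne this]
    exact h y (by omega)

/-- The machine has no remainder operation; the program keeps residues by incrementing and resetting
a register. -/
theorem succ_mod_eq {x d : ℕ} (hd : 0 < d) :
    (x + 1) % d = if x % d + 1 < d then x % d + 1 else 0 := by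
  have h1 := Nat.mod_lt x hd
  rw [← Nat.mod_add_mod]
  split_ifs with h
  · exact Nat.mod_eq_of_lt h
  · have : x % d + 1 = d := by omega
    rw [this, Nat.mod_self]

theorem wp_cmdForwardStep {n H D o x : ℕ} {ζ src : ℕ → ℂ} (h1 : s.nat 1 = n) (h2 : s.nat 2 = H)
    (h5 : s.nat 5 = D) (h6 : s.nat 6 = o) (hx : s.nat 3 = x) (hq : s.nat 4 = x % D) (hD : 0 < D)
    (hDn : D ≤ n) (hn : n = 2 * H) (hxn : x < n) (hsrc : s.Seg o n src) (hζ : s.Twid n ζ)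
    (hdst : s.Seg (o + n) x fun y => src (y / 2) + ζ (y % D) * src (y / 2 + H)) :
    wp O cmdForwardStep (fun s' t => (s'.nat 3 = x + 1 ∧ s'.nat 4 = (x + 1) % D ∧ s'.Seg o n src ∧
      s'.Seg (o + n) (x + 1) fun y => src (y / 2) + ζ (y % D) * src (y / 2 + H)) ∧ t ≤ 80) s := by
  have hm := Nat.mod_lt x hD
  have r1 := hsrc (x / 2) (by omega)
  have r2 := hsrc (x / 2 + H) (by omega)
  rw [← add_assoc] at r2
  have r3 := hζ (x % D) (by omega)
  -- A stage reads the segment at `o` and writes a fresh one at `o + n`, so the first store does not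
  -- disturb what the second one reads.
  have ne1 : o + x / 2 ≠ o + n + x := by omega
  have ne2 : o + x / 2 + H ≠ o + n + x := by omega
  simp [cmdForwardStep, block, wp_ite, h1, h2, h5, h6, hx, hq, succ_mod_eq hD]
  constructor
  · intro h
    refine ⟨by simp [h], ?_, ?_⟩
    · exact hsrc.update rfl rfl (by omega)
    · refine hdst.push rfl rfl ?_ ?_
      · simp [r1, r2, r3]
      · simp [r1, r2, r3, Function.update_of_ne ne2]
  · intro h
    refine ⟨by omega, ?_, ?_⟩
    · exact hsrc.update rfl rfl (by omega)
    · refine hdst.push rfl rfl ?_ ?_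
      · simp [r1, r2, r3]
      · simp [r1, r2, r3, Function.update_of_ne ne2]

theorem wp_cmdForwardStage {n H D o : ℕ} {ζ src : ℕ → ℂ} (h1 : s.nat 1 = n) (h2 : s.nat 2 = H)
    (h5 : s.nat 5 = D) (h6 : s.nat 6 = o) (hD : 0 < D)
    (hDn : 2 * D ≤ n) (hn : n = 2 * H) (hsrc : s.Seg o n src) (hζ : s.Twid n ζ) :
    wp O cmdForwardStage (fun s' t => (s'.nat 5 = 2 * D ∧ s'.nat 6 = o + n ∧
      s'.Seg (o + n) n fun y => src (y / 2) + ζ (y % (2 * D)) * src (y / 2 + H)) ∧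
      t ≤ 200 * n) s := by
  simp only [cmdForwardStage, block, wp_seq, wp_setN]
  refine (wp_while _ _ (fun x s' => s'.nat 3 = x ∧ s'.nat 4 = x % (2 * D) ∧ s'.Seg o n src ∧
    s'.Seg (o + n) x fun y => src (y / 2) + ζ (y % (2 * D)) * src (y / 2 + H)) n 80 ?_ ?_ ?_).mono ?_
  · refine ⟨by simp, by simp, hsrc.congr rfl rfl, fun y hy => absurd hy (by omega)⟩
  · rintro x hx s' ha ⟨i3, i4, is, id⟩
    have a1 : s'.nat 1 = n := by rw [ha.nat 1 (by decide)]; simpa using h1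
    have a2 : s'.nat 2 = H := by rw [ha.nat 2 (by decide)]; simpa using h2
    have a5 : s'.nat 5 = 2 * D := by rw [ha.nat 5 (by decide)]; simp [h5, two_mul]
    have a6 : s'.nat 6 = o := by rw [ha.nat 6 (by decide)]; simpa using h6
    refine ⟨by simp [i3, a1, hx], ?_⟩
    exact wp_cmdForwardStep a1 a2 a5 a6 i3 i4 (by omega) hDn hn hx is
      (hζ.congr (ha.arr 5 (by decide)) (ha.arr 6 (by decide))) id
  · rintro s' ha ⟨i3, -⟩
    have a1 : s'.nat 1 = n := by rw [ha.nat 1 (by decide)]; simpa using h1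
    simp [i3, a1]
  · rintro s' t ⟨⟨-, -, -, id⟩, ha, ht⟩
    have a1 : s'.nat 1 = n := by rw [ha.nat 1 (by decide)]; simpa using h1
    have a5 : s'.nat 5 = 2 * D := by rw [ha.nat 5 (by decide)]; simp [h5, two_mul]
    have a6 : s'.nat 6 = o := by rw [ha.nat 6 (by decide)]; simpa using h6
    refine ⟨⟨by simpa using a5, by simp [a1, a6], id.congr rfl rfl⟩, ?_⟩
    simp at ht ⊢
    omega

theorem wp_cmdForward {n H T : ℕ} {ζ a : ℕ → ℂ} (h1 : s.nat 1 = n) (h2 : s.nat 2 = H)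
    (hnT : n = 2 ^ T) (hn : n = 2 * H) (hsrc : s.Seg 0 n a) (hζ : s.Twid n ζ) :
    wp O cmdForward (fun s' t => (s'.nat 5 = n ∧ s'.Seg (s'.nat 6) n (FFT.fft ζ H a T)) ∧
      t ≤ 300 * (n * (T + 1))) s := by
  simp only [cmdForward, block, wp_seq, wp_setN]
  refine (wp_while _ _ (fun j s' => s'.nat 5 = 2 ^ j ∧ s'.Seg (s'.nat 6) n (FFT.fft ζ H a j)) T
    (200 * n) ?_ ?_ ?_).mono ?_
  · exact ⟨by simp, fun y hy => by simpa [FFT.fft] using hsrc y hy⟩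
  · rintro j hj s' ha ⟨i5, is⟩
    have a1 : s'.nat 1 = n := by rw [ha.nat 1 (by decide)]; simpa using h1
    have a2 : s'.nat 2 = H := by rw [ha.nat 2 (by decide)]; simpa using h2
    have hlt : 2 * 2 ^ j ≤ n := by
      rw [hnT, ← pow_succ']; exact Nat.pow_le_pow_right (by norm_num) hj
    have hpos : 0 < 2 ^ j := by positivity
    refine ⟨by simp [i5, a1]; omega, ?_⟩
    refine (wp_cmdForwardStage a1 a2 i5 rfl hpos hlt hn is
      (hζ.congr (ha.arr 5 (by decide)) (ha.arr 6 (by decide)))).mono ?_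
    rintro s'' t ⟨⟨b5, b6, b⟩, ht⟩
    refine ⟨⟨by rw [b5, pow_succ'], ?_⟩, ht⟩
    rw [b6]
    intro y hy
    have := b y hy
    rwa [← pow_succ'] at this
  · rintro s' ha ⟨i5, -⟩
    have a1 : s'.nat 1 = n := by rw [ha.nat 1 (by decide)]; simpa using h1
    simp [i5, a1, hnT]
  · rintro s' t ⟨⟨i5, is⟩, ha, ht⟩
    refine ⟨⟨by rw [i5, hnT], is⟩, ?_⟩
    have hn1 : 0 < n := by rw [hnT]; positivity
    simp at ht ⊢
    nlinarith

/-- Binary exponentiation keeps r z^e constant: an odd exponent moves one factor z into r, then z is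
squared. -/
theorem wp_cmdPowStep {r z w : ℂ} {e : ℕ} (h7 : s.nat 7 = e) (h8 : s.real 8 = z.re)
    (h9 : s.real 9 = z.im) (h10 : s.real 10 = r.re) (h11 : s.real 11 = r.im)
    (hw : r * z ^ e = w) :
    wp O cmdPowStep (fun s' t => (s'.nat 7 = e / 2 ∧ ∃ r' z' : ℂ, s'.real 8 = z'.re ∧
      s'.real 9 = z'.im ∧ s'.real 10 = r'.re ∧ s'.real 11 = r'.im ∧ r' * z' ^ (e / 2) = w) ∧
      t ≤ 80) s := by
  simp [cmdPowStep, block, wp_ite, h7, h8, h9, h10, h11]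
  constructor
  · intro h
    have hodd : e = 2 * (e / 2) + 1 := by omega
    refine ⟨r * z, z * z, by simp, by simp, by simp, by simp, ?_⟩
    rw [← hw]
    conv_rhs => rw [hodd]
    rw [pow_succ, pow_mul]
    ring
  · intro h
    have heven : e = 2 * (e / 2) := by omega
    refine ⟨r, z * z, by simp, by simp, rfl, rfl, ?_⟩
    rw [← hw]
    conv_rhs => rw [heven]
    rw [pow_mul]
    ring

theorem wp_cmdPowEntry {k n o x : ℕ} {src : ℕ → ℂ} (h0 : s.nat 0 = k) (h1 : s.nat 1 = n)
    (h6 : s.nat 6 = o) (hx : s.nat 3 = x) (hxn : x < n) (hsrc : s.Seg o n src)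
    (hdst : s.Seg (o + n) x fun y => src y ^ k) :
    wp O cmdPowEntry (fun s' t => (s'.nat 3 = x + 1 ∧ s'.Seg o n src ∧
      s'.Seg (o + n) (x + 1) fun y => src y ^ k) ∧ t ≤ 200 * (k.size + 1)) s := by
  simp only [cmdPowEntry, block, wp_seq, wp_setN, wp_setR, wp_store]
  refine (wp_while _ _ (fun j s' => s'.nat 7 = k / 2 ^ j ∧ ∃ r z : ℂ, s'.real 8 = z.re ∧
      s'.real 9 = z.im ∧ s'.real 10 = r.re ∧ s'.real 11 = r.im ∧
      r * z ^ (k / 2 ^ j) = src x ^ k) k.size 80 ?_ ?_ ?_).mono ?_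
  · have := hsrc x hxn
    exact ⟨by simp [h0], 1, src x, by simp [h6, hx, this], by simp [h6, hx, this], by simp,
      by simp, by simp⟩
  · rintro j hj s' ha ⟨i7, r, z, i8, i9, i10, i11, hw⟩
    have hpos : 0 < k / 2 ^ j := Nat.div_pos (Nat.lt_size.1 hj) (by positivity)
    refine ⟨by simp only [BExp.eval_ltN, NExp.eval_lit, NExp.eval_var, i7]; exact hpos, ?_⟩
    have := wp_cmdPowStep (O := O) i7 i8 i9 i10 i11 hw
    rwa [Nat.div_div_eq_div_mul, ← pow_succ] at this
  · rintro s' ha ⟨i7, -⟩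
    have : k / 2 ^ k.size = 0 := Nat.div_eq_of_lt (Nat.lt_size_self k)
    simp [i7, this]
  · rintro s' t ⟨⟨i7, r, z, i8, i9, i10, i11, hw⟩, ha, ht⟩
    have a1 : s'.nat 1 = n := by rw [ha.nat 1 (by decide)]; simpa using h1
    have a3 : s'.nat 3 = x := by rw [ha.nat 3 (by decide)]; simpa using hx
    have a6 : s'.nat 6 = o := by rw [ha.nat 6 (by decide)]; simpa using h6
    have e3 : s'.arr 3 = s.arr 3 := ha.arr 3 (by decide)
    have e4 : s'.arr 4 = s.arr 4 := ha.arr 4 (by decide)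
    rw [Nat.div_eq_of_lt (Nat.lt_size_self k), pow_zero, mul_one] at hw
    refine ⟨⟨by simp [a3], ?_, ?_⟩, ?_⟩
    · exact (hsrc.congr e3 e4).update (p := o + n + x) (u := r.re) (v := r.im)
        (by simp [a1, a3, a6, i10]) (by simp [a1, a3, a6, i11]) (by omega)
    · exact (hdst.congr e3 e4).push (u := r.re) (v := r.im)
        (by simp [a1, a3, a6, i10]) (by simp [a1, a3, a6, i11]) (by simp [hw]) (by simp [hw])
    · simp at ht ⊢
      omega

theorem wp_cmdPow {k n o : ℕ} {src : ℕ → ℂ} (h0 : s.nat 0 = k) (h1 : s.nat 1 = n)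
    (h6 : s.nat 6 = o) (hsrc : s.Seg o n src) (hn : 0 < n) :
    wp O cmdPow (fun s' t => (s'.Seg (s'.nat 6) n fun y => src y ^ k) ∧
      t ≤ 500 * (n * (k.size + 1))) s := by
  simp only [cmdPow, block, wp_seq, wp_setN]
  refine (wp_while _ _ (fun x s' => s'.nat 3 = x ∧ s'.Seg o n src ∧
    s'.Seg (o + n) x fun y => src y ^ k) n (200 * (k.size + 1)) ?_ ?_ ?_).mono ?_
  · exact ⟨by simp, hsrc.congr rfl rfl, fun y hy => absurd hy (by omega)⟩
  · rintro x hx s' ha ⟨i3, is, id⟩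
    have a0 : s'.nat 0 = k := by rw [ha.nat 0 (by decide)]; simpa using h0
    have a1 : s'.nat 1 = n := by rw [ha.nat 1 (by decide)]; simpa using h1
    have a6 : s'.nat 6 = o := by rw [ha.nat 6 (by decide)]; simpa using h6
    exact ⟨by simp [i3, a1, hx], wp_cmdPowEntry a0 a1 a6 i3 hx is id⟩
  · rintro s' ha ⟨i3, -⟩
    have a1 : s'.nat 1 = n := by rw [ha.nat 1 (by decide)]; simpa using h1
    simp [i3, a1]
  · rintro s' t ⟨⟨-, -, id⟩, ha, ht⟩
    have a1 : s'.nat 1 = n := by rw [ha.nat 1 (by decide)]; simpa using h1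
    have a6 : s'.nat 6 = o := by rw [ha.nat 6 (by decide)]; simpa using h6
    refine ⟨by simpa [a1, a6] using id.congr (s' := { s' with nat := Function.update s'.nat 6 (o + n) }) rfl rfl, ?_⟩
    simp at ht ⊢
    nlinarith

theorem wp_cmdInverseStep {n H D o x : ℕ} {ζ src dst : ℕ → ℂ} (h1 : s.nat 1 = n)
    (h2 : s.nat 2 = H) (h5 : s.nat 5 = 2 * D) (h6 : s.nat 6 = o) (hx : s.nat 3 = x)
    (hq : s.nat 4 = 2 * x % (2 * D)) (hD : 0 < D)
    (hDn : 2 * D ≤ n) (hn : n = 2 * H) (hxH : x < H) (hsrc : s.Seg o n src) (hζ : s.Twid n ζ)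
    (hlo : ∀ y, y < H → dst y = (src (2 * y) + src (2 * y + 1)) / 2)
    (hhi : ∀ y, y < H → dst (y + H) = (src (2 * y) - src (2 * y + 1)) *
      (starRingEnd ℂ) (ζ (2 * y % (2 * D))) / 2)
    (hdst : s.Seg (o + n) x dst) (hdst' : s.Seg (o + n + H) x fun y => dst (y + H)) :
    wp O cmdInverseStep (fun s' t => (s'.nat 3 = x + 1 ∧ s'.nat 4 = 2 * (x + 1) % (2 * D) ∧
      s'.Seg o n src ∧ s'.Seg (o + n) (x + 1) dst ∧
      s'.Seg (o + n + H) (x + 1) fun y => dst (y + H)) ∧ t ≤ 160) s := by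
  have hm := Nat.mod_lt x hD
  have r1 := hsrc (2 * x) (by omega)
  have r2 := hsrc (2 * x + 1) (by omega)
  rw [Nat.mul_mod_mul_left] at hq
  have r3 := hζ (2 * (x % D)) (by omega)
  have hl := hlo x hxH
  have hh := hhi x hxH
  rw [Nat.mul_mod_mul_left] at hh
  rw [show o + 2 * x = o + x + x by ring] at r1
  rw [show o + (2 * x + 1) = o + x + x + 1 by ring] at r2
  have ne1 : o + x + x ≠ o + n + x := by omega
  have ne2 : o + x + x + 1 ≠ o + n + x := by omega
  have q1 : 2 * (x + 1) % (2 * D) = if x % D + 1 < D then 2 * (x % D) + 2 else 0 := by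
    rw [Nat.mul_mod_mul_left, succ_mod_eq hD]
    split_ifs <;> ring
  have v1 : (dst x).re = (s.arr 3 (o + x + x) + s.arr 3 (o + x + x + 1)) / 2 := by
    rw [hl, r1.1, r2.1]; simp
  have v2 : (dst x).im = (s.arr 4 (o + x + x) + s.arr 4 (o + x + x + 1)) / 2 := by
    rw [hl, r1.2, r2.2]; simp
  have v3 : (dst (x + H)).re = ((s.arr 3 (o + x + x) - s.arr 3 (o + x + x + 1)) *
      s.arr 5 (2 * (x % D)) + (s.arr 4 (o + x + x) - s.arr 4 (o + x + x + 1)) *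
        s.arr 6 (2 * (x % D))) / 2 := by
    rw [hh, r1.1, r2.1, r1.2, r2.2, r3.1, r3.2]; simp
  have v4 : (dst (x + H)).im = ((s.arr 4 (o + x + x) - s.arr 4 (o + x + x + 1)) *
      s.arr 5 (2 * (x % D)) - (s.arr 3 (o + x + x) - s.arr 3 (o + x + x + 1)) *
        s.arr 6 (2 * (x % D))) / 2 := by
    rw [hh, r1.1, r2.1, r1.2, r2.2, r3.1, r3.2]; simp; ring
  -- The two output entries are written through an intermediate state `s₁`, so that the segment
  -- lemmas handle one write at a time.
  have key : ∀ s' : State,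
      s'.arr 3 = Function.update (Function.update (s.arr 3) (o + n + x) (dst x).re) (o + n + x + H)
        (dst (x + H)).re →
      s'.arr 4 = Function.update (Function.update (s.arr 4) (o + n + x) (dst x).im) (o + n + x + H)
        (dst (x + H)).im →
      s'.Seg o n src ∧ s'.Seg (o + n) (x + 1) dst ∧
      s'.Seg (o + n + H) (x + 1) fun y => dst (y + H) := by
    intro s' a3 a4
    set s₁ : State := { s with
      arr := Function.update (Function.update s.arr 3
        (Function.update (s.arr 3) (o + n + x) (dst x).re)) 4
          (Function.update (s.arr 4) (o + n + x) (dst x).im) } with hs₁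
    have b3 : s₁.arr 3 = Function.update (s.arr 3) (o + n + x) (dst x).re := by simp [hs₁]
    have b4 : s₁.arr 4 = Function.update (s.arr 4) (o + n + x) (dst x).im := by simp [hs₁]
    rw [← b3] at a3
    rw [← b4] at a4
    refine ⟨?_, ?_, ?_⟩
    · exact (hsrc.update b3 b4 (by omega)).update a3 a4 (by omega)
    · exact (hdst.push b3 b4 rfl rfl).update a3 a4 (by omega)
    · rw [show o + n + x + H = o + n + H + x by ring] at a3 a4
      exact (hdst'.update b3 b4 (by omega)).push a3 a4 rfl rfl
  rw [v1, v2, v3, v4] at key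
  simp [cmdInverseStep, block, wp_ite, h1, h2, h5, h6, hx, hq]
  rw [q1]
  constructor
  · intro h
    exact ⟨(if_pos (by omega)).symm, key _ (by simp) (by simp)⟩
  · intro h
    exact ⟨(if_neg (by omega)).symm, key _ (by simp) (by simp)⟩

end RealRAM

namespace RealRAM

variable {O : Oracle} {s : State}

theorem State.Seg.append {o m m' : ℕ} {f : ℕ → ℂ} (h : s.Seg o m f)
    (h' : s.Seg (o + m) m' fun y => f (y + m)) : s.Seg o (m + m') f := by
  intro y hy
  by_cases hym : y < m
  · exact h y hym
  · have := h' (y - m) (by omega)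
    simp only at this
    rwa [show o + m + (y - m) = o + y by omega, show y - m + m = y by omega] at this

theorem wp_cmdInverseStage {n H D o : ℕ} {ζ src : ℕ → ℂ} (h1 : s.nat 1 = n) (h2 : s.nat 2 = H)
    (h5 : s.nat 5 = 2 * D) (h6 : s.nat 6 = o) (hD : 0 < D)
    (hDn : 2 * D ≤ n) (hn : n = 2 * H) (hsrc : s.Seg o n src) (hζ : s.Twid n ζ) :
    wp O cmdInverseStage (fun s' t => (s'.nat 5 = D ∧ s'.nat 6 = o + n ∧ ∃ dst : ℕ → ℂ,
      (∀ y, y < H → dst y = (src (2 * y) + src (2 * y + 1)) / 2) ∧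
      (∀ y, y < H → dst (y + H) = (src (2 * y) - src (2 * y + 1)) *
        (starRingEnd ℂ) (ζ (2 * y % (2 * D))) / 2) ∧ s'.Seg (o + n) n dst) ∧ t ≤ 400 * n) s := by
  set dst : ℕ → ℂ := fun y => if y < H then (src (2 * y) + src (2 * y + 1)) / 2 else
    (src (2 * (y - H)) - src (2 * (y - H) + 1)) *
        (starRingEnd ℂ) (ζ (2 * (y - H) % (2 * D))) / 2 with hdst
  have hlo : ∀ y, y < H → dst y = (src (2 * y) + src (2 * y + 1)) / 2 := by
    intro y hy; simp [hdst, hy]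
  have hhi : ∀ y, y < H → dst (y + H) = (src (2 * y) - src (2 * y + 1)) *
        (starRingEnd ℂ) (ζ (2 * y % (2 * D))) / 2 := by
    intro y _; simp [hdst]
  simp only [cmdInverseStage, block, wp_seq, wp_setN]
  refine (wp_while _ _ (fun x s' => s'.nat 3 = x ∧ s'.nat 4 = 2 * x % (2 * D) ∧ s'.Seg o n src ∧
    s'.Seg (o + n) x dst ∧ s'.Seg (o + n + H) x fun y => dst (y + H)) H 160 ?_ ?_ ?_).mono ?_
  · exact ⟨by simp, by simp, hsrc.congr rfl rfl, fun y hy => absurd hy (by omega),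
      fun y hy => absurd hy (by omega)⟩
  · rintro x hx s' ha ⟨i3, i4, is, id, id'⟩
    have a1 : s'.nat 1 = n := by rw [ha.nat 1 (by decide)]; simpa using h1
    have a2 : s'.nat 2 = H := by rw [ha.nat 2 (by decide)]; simpa using h2
    have a5 : s'.nat 5 = 2 * D := by rw [ha.nat 5 (by decide)]; simpa using h5
    have a6 : s'.nat 6 = o := by rw [ha.nat 6 (by decide)]; simpa using h6
    refine ⟨by simp [i3, a2, hx], ?_⟩
    exact wp_cmdInverseStep a1 a2 a5 a6 i3 i4 hD hDn hn hx is
      (hζ.congr (ha.arr 5 (by decide)) (ha.arr 6 (by decide))) hlo hhi id id'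
  · rintro s' ha ⟨i3, -⟩
    have a2 : s'.nat 2 = H := by rw [ha.nat 2 (by decide)]; simpa using h2
    simp [i3, a2]
  · rintro s' t ⟨⟨-, -, -, id, id'⟩, ha, ht⟩
    have a1 : s'.nat 1 = n := by rw [ha.nat 1 (by decide)]; simpa using h1
    have a5 : s'.nat 5 = 2 * D := by rw [ha.nat 5 (by decide)]; simpa using h5
    have a6 : s'.nat 6 = o := by rw [ha.nat 6 (by decide)]; simpa using h6
    refine ⟨⟨by simp [a5], by simp [a1, a6], dst, hlo, hhi, ?_⟩, ?_⟩
    · have := id.append id'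
      rw [← two_mul, ← hn] at this
      exact this.congr rfl rfl
    · simp at ht ⊢
      omega

-- Invariant after j stages: modulo X^{2^j} − ζ_b, strand b is the k-th power of strand b of the
-- forward transform at stage T − j. At j = 0 strands are constants and this is the entrywise power;
-- at j = T there is one strand and the modulus is X^n − 1.
open Polynomial in
theorem wp_cmdInverse {n H T k : ℕ} {ζ a : ℕ → ℂ} (h1 : s.nat 1 = n) (h2 : s.nat 2 = H)
    (h5 : s.nat 5 = n) (hnT : n = 2 ^ T) (hn : n = 2 * H) (hζ' : FFT.IsTwiddle n ζ)
    (hsrc : s.Seg (s.nat 6) n fun y => FFT.fft ζ H a T y ^ k) (hζ : s.Twid n ζ) :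
    wp O cmdInverse (fun s' t => (∃ c, s'.Seg (s'.nat 6) n c ∧
      (X ^ n - 1 : ℂ[X]) ∣ FFT.strand 1 n c 0 - FFT.strand 1 n a 0 ^ k) ∧
      t ≤ 500 * (n * (T + 1))) s := by
  rw [cmdInverse]
  refine (wp_while _ _ (fun j s' => s'.nat 5 = 2 ^ (T - j) ∧ ∃ c, s'.Seg (s'.nat 6) n c ∧
    ∀ b, b < 2 ^ (T - j) → (X ^ (2 ^ j) - C (ζ b) : ℂ[X]) ∣
      FFT.strand (2 ^ (T - j)) (2 ^ j) c b -
        FFT.strand (2 ^ (T - j)) (2 ^ j) (FFT.fft ζ H a (T - j)) b ^ k) T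
    (400 * n) ?_ ?_ ?_).mono ?_
  · refine ⟨by simp [h5, hnT], _, hsrc, fun b _ => ?_⟩
    simp [FFT.strand]
  · rintro j hj s' ha ⟨i5, c', is, hc'⟩
    have a1 : s'.nat 1 = n := by rw [ha.nat 1 (by decide)]; simpa using h1
    have a2 : s'.nat 2 = H := by rw [ha.nat 2 (by decide)]; simpa using h2
    obtain ⟨t, ht⟩ : ∃ t, T = t + 1 + j := ⟨T - j - 1, by omega⟩
    have e1 : T - j = t + 1 := by omega
    have e2 : T - (j + 1) = t := by omega
    rw [e1, pow_succ'] at i5 hc'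
    have hpos : 0 < 2 ^ t := by positivity
    have hnm : 2 * (2 ^ j * 2 ^ t) = n := by
      rw [hnT, ht, pow_add, pow_succ]; ring
    have hH : 2 ^ j * 2 ^ t = H := by omega
    have hle : 2 * 2 ^ t ≤ n := by
      rw [← hnm]
      have : 1 ≤ 2 ^ j := Nat.one_le_two_pow
      nlinarith
    refine ⟨by simp [i5]; omega, ?_⟩
    refine (wp_cmdInverseStage a1 a2 i5 rfl hpos hle hn is
      (hζ.congr (ha.arr 5 (by decide)) (ha.arr 6 (by decide)))).mono ?_
    rintro s'' τ ⟨⟨b5, b6, c, hlo, hhi, b⟩, hτ⟩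
    refine ⟨⟨by rw [b5, e2], c, by rw [b6]; exact b, fun b hb => ?_⟩, hτ⟩
    rw [e2] at hb ⊢
    rw [← hH] at hlo hhi
    rw [pow_succ']
    refine FFT.dvd_strand_sub_pow hζ' hnm (by positivity) ?_ hlo hhi hc' hb
    intro x _
    rw [FFT.fft, hH, pow_succ']
  · rintro s' ha ⟨i5, -⟩
    simp [i5]
  · rintro s' t ⟨⟨-, c, is, hc⟩, ha, ht⟩
    refine ⟨⟨c, is, ?_⟩, ?_⟩
    · have := hc 0 (by simp)
      simpa [hζ'.zero, ← hnT, FFT.fft] using this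
    · have hn1 : 0 < n := by rw [hnT]; positivity
      simp at ht ⊢
      nlinarith

end RealRAM

/-! ### Transform size, twiddle factors, discretization. -/

namespace RealRAM

variable {O : Oracle} {s : State}

theorem wp_cmdSize {k T : ℕ} {σ δ u h : ℝ} (h0 : s.nat 0 = k) (r0 : s.real 0 = σ)
    (r1 : s.real 1 = δ) (r2 : s.real 2 = u) (hh : h = σ / √((k : ℝ) / 2 * Real.log (12 / δ)))
    (hlt : ∀ j < T, (2 : ℝ) ^ j * h < 8 * (2 + σ + u)) (hle : 8 * (2 + σ + u) ≤ (2 : ℝ) ^ T * h) :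
    wp O cmdSize (fun s' t => (s'.nat 1 = 2 ^ T ∧ s'.nat 2 = 2 ^ T / 2 ∧ s'.real 3 = h) ∧
      t ≤ 100 * (T + 1)) s := by
  simp only [cmdSize, block, wp_seq, wp_setN, wp_setR]
  refine (wp_while _ _ (fun j s' => s'.nat 1 = 2 ^ j ∧ s'.real 3 = h) T 10 ?_ ?_ ?_).mono ?_
  · exact ⟨by simp, by simp [h0, r0, r1, hh]⟩
  · rintro j hj s' ha ⟨i1, i3⟩
    have a0 : s'.real 0 = σ := by rw [ha.real 0 (by decide)]; simpa using r0
    have a2 : s'.real 2 = u := by rw [ha.real 2 (by decide)]; simpa using r2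
    refine ⟨by simp [i1, i3, a0, a2, hlt j hj], ?_⟩
    simp [i1, i3, pow_succ, mul_two]
  · rintro s' ha ⟨i1, i3⟩
    have a0 : s'.real 0 = σ := by rw [ha.real 0 (by decide)]; simpa using r0
    have a2 : s'.real 2 = u := by rw [ha.real 2 (by decide)]; simpa using r2
    simp [i1, i3, a0, a2, hle]
  · rintro s' t ⟨⟨i1, i3⟩, ha, ht⟩
    simp at ht ⊢
    exact ⟨⟨i1, by rw [i1], i3⟩, by omega⟩

/-- (1 + z)/|1 + z| bisects the angle between 1 and z, and |1 + z|² = 2 + 2 Re z on the unit circle.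
One real square root suffices, without trigonometric functions, as long as z ≠ −1. -/
theorem exists_sqrt_twiddle {z : ℂ} (hz : z * (starRingEnd ℂ) z = 1) (hne : z ≠ -1) :
    (⟨(1 + z.re) / √(2 + 2 * z.re), z.im / √(2 + 2 * z.re)⟩ : ℂ) ^ 2 = z ∧
    (⟨(1 + z.re) / √(2 + 2 * z.re), z.im / √(2 + 2 * z.re)⟩ : ℂ) *
      (starRingEnd ℂ) ⟨(1 + z.re) / √(2 + 2 * z.re), z.im / √(2 + 2 * z.re)⟩ = 1 := by
  have h1 : z.re * z.re + z.im * z.im = 1 := by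
    have := congrArg Complex.re hz
    simpa using this
  have hpos : 0 < 2 + 2 * z.re := by
    have hge : -1 ≤ z.re := by nlinarith [mul_self_nonneg z.im]
    rcases hge.lt_or_eq with h | h
    · linarith
    · exfalso
      apply hne
      have him : z.im = 0 := by
        have : z.im * z.im = 0 := by rw [← h] at h1; linarith
        exact mul_self_eq_zero.1 this
      apply Complex.ext <;> simp [him, ← h]
  set r := √(2 + 2 * z.re) with hr
  have hr2 : r * r = 2 + 2 * z.re := Real.mul_self_sqrt hpos.le
  have hr0 : r ≠ 0 := (Real.sqrt_pos.2 hpos).ne'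
  constructor
  · rw [pow_two]
    apply Complex.ext
    · simp only [Complex.mul_re]
      field_simp
      rw [pow_two r, hr2]
      linear_combination -h1
    · simp only [Complex.mul_im]
      field_simp
      rw [pow_two r, hr2]
      ring
  · apply Complex.ext
    · simp only [Complex.mul_re, Complex.conj_re, Complex.conj_im, Complex.one_re]
      field_simp
      rw [pow_two r, hr2]
      linear_combination h1
    · simp only [Complex.mul_im, Complex.conj_re, Complex.conj_im, Complex.one_im]
      ring

theorem wp_cmdTwiddleStep {m : ℕ} (hm : 2 ≤ m) (h3 : s.nat 3 = m)
    (hs : ∃ ζ, s.Twid (2 * m) ζ ∧ FFT.IsTwiddle (2 * m) ζ ∧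
      ∀ b, 2 ≤ b → b < 2 * m → ζ b ≠ 1 ∧ ζ b ≠ -1) :
    wp O cmdTwiddleStep (fun s' t => (s'.nat 3 = m + 1 ∧ ∃ ζ, s'.Twid (2 * (m + 1)) ζ ∧
      FFT.IsTwiddle (2 * (m + 1)) ζ ∧ ∀ b, 2 ≤ b → b < 2 * (m + 1) → ζ b ≠ 1 ∧ ζ b ≠ -1) ∧
      t ≤ 80) s := by
  obtain ⟨ζ, ht, hζ, hne⟩ := hs
  obtain ⟨hw2, hwc⟩ := exists_sqrt_twiddle (hζ.conj m (by omega)) (hne m hm (by omega)).2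
  have r := ht m (by omega)
  set w : ℂ := ⟨(1 + (ζ m).re) / √(2 + 2 * (ζ m).re), (ζ m).im / √(2 + 2 * (ζ m).re)⟩ with hw
  set ζ' : ℕ → ℂ := fun b => if b = 2 * m then w else if b = 2 * m + 1 then -w else ζ b with hζ'
  have z0 : ζ' (2 * m) = w := by simp [hζ']
  have z1 : ζ' (2 * m + 1) = -w := by simp [hζ']
  have z2 : ∀ b, b < 2 * m → ζ' b = ζ b := by
    intro b hb
    have h1 : b ≠ 2 * m := by omega
    have h2 : b ≠ 2 * m + 1 := by omega
    simp [hζ', h1, h2]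
  -- Both 1 and −1 have square 1, while the square of `w` is not 1. This keeps all later roots away
  -- from the degenerate point −1.
  have hw1 : w ≠ 1 ∧ w ≠ -1 := by
    constructor <;> intro h <;> apply (hne m hm (by omega)).1 <;> rw [← hw2, h] <;> norm_num
  have hI : FFT.IsTwiddle (2 * (m + 1)) ζ' := by
    refine ⟨by rw [z2 0 (by omega)]; exact hζ.zero, fun b hb => ?_, fun b hb => ?_, fun b hb => ?_⟩
    · rcases eq_or_ne b m with rfl | hbm
      · rw [z0, hw2, z2 _ (by omega)]
      · rw [z2 _ (by omega), z2 _ (by omega)]; exact hζ.sq b (by omega)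
    · rcases eq_or_ne b m with rfl | hbm
      · rw [z0, z1]
      · rw [z2 _ (by omega), z2 _ (by omega)]; exact hζ.neg b (by omega)
    · have : b < 2 * m ∨ b = 2 * m ∨ b = 2 * m + 1 := by omega
      rcases this with h | rfl | rfl
      · rw [z2 b h]; exact hζ.conj b h
      · rw [z0, hwc]
      · rw [z1, map_neg, neg_mul_neg, hwc]
  have hN : ∀ b, 2 ≤ b → b < 2 * (m + 1) → ζ' b ≠ 1 ∧ ζ' b ≠ -1 := by
    intro b h2 hb
    have : b < 2 * m ∨ b = 2 * m ∨ b = 2 * m + 1 := by omega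
    rcases this with h | rfl | rfl
    · rw [z2 b h]; exact hne b h2 h
    · rw [z0]; exact hw1
    · rw [z1]
      exact ⟨fun h => hw1.2 (by rw [← h, neg_neg]), fun h => hw1.1 (neg_injective h)⟩
  have wre : w.re = (1 + s.arr 5 m) / √(2 + 2 * s.arr 5 m) := by rw [r.1]
  have wim : w.im = s.arr 6 m / √(2 + 2 * s.arr 5 m) := by rw [r.1, r.2]
  have key : ∀ s' : State, s'.nat 3 = m + 1 →
      s'.arr 5 = Function.update (Function.update (s.arr 5) (m + m) w.re) (m + m + 1) (-w.re) →
      s'.arr 6 = Function.update (Function.update (s.arr 6) (m + m) w.im) (m + m + 1) (-w.im) →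
      s'.nat 3 = m + 1 ∧ ∃ ζ, s'.Twid (2 * (m + 1)) ζ ∧
      FFT.IsTwiddle (2 * (m + 1)) ζ ∧ ∀ b, 2 ≤ b → b < 2 * (m + 1) → ζ b ≠ 1 ∧ ζ b ≠ -1 := by
    intro s' e3 e5 e6
    refine ⟨e3, ζ', fun b hb => ?_, hI, hN⟩
    rw [e5, e6]
    have : b < 2 * m ∨ b = m + m ∨ b = m + m + 1 := by omega
    rcases this with h | rfl | rfl
    · rw [Function.update_of_ne (by omega), Function.update_of_ne (by omega),
        Function.update_of_ne (by omega), Function.update_of_ne (by omega), z2 b h]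
      exact ht b h
    · rw [← two_mul, z0]; simp
    · rw [← two_mul, z1]; simp
  rw [wre, wim] at key
  refine wp.mono (Q := fun s' t => (s'.nat 3 = m + 1 ∧ s'.arr 5 = _ ∧ s'.arr 6 = _) ∧ t ≤ 80) ?_
    fun s' t h => ⟨key s' h.1.1 h.1.2.1 h.1.2.2, h.2⟩
  simp [cmdTwiddleStep, block, h3]

/-- The entries 1, −1, i, −i are written by hand because the root formula divides by zero at −1;
from index 2 on no entry is ±1. -/
theorem wp_cmdTwiddle {n H : ℕ} (h2 : s.nat 2 = H) (hn : n = 2 * H) (hH : 2 ≤ H) :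
    wp O cmdTwiddle (fun s' t => (∃ ζ, s'.Twid n ζ ∧ FFT.IsTwiddle n ζ) ∧ t ≤ 200 * n) s := by
  simp only [cmdTwiddle, block, wp_seq, wp_setN, wp_store]
  refine (wp_while _ _ (fun j s' => s'.nat 3 = j + 2 ∧ ∃ ζ, s'.Twid (2 * (j + 2)) ζ ∧
      FFT.IsTwiddle (2 * (j + 2)) ζ ∧ ∀ b, 2 ≤ b → b < 2 * (j + 2) → ζ b ≠ 1 ∧ ζ b ≠ -1)
      (H - 2) 80 ?_ ?_ ?_).mono ?_
  · refine ⟨by simp, fun b => if b = 0 then 1 else if b = 1 then -1 else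
      if b = 2 then Complex.I else -Complex.I, ?_, ⟨?_, ?_, ?_, ?_⟩, ?_⟩
    · intro y hy
      have : y = 0 ∨ y = 1 ∨ y = 2 ∨ y = 3 := by omega
      rcases this with rfl | rfl | rfl | rfl <;> simp
    · simp
    · intro b hb
      have : b = 0 ∨ b = 1 := by omega
      rcases this with rfl | rfl <;> simp
    · intro b hb
      have : b = 0 ∨ b = 1 := by omega
      rcases this with rfl | rfl <;> simp
    · intro b hb
      have : b = 0 ∨ b = 1 ∨ b = 2 ∨ b = 3 := by omega
      rcases this with rfl | rfl | rfl | rfl <;> simp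
    · intro b hb hb'
      have : b = 2 ∨ b = 3 := by omega
      rcases this with rfl | rfl <;> simp [Complex.ext_iff]
  · rintro j hj s' ha ⟨i3, hs⟩
    have a2 : s'.nat 2 = H := by rw [ha.nat 2 (by decide)]; simpa using h2
    refine ⟨by simp [i3, a2]; omega, ?_⟩
    have := wp_cmdTwiddleStep (O := O) (by omega) i3 hs
    rwa [show j + 2 + 1 = j + 1 + 2 by ring] at this
  · rintro s' ha ⟨i3, -⟩
    have a2 : s'.nat 2 = H := by rw [ha.nat 2 (by decide)]; simpa using h2
    simp [i3, a2]; omega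
  · rintro s' t ⟨⟨-, ζ, ht, hζ, -⟩, ha, hc⟩
    rw [show 2 * (H - 2 + 2) = n by omega] at ht hζ
    refine ⟨⟨ζ, ht, hζ⟩, ?_⟩
    simp at hc ⊢
    omega

/-- Left end of a cell of the discretization. -/
noncomputable def cellLeft (n H : ℕ) (h : ℝ) (x : ℕ) : ℝ :=
  if x < H then x * h else x * h - n * h

/-- Mass of a cell of the discretization. -/
noncomputable def cellMass (O : Oracle) (n H : ℕ) (h : ℝ) (x : ℕ) : ℝ :=
  O.cdf (cellLeft n H h x + h) - O.cdf (cellLeft n H h x)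

/-- The mean shift that makes up for the discretization. -/
noncomputable def meanShift (O : Oracle) (n H : ℕ) (h : ℝ) : ℝ :=
  (O.truncMean (H * h) - ∑ x ∈ Finset.range n, cellMass O n H h x * cellLeft n H h x) /
    ∑ x ∈ Finset.range n, cellMass O n H h x

theorem wp_cmdCell {n H x : ℕ} {h : ℝ} (h1 : s.nat 1 = n) (h2 : s.nat 2 = H)
    (r3 : s.real 3 = h) (h3 : s.nat 3 = x)
    (r5 : s.real 5 = ∑ x ∈ Finset.range x, cellMass O n H h x)
    (r6 : s.real 6 = ∑ x ∈ Finset.range x, cellMass O n H h x * cellLeft n H h x)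
    (hs : s.Seg 0 x fun x => cellMass O n H h x) :
    wp O cmdCell (fun s' t => (s'.nat 3 = x + 1 ∧
      s'.real 5 = ∑ x ∈ Finset.range (x + 1), cellMass O n H h x ∧
      s'.real 6 = ∑ x ∈ Finset.range (x + 1), cellMass O n H h x * cellLeft n H h x ∧
      s'.Seg 0 (x + 1) fun x => cellMass O n H h x) ∧ t ≤ 80) s := by
  simp [cmdCell, block, wp_ite, h1, h2, r3, h3, r5, r6, Finset.sum_range_succ]
  constructor
  · intro hx
    have e : cellLeft n H h x = x * h := by simp [cellLeft, hx]
    have e' : cellMass O n H h x = O.cdf (x * h + h) - O.cdf (x * h) := by rw [cellMass, e]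
    refine ⟨e'.symm, by rw [e', e], ?_⟩
    exact hs.push (u := cellMass O n H h x) (v := 0) (by simp [e']) (by simp) (by simp) (by simp)
  · intro hx
    have e : cellLeft n H h x = x * h - n * h := by simp [cellLeft, hx]
    have e' : cellMass O n H h x = O.cdf (x * h - n * h + h) - O.cdf (x * h - n * h) := by
      rw [cellMass, e]
    refine ⟨e'.symm, by rw [e', e], ?_⟩
    exact hs.push (u := cellMass O n H h x) (v := 0) (by simp [e']) (by simp) (by simp) (by simp)

theorem wp_cmdDiscretize {n H k : ℕ} {h : ℝ} (h0 : s.nat 0 = k) (h1 : s.nat 1 = n)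
    (h2 : s.nat 2 = H) (r3 : s.real 3 = h) :
    wp O cmdDiscretize (fun s' t => (s'.real 7 = k * meanShift O n H h ∧
      s'.Seg 0 n fun x => cellMass O n H h x) ∧ t ≤ 200 * (n + 1)) s := by
  simp only [cmdDiscretize, block, wp_seq, wp_setN, wp_setR]
  refine (wp_while _ _ (fun x s' => s'.nat 3 = x ∧
      s'.real 5 = ∑ x ∈ Finset.range x, cellMass O n H h x ∧
      s'.real 6 = ∑ x ∈ Finset.range x, cellMass O n H h x * cellLeft n H h x ∧
      s'.Seg 0 x fun x => cellMass O n H h x) n 80 ?_ ?_ ?_).mono ?_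
  · exact ⟨by simp, by simp, by simp, fun y hy => absurd hy (by omega)⟩
  · rintro x hx s' ha ⟨i3, i5, i6, is⟩
    have a1 : s'.nat 1 = n := by rw [ha.nat 1 (by decide)]; simpa using h1
    have a2 : s'.nat 2 = H := by rw [ha.nat 2 (by decide)]; simpa using h2
    have a3 : s'.real 3 = h := by rw [ha.real 3 (by decide)]; simpa using r3
    exact ⟨by simp [i3, a1, hx], wp_cmdCell a1 a2 a3 i3 i5 i6 is⟩
  · rintro s' ha ⟨i3, -⟩
    have a1 : s'.nat 1 = n := by rw [ha.nat 1 (by decide)]; simpa using h1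
    simp [i3, a1]
  · rintro s' t ⟨⟨i3, i5, i6, is⟩, ha, ht⟩
    have a0 : s'.nat 0 = k := by rw [ha.nat 0 (by decide)]; simpa using h0
    have a2 : s'.nat 2 = H := by rw [ha.nat 2 (by decide)]; simpa using h2
    have a3 : s'.real 3 = h := by rw [ha.real 3 (by decide)]; simpa using r3
    refine ⟨⟨by simp [a0, a2, a3, i5, i6, meanShift], is.congr rfl rfl⟩, ?_⟩
    simp at ht ⊢
    omega

end RealRAM

/-! ### Reduction of the shift, and the output table. -/

namespace RealRAM

variable {O : Oracle} {s : State}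

/-- Reals cannot be rounded to indices, so the quotient by `h` is found by subtraction: `n * h` is
removed w ≤ n times, because R ≤ kh ≤ n²h, and then `h` is removed l < n times. Register 8 moves one
index back, cyclically, for each `h` removed; it ends at the entry that the shift carries to the
left end of the window. -/
theorem wp_cmdShift {n H k : ℕ} {h R : ℝ} (h1 : s.nat 1 = n) (h2 : s.nat 2 = H)
    (r3 : s.real 3 = h) (r7 : s.real 7 = R) (hn : n = 2 * H) (hH : 0 < H) (hh : 0 < h)
    (hR : 0 ≤ R) (hRk : R ≤ k * h) (hk : k ≤ n * n) :
    wp O cmdShift (fun s' t => (∃ w l : ℕ, ∃ y : ℝ, l < n ∧ 0 ≤ y ∧ y < h ∧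
      R = w * (n * h) + l * h + y ∧ s'.real 7 = y - H * h ∧ s'.nat 8 = (H + n - l) % n) ∧
      t ≤ 200 * (n + 1)) s := by
  have hn0 : 0 < n := by omega
  have hnR : (0 : ℝ) < n := by exact_mod_cast hn0
  have hnh : 0 < n * h := by positivity
  set w := ⌊R / (n * h)⌋₊ with hw
  have hw1 : w * (n * h) ≤ R := by
    rw [← le_div_iff₀ hnh]; exact Nat.floor_le (by positivity)
  have hw2 : R < (w + 1) * (n * h) := by
    rw [← div_lt_iff₀ hnh]; exact Nat.lt_floor_add_one _
  have hwn : w ≤ n := by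
    have : (w : ℝ) ≤ n := by
      have h1 : (w : ℝ) * (n * h) ≤ (n * n) * h := hw1.trans (hRk.trans (by
        gcongr; exact_mod_cast hk))
      have h2 : (w : ℝ) * (n * h) ≤ n * (n * h) := by linarith
      exact le_of_mul_le_mul_right h2 hnh
    exact_mod_cast this
  set R' := R - w * (n * h) with hR'
  have hR'0 : 0 ≤ R' := by linarith
  have hR'1 : R' < n * h := by linarith
  set l := ⌊R' / h⌋₊ with hl
  have hl1 : l * h ≤ R' := by
    rw [← le_div_iff₀ hh]; exact Nat.floor_le (by positivity)
  have hl2 : R' < (l + 1) * h := by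
    rw [← div_lt_iff₀ hh]; exact Nat.lt_floor_add_one _
  have hln : l < n := by
    have : (l : ℝ) * h < n * h := by linarith
    exact_mod_cast lt_of_mul_lt_mul_right this hh.le
  simp only [cmdShift, block, wp_seq, wp_setN, wp_setR]
  refine (wp_while _ _ (fun j s' => s'.real 7 = R - j * (n * h)) w 20 ?_ ?_ ?_).mono ?_
  · simpa using r7
  · rintro j hj s' ha i7
    have a1 : s'.nat 1 = n := by rw [ha.nat 1 (by decide)]; simpa using h1
    have a3 : s'.real 3 = h := by rw [ha.real 3 (by decide)]; simpa using r3
    have hj' : (j : ℝ) + 1 ≤ w := by exact_mod_cast hj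
    refine ⟨?_, ?_⟩
    · simp only [BExp.eval_not, BExp.eval_ltR, RExp.eval_var, RExp.eval_mul, RExp.eval_ofNat,
        NExp.eval_var, i7, a1, a3, not_lt]
      nlinarith
    · simp [i7, a1, a3]; ring
  · rintro s' ha i7
    have a1 : s'.nat 1 = n := by rw [ha.nat 1 (by decide)]; simpa using h1
    have a3 : s'.real 3 = h := by rw [ha.real 3 (by decide)]; simpa using r3
    simp only [BExp.eval_not, BExp.eval_ltR, RExp.eval_var, RExp.eval_mul, RExp.eval_ofNat,
        NExp.eval_var, i7, a1, a3, not_not]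
    exact hR'1
  rintro s₁ t₁ ⟨i7, ha₁, ht₁⟩
  refine (wp_while _ _ (fun j s' => s'.real 7 = R' - j * h ∧ s'.nat 8 = (H + n - j) % n) l 40
    ?_ ?_ ?_).mono ?_
  · refine ⟨by simpa using i7, ?_⟩
    have : s₁.nat 2 = H := by rw [ha₁.nat 2 (by decide)]; exact h2
    simp [this]
    exact (Nat.mod_eq_of_lt (by omega)).symm
  · rintro j hj s' ha ⟨i7, i8⟩
    have a1 : s'.nat 1 = n := by
      rw [ha.nat 1 (by decide)]; simp; rw [ha₁.nat 1 (by decide), h1]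
    have a3 : s'.real 3 = h := by
      rw [ha.real 3 (by decide)]; simp; rw [ha₁.real 3 (by decide), r3]
    have hj' : (j : ℝ) + 1 ≤ l := by exact_mod_cast hj
    have hm : (H + n - (j + 1)) % n =
        if 0 < (H + n - j) % n then (H + n - j) % n - 1 else n - 1 := by
      have e := succ_mod_eq (x := H + n - (j + 1)) hn0
      rw [show H + n - (j + 1) + 1 = H + n - j by omega] at e
      have := Nat.mod_lt (H + n - (j + 1)) hn0
      split_ifs at e ⊢ <;> omega
    refine ⟨?_, ?_⟩
    · simp only [BExp.eval_not, BExp.eval_ltR, RExp.eval_var, i7, a3, not_lt]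
      nlinarith
    · simp [cmdShiftStep, block, wp_ite, i7, a1, a3, i8, hm]
      constructor
      · intro h'
        exact ⟨by ring, fun h'' => absurd h'' h'.ne'⟩
      · intro h'
        exact ⟨by ring, fun h'' => absurd h' h''.ne'⟩
  · rintro s' ha ⟨i7, -⟩
    have a3 : s'.real 3 = h := by
      rw [ha.real 3 (by decide)]; simp; rw [ha₁.real 3 (by decide), r3]
    simp only [BExp.eval_not, BExp.eval_ltR, RExp.eval_var, i7, a3, not_not]
    linarith
  · rintro s' t ⟨⟨i7, i8⟩, ha, ht⟩
    have a2 : s'.nat 2 = H := by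
      rw [ha.nat 2 (by decide)]; simp; rw [ha₁.nat 2 (by decide), h2]
    have a3 : s'.real 3 = h := by
      rw [ha.real 3 (by decide)]; simp; rw [ha₁.real 3 (by decide), r3]
    refine ⟨⟨w, l, R' - l * h, hln, by linarith, by linarith, by rw [hR']; ring, ?_, ?_⟩, ?_⟩
    · simp [i7, a2, a3]
    · simpa using i8
    · clear_value w l
      simp at ht ht₁ ⊢
      omega

theorem add_mod_step {n j i q : ℕ} (hn : 0 < n) (hq : q = (j + i) % n) :
    (j + (i + 1)) % n = if q + 1 < n then q + 1 else 0 := by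
  rw [← add_assoc, succ_mod_eq hn, hq]

theorem wp_cmdTotal {n j₀ o : ℕ} {h x₀ : ℝ} {c : ℕ → ℂ} (h1 : s.nat 1 = n) (h6 : s.nat 6 = o)
    (h8 : s.nat 8 = j₀ % n) (r3 : s.real 3 = h) (r7 : s.real 7 = x₀) (hn : 0 < n)
    (hs : s.Seg o n c) :
    wp O cmdTotal (fun s' t => s'.real 13 =
      ∑ i ∈ Finset.range n, (c ((j₀ + i) % n)).re * Real.exp (-(x₀ + i * h)) ∧
      t ≤ 200 * (n + 1)) s := by
  simp only [cmdTotal, block, wp_seq, wp_setN, wp_setR]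
  refine (wp_while _ _ (fun i s' => s'.nat 3 = i ∧ s'.nat 4 = (j₀ + i) % n ∧
    s'.real 4 = x₀ + i * h ∧ s'.real 13 =
      ∑ i ∈ Finset.range i, (c ((j₀ + i) % n)).re * Real.exp (-(x₀ + i * h))) n 60 ?_ ?_ ?_).mono ?_
  · exact ⟨by simp, by simp [h8], by simp [r7], by simp⟩
  · rintro i hi s' ha ⟨i3, i4, ir4, i13⟩
    have a1 : s'.nat 1 = n := by rw [ha.nat 1 (by decide)]; simpa using h1
    have a6 : s'.nat 6 = o := by rw [ha.nat 6 (by decide)]; simpa using h6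
    have a3 : s'.real 3 = h := by rw [ha.real 3 (by decide)]; simpa using r3
    have e3 : s'.arr 3 = s.arr 3 := ha.arr 3 (by decide)
    have hc := (hs _ (Nat.mod_lt (j₀ + i) hn)).1
    refine ⟨by simp [i3, a1, hi], ?_⟩
    simp [cmdTotalStep, block, wp_ite, i3, i4, ir4, i13, a1, a6, a3, e3, hc,
      Finset.sum_range_succ, add_mod_step hn rfl]
    constructor
    · intro h'
      exact ⟨h', by ring⟩
    · intro h'
      exact ⟨h', by ring⟩
  · rintro s' ha ⟨i3, -⟩
    have a1 : s'.nat 1 = n := by rw [ha.nat 1 (by decide)]; simpa using h1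
    simp [i3, a1]
  · rintro s' t ⟨⟨-, -, -, i13⟩, ha, ht⟩
    refine ⟨i13, ?_⟩
    simp at ht ⊢
    omega

/-- Row `N` of the coefficients is never written: the zero piece beyond the last breakpoint is the
initial content of the arrays, whence `ha1` and `ha2`. -/
theorem wp_cmdOutput {n j₀ o N : ℕ} {h x₀ δ u B : ℝ} {c : ℕ → ℂ} (h1 : s.nat 1 = n)
    (h6 : s.nat 6 = o) (h8 : s.nat 8 = j₀ % n) (r1 : s.real 1 = δ) (r2 : s.real 2 = u)
    (r3 : s.real 3 = h) (r7 : s.real 7 = x₀) (r13 : s.real 13 = B) (hn : 0 < n)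
    (hs : s.Seg o n c) (ha1 : s.arr 1 = fun _ => 0) (ha2 : s.arr 2 = fun _ => 0)
    (hlt : ∀ i < N, x₀ + i * h < u) (hle : u ≤ x₀ + N * h) :
    wp O cmdOutput (fun s' t => (s'.numBreaks = N ∧ (∀ i < N, s'.arr 0 i = x₀ + i * h) ∧
      (∀ i < N, s'.arr 1 i = 1 + δ / 2 - ∑ i ∈ Finset.range i, (c ((j₀ + i) % n)).re) ∧
      (∀ i < N, s'.arr 2 i = B -
        ∑ i ∈ Finset.range i, (c ((j₀ + i) % n)).re * Real.exp (-(x₀ + i * h))) ∧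
      s'.arr 1 N = 0 ∧ s'.arr 2 N = 0) ∧ t ≤ 200 * (N + 1)) s := by
  simp only [cmdOutput, block, wp_seq, wp_setN, wp_setR]
  refine (wp_while _ _ (fun i s' => s'.nat 3 = i ∧ s'.nat 8 = (j₀ + i) % n ∧
    s'.real 7 = x₀ + i * h ∧
    s'.real 12 = 1 + δ / 2 - ∑ i ∈ Finset.range i, (c ((j₀ + i) % n)).re ∧
    s'.real 13 = B - ∑ i ∈ Finset.range i, (c ((j₀ + i) % n)).re * Real.exp (-(x₀ + i * h)) ∧
    (∀ l < i, s'.arr 0 l = x₀ + l * h) ∧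
    (∀ l < i, s'.arr 1 l = 1 + δ / 2 - ∑ i ∈ Finset.range l, (c ((j₀ + i) % n)).re) ∧
    (∀ l < i, s'.arr 2 l = B -
      ∑ i ∈ Finset.range l, (c ((j₀ + i) % n)).re * Real.exp (-(x₀ + i * h))) ∧
    (∀ l, i ≤ l → s'.arr 1 l = 0) ∧ (∀ l, i ≤ l → s'.arr 2 l = 0)) N 80 ?_ ?_ ?_).mono ?_
  · refine ⟨by simp, by simp [h8], by simp [r7], by simp [r1], by simp [r13],
      fun l hl => absurd hl (by omega), fun l hl => absurd hl (by omega),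
      fun l hl => absurd hl (by omega), fun l _ => by simp [ha1], fun l _ => by simp [ha2]⟩
  · rintro i hi s' ha ⟨i3, i8, i7, i12, i13, j0, j1, j2, k1, k2⟩
    have a1 : s'.nat 1 = n := by rw [ha.nat 1 (by decide)]; simpa using h1
    have a6 : s'.nat 6 = o := by rw [ha.nat 6 (by decide)]; simpa using h6
    have a3 : s'.real 3 = h := by rw [ha.real 3 (by decide)]; simpa using r3
    have a2 : s'.real 2 = u := by rw [ha.real 2 (by decide)]; simpa using r2
    have e3 : s'.arr 3 = s.arr 3 := ha.arr 3 (by decide)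
    have hc := (hs _ (Nat.mod_lt (j₀ + i) hn)).1
    refine ⟨by simp [i7, a2, hlt i hi], ?_⟩
    have hpush : ∀ (f g : ℕ → ℝ), (∀ l < i, f l = g l) →
        ∀ l < i + 1, Function.update f i (g i) l = g l := by
      intro f g hfg l hl
      rcases eq_or_ne l i with rfl | hli
      · simp
      · rw [Function.update_of_ne hli]; exact hfg l (by omega)
    have hzero : ∀ (f : ℕ → ℝ) (v : ℝ), (∀ l, i ≤ l → f l = 0) →
        ∀ l, i + 1 ≤ l → Function.update f i v l = 0 := by
      intro f v hf l hl
      rw [Function.update_of_ne (by omega)]; exact hf l (by omega)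
    have p0 := hpush _ _ j0
    have p1 := hpush _ _ j1
    have p2 := hpush _ _ j2
    refine wp.mono (Q := fun s'' t => (s''.nat 3 = i + 1 ∧ s''.nat 8 = (j₀ + (i + 1)) % n ∧
      s''.real 7 = x₀ + (i + 1 : ℕ) * h ∧
      s''.real 12 = 1 + δ / 2 - ∑ i ∈ Finset.range (i + 1), (c ((j₀ + i) % n)).re ∧
      s''.real 13 = B - ∑ i ∈ Finset.range (i + 1), (c ((j₀ + i) % n)).re *
        Real.exp (-(x₀ + i * h)) ∧
      s''.arr 0 = Function.update (s'.arr 0) i (x₀ + i * h) ∧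
      s''.arr 1 = Function.update (s'.arr 1) i
        (1 + δ / 2 - ∑ i ∈ Finset.range i, (c ((j₀ + i) % n)).re) ∧
      s''.arr 2 = Function.update (s'.arr 2) i
        (B - ∑ i ∈ Finset.range i, (c ((j₀ + i) % n)).re * Real.exp (-(x₀ + i * h)))) ∧ t ≤ 80)
      ?_ ?_
    · simp [cmdOutputStep, block, wp_ite, i3, i8, i7, i12, i13, a1, a6, a3, e3, hc,
        Finset.sum_range_succ, add_mod_step hn rfl]
      constructor
      · intro h'
        exact ⟨h', by ring, by ring, by ring⟩
      · intro h'
        exact ⟨h', by ring, by ring, by ring⟩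
    · rintro s'' t ⟨⟨b3, b8, b7, b12, b13, c0, c1, c2⟩, ht⟩
      refine ⟨⟨b3, b8, b7, b12, b13, by rw [c0]; exact p0, by rw [c1]; exact p1,
        by rw [c2]; exact p2, by rw [c1]; exact hzero _ _ k1, by rw [c2]; exact hzero _ _ k2⟩, ht⟩
  · rintro s' ha ⟨-, -, i7, -⟩
    have a2 : s'.real 2 = u := by rw [ha.real 2 (by decide)]; simpa using r2
    simp [i7, a2, hle]
  · rintro s' t ⟨⟨i3, i8, i7, i12, i13, j0, j1, j2, k1, k2⟩, ha, ht⟩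
    refine ⟨⟨by simp [State.numBreaks, i3], j0, j1, j2, k1 N le_rfl, k2 N le_rfl⟩, ?_⟩
    simp at ht ⊢
    omega

end RealRAM

/-! ### The whole program and the curve in its table. -/

namespace RealRAM

open Polynomial in
/-- The table that `composePRV` leaves, in terms of the cyclic convolution power `c` of the cell
masses, the reduced shift `y`, the rotation `l` and the number `N` of breakpoints. -/
structure IsTable (O : Oracle) (k n H : ℕ) (h δ u : ℝ) (s : State) (c : ℕ → ℂ) (w l N : ℕ)
    (y : ℝ) : Prop where
  dvd : (X ^ n - 1 : ℂ[X]) ∣ FFT.strand 1 n c 0 -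
    FFT.strand 1 n (fun x => (cellMass O n H h x : ℂ)) 0 ^ k
  lt_size : l < n
  shift_nonneg : 0 ≤ y
  shift_lt : y < h
  shift_eq : k * meanShift O n H h = w * (n * h) + l * h + y
  breaks_lt : ∀ i < N, y - H * h + i * h < u
  le_break : u ≤ y - H * h + N * h
  breaks_le : N ≤ n
  numBreaks : s.numBreaks = N
  breaks : ∀ i < N, s.arr 0 i = y - H * h + i * h
  coeffA : ∀ i < N, s.arr 1 i = 1 + δ / 2 - ∑ i ∈ Finset.range i, (c ((H + n - l + i) % n)).re
  coeffB : ∀ i < N, s.arr 2 i =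
    (∑ i ∈ Finset.range n, (c ((H + n - l + i) % n)).re * Real.exp (-(y - H * h + i * h))) -
      ∑ i ∈ Finset.range i, (c ((H + n - l + i) % n)).re * Real.exp (-(y - H * h + i * h))
  coeffA_last : s.arr 1 N = 0
  coeffB_last : s.arr 2 N = 0

theorem wp_composePRV {O : Oracle} {k n H T : ℕ} {σ δ u h : ℝ}
    (hh : h = σ / √((k : ℝ) / 2 * Real.log (12 / δ)))
    (hlt : ∀ j < T, (2 : ℝ) ^ j * h < 8 * (2 + σ + u)) (hle : 8 * (2 + σ + u) ≤ (2 : ℝ) ^ T * h)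
    (hnT : n = 2 ^ T) (hn : n = 2 * H) (hH : 2 ≤ H) (hh0 : 0 < h) (hk : k < n * n)
    (hm0 : 0 ≤ meanShift O n H h) (hm1 : meanShift O n H h ≤ h) (hu : u ≤ H * h) :
    wp O composePRV (fun s' t => (∃ c w l N y, IsTable O k n H h δ u s' c w l N y) ∧
      t ≤ 4000 * (n * (T + 1))) (State.input k σ δ u) := by
  have hn0 : 0 < n := by omega
  -- From k < n² = 2^{2T}: a repeated squaring takes at most about twice as many rounds as a
  -- transform has stages.
  have hsize : k.size ≤ 2 * T := by
    rw [Nat.size_le, two_mul, pow_add, ← hnT]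
    exact hk
  simp only [composePRV, block, wp_seq]
  refine (wp_cmdSize (k := k) (σ := σ) (δ := δ) (u := u) rfl rfl rfl rfl hh hlt hle).agree.mono ?_
  rintro s₁ t₁ ⟨⟨⟨n1, n2, r3⟩, ht₁⟩, a₁⟩
  rw [← hnT] at n1 n2
  have n2 : s₁.nat 2 = H := by omega
  have n0 : s₁.nat 0 = k := a₁.nat 0 (by decide)
  have r1 : s₁.real 1 = δ := a₁.real 1 (by decide)
  have r2 : s₁.real 2 = u := a₁.real 2 (by decide)
  have q1 : s₁.arr 1 = fun _ => 0 := a₁.arr 1 (by decide)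
  have q2 : s₁.arr 2 = fun _ => 0 := a₁.arr 2 (by decide)
  refine (wp_cmdTwiddle n2 hn hH).agree.mono ?_
  rintro s₂ t₂ ⟨⟨⟨ζ, hζ, hζ'⟩, ht₂⟩, a₂⟩
  refine (wp_cmdDiscretize (k := k) (n := n) (H := H) (h := h) ((a₂.nat 0 (by decide)).trans n0)
    ((a₂.nat 1 (by decide)).trans n1) ((a₂.nat 2 (by decide)).trans n2)
    ((a₂.real 3 (by decide)).trans r3)).agree.mono ?_
  rintro s₃ t₃ ⟨⟨⟨r7, hs₃⟩, ht₃⟩, a₃⟩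
  have n1₃ : s₃.nat 1 = n := (a₃.nat 1 (by decide)).trans ((a₂.nat 1 (by decide)).trans n1)
  have n2₃ : s₃.nat 2 = H := (a₃.nat 2 (by decide)).trans ((a₂.nat 2 (by decide)).trans n2)
  have hζ₃ : s₃.Twid n ζ := hζ.congr (a₃.arr 5 (by decide)) (a₃.arr 6 (by decide))
  refine (wp_cmdForward n1₃ n2₃ hnT hn hs₃ hζ₃).agree.mono ?_
  rintro s₄ t₄ ⟨⟨⟨n5, hs₄⟩, ht₄⟩, a₄⟩
  refine (wp_cmdPow (k := k) ((a₄.nat 0 (by decide)).trans ((a₃.nat 0 (by decide)).trans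
    ((a₂.nat 0 (by decide)).trans n0))) ((a₄.nat 1 (by decide)).trans n1₃) rfl hs₄ hn0).agree.mono ?_
  rintro s₅ t₅ ⟨⟨hs₅, ht₅⟩, a₅⟩
  refine (wp_cmdInverse (k := k) ((a₅.nat 1 (by decide)).trans ((a₄.nat 1 (by decide)).trans n1₃))
    ((a₅.nat 2 (by decide)).trans ((a₄.nat 2 (by decide)).trans n2₃))
    ((a₅.nat 5 (by decide)).trans n5) hnT hn hζ' hs₅
    ((hζ₃.congr (a₄.arr 5 (by decide)) (a₄.arr 6 (by decide))).congr (a₅.arr 5 (by decide))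
      (a₅.arr 6 (by decide)))).agree.mono ?_
  rintro s₆ t₆ ⟨⟨⟨c, hs₆, hc⟩, ht₆⟩, a₆⟩
  have n1₆ : s₆.nat 1 = n := (a₆.nat 1 (by decide)).trans
    ((a₅.nat 1 (by decide)).trans ((a₄.nat 1 (by decide)).trans n1₃))
  have n2₆ : s₆.nat 2 = H := (a₆.nat 2 (by decide)).trans
    ((a₅.nat 2 (by decide)).trans ((a₄.nat 2 (by decide)).trans n2₃))
  have hreal : ∀ i < 4, s₆.real i = s₁.real i := by
    intro i hi
    rw [a₆.real i (by interval_cases i <;> decide), a₅.real i (by interval_cases i <;> decide),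
      a₄.real i (by interval_cases i <;> decide), a₃.real i (by interval_cases i <;> decide),
      a₂.real i (by interval_cases i <;> decide)]
  have harr : ∀ i < 3, s₆.arr i = s₁.arr i := by
    intro i hi
    rw [a₆.arr i (by interval_cases i <;> decide), a₅.arr i (by interval_cases i <;> decide),
      a₄.arr i (by interval_cases i <;> decide), a₃.arr i (by interval_cases i <;> decide),
      a₂.arr i (by interval_cases i <;> decide)]
  have r7₆ : s₆.real 7 = k * meanShift O n H h := by
    rw [a₆.real 7 (by decide), a₅.real 7 (by decide), a₄.real 7 (by decide), r7]
  have r3₆ : s₆.real 3 = h := (hreal 3 (by omega)).trans r3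
  refine (wp_cmdShift (k := k) n1₆ n2₆ r3₆ r7₆ hn (by omega) hh0 (by positivity)
    (by gcongr) hk.le).agree.mono ?_
  rintro s₇ t₇ ⟨⟨⟨w, l, y, hl, hy0, hyh, hw, r7₇, n8⟩, ht₇⟩, a₇⟩
  have hs₇ : s₇.Seg (s₇.nat 6) n c := by
    rw [a₇.nat 6 (by decide)]
    exact hs₆.congr (a₇.arr 3 (by decide)) (a₇.arr 4 (by decide))
  have n1₇ : s₇.nat 1 = n := (a₇.nat 1 (by decide)).trans n1₆
  have r3₇ : s₇.real 3 = h := (a₇.real 3 (by decide)).trans r3₆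
  refine (wp_cmdTotal n1₇ rfl n8 r3₇ r7₇ hn0 hs₇).agree.mono ?_
  rintro s₈ t₈ ⟨⟨r13, ht₈⟩, a₈⟩
  have hs₈ : s₈.Seg (s₈.nat 6) n c := by
    rw [a₈.nat 6 (by decide)]
    exact hs₇.congr (a₈.arr 3 (by decide)) (a₈.arr 4 (by decide))
  -- After `n` meshes the grid has reached y + Hh, which is at least u.
  have hex : ∃ N : ℕ, u ≤ y - H * h + N * h := by
    refine ⟨n, ?_⟩
    have : (n : ℝ) = 2 * H := by exact_mod_cast hn
    rw [this]
    linarith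
  classical
  have hNn : Nat.find hex ≤ n := by
    refine Nat.find_min' hex ?_
    have : (n : ℝ) = 2 * H := by exact_mod_cast hn
    rw [this]
    linarith
  have hNlt : ∀ i < Nat.find hex, y - H * h + i * h < u := fun i hi => not_le.1 (Nat.find_min hex hi)
  refine (wp_cmdOutput (N := Nat.find hex) (δ := δ) (u := u) (h := h) (x₀ := y - H * h)
    ((a₈.nat 1 (by decide)).trans n1₇) rfl
    ((a₈.nat 8 (by decide)).trans n8) ?_ ?_ ((a₈.real 3 (by decide)).trans r3₇)
    ((a₈.real 7 (by decide)).trans r7₇) r13 hn0 hs₈ ?_ ?_ hNlt (Nat.find_spec hex)).mono ?_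
  · rw [a₈.real 1 (by decide), a₇.real 1 (by decide), hreal 1 (by omega), r1]
  · rw [a₈.real 2 (by decide), a₇.real 2 (by decide), hreal 2 (by omega), r2]
  · rw [a₈.arr 1 (by decide), a₇.arr 1 (by decide), harr 1 (by omega), q1]
  · rw [a₈.arr 2 (by decide), a₇.arr 2 (by decide), harr 2 (by omega), q2]
  · rintro s' t ⟨⟨b, b0, b1, b2, e1, e2⟩, ht⟩
    refine ⟨⟨c, w, l, _, y, ⟨hc, hl, hy0, hyh, hw, hNlt, Nat.find_spec hex, hNn, b, b0, b1, b2,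
      e1, e2⟩⟩, ?_⟩
    have hT : T + 1 ≤ n * (T + 1) := Nat.le_mul_of_pos_left _ hn0
    have hn4 : 4 ≤ n := by omega
    have hn' : n ≤ n * (T + 1) := Nat.le_mul_of_pos_right _ (by omega)
    have hks : n * (k.size + 1) ≤ 2 * (n * (T + 1)) := by
      calc n * (k.size + 1) ≤ n * (2 * (T + 1)) := by gcongr; omega
        _ = 2 * (n * (T + 1)) := by ring
    omega

namespace IsTable

variable {O : Oracle} {k n H : ℕ} {h δ u : ℝ} {s : State} {c : ℕ → ℂ} {w l N : ℕ} {y : ℝ}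

theorem sorted (ht : IsTable O k n H h δ u s c w l N y) : s.Sorted := by
  intro i j hij hj
  rw [ht.numBreaks] at hj
  rw [ht.breaks i (by omega), ht.breaks j hj]
  have h0 : 0 ≤ h := ht.shift_nonneg.trans ht.shift_lt.le
  gcongr

theorem card_breaks (ht : IsTable O k n H h δ u s c w l N y) {ε : ℝ} {j : ℕ} (hj : j ≤ N)
    (h1 : ∀ i < j, y - H * h + i * h ≤ ε) (h2 : j < N → ε < y - H * h + j * h) :
    Nat.card {i : ℕ // i < s.numBreaks ∧ s.arr 0 i ≤ ε} = j := by
  have h0 : 0 ≤ h := ht.shift_nonneg.trans ht.shift_lt.le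
  have : ∀ i, (i < s.numBreaks ∧ s.arr 0 i ≤ ε) ↔ i ∈ Finset.range j := by
    intro i
    rw [ht.numBreaks, Finset.mem_range]
    constructor
    · rintro ⟨hi, hi'⟩
      by_contra! hji
      rw [ht.breaks i hi] at hi'
      have := h2 (by omega)
      have hle : (j : ℝ) * h ≤ i * h := by gcongr
      linarith
    · intro hi
      exact ⟨by omega, (ht.breaks i (by omega)).trans_le (h1 i hi)⟩
  rw [Nat.card_congr (Equiv.subtypeEquivRight this)]
  exact (Nat.card_eq_finsetCard _).trans (Finset.card_range j)

theorem outputCurve_eq_zero (ht : IsTable O k n H h δ u s c w l N y) {ε : ℝ}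
    (hε : ∀ i < N, y - H * h + i * h ≤ ε) : s.outputCurve ε = 0 := by
  simp only [State.outputCurve, ht.card_breaks le_rfl hε (fun h => absurd h (lt_irrefl _)),
    ht.coeffA_last, ht.coeffB_last, zero_mul, sub_zero]

/-- On the piece containing ε, grid points up to ε have min(1, e^{ε−x}) = 1 and were subtracted from
A; the later ones have e^{ε−x} and are what is left in B. -/
theorem outputCurve_eq (ht : IsTable O k n H h δ u s c w l N y) {ε : ℝ}
    (hε : ∃ i < N, ε < y - H * h + i * h) : s.outputCurve ε = 1 + δ / 2 -
      ∑ i ∈ Finset.range n, (c ((H + n - l + i) % n)).re *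
        min 1 (Real.exp (ε - (y - H * h + i * h))) := by
  classical
  have h0 : 0 ≤ h := ht.shift_nonneg.trans ht.shift_lt.le
  obtain ⟨i, hi, hiε⟩ := hε
  have hex : ∃ i : ℕ, ε < y - H * h + i * h := ⟨i, hiε⟩
  set j := Nat.find hex with hjdef
  have hjN : j < N := (Nat.find_min' hex hiε).trans_lt hi
  have hlow : ∀ i < j, y - H * h + i * h ≤ ε := fun i hi => not_lt.1 (Nat.find_min hex hi)
  have hjε : ε < y - H * h + j * h := Nat.find_spec hex
  simp only [State.outputCurve, ht.card_breaks hjN.le hlow (fun _ => hjε), ht.coeffA j hjN,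
    ht.coeffB j hjN]
  have hjn : j ≤ n := hjN.le.trans ht.breaks_le
  rw [← Finset.sum_range_add_sum_Ico (fun i => (c ((H + n - l + i) % n)).re *
        min 1 (Real.exp (ε - (y - H * h + i * h)))) hjn,
    ← Finset.sum_range_add_sum_Ico (fun i => (c ((H + n - l + i) % n)).re *
        Real.exp (-(y - H * h + i * h))) hjn, add_sub_cancel_left, Finset.sum_mul]
  have e1 : ∑ i ∈ Finset.range j, (c ((H + n - l + i) % n)).re *
        min 1 (Real.exp (ε - (y - H * h + i * h))) =
      ∑ i ∈ Finset.range j, (c ((H + n - l + i) % n)).re := by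
    refine Finset.sum_congr rfl fun i hi => ?_
    rw [min_eq_left, mul_one]
    have := hlow i (Finset.mem_range.1 hi)
    exact Real.one_le_exp (by linarith)
  have e2 : ∑ i ∈ Finset.Ico j n, (c ((H + n - l + i) % n)).re *
        min 1 (Real.exp (ε - (y - H * h + i * h))) =
      ∑ i ∈ Finset.Ico j n, (c ((H + n - l + i) % n)).re * Real.exp (-(y - H * h + i * h)) *
        Real.exp ε := by
    refine Finset.sum_congr rfl fun i hi => ?_
    have hle : (j : ℝ) * h ≤ i * h := by
      have := (Finset.mem_Ico.1 hi).1
      gcongr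
    rw [min_eq_right, mul_assoc, ← Real.exp_add, sub_eq_neg_add]
    exact Real.exp_le_one_iff.2 (by linarith)
  rw [e1, e2]
  ring

end IsTable

end RealRAM

/-! ### Cells, and the centred rounding error. -/

namespace RealRAM

/-- The cell `x` of the discretization. -/
def cell (n H : ℕ) (h : ℝ) (x : ℕ) : Set EReal :=
  Set.Ioc ((cellLeft n H h x : ℝ) : EReal) ((cellLeft n H h x + h : ℝ) : EReal)

/-- The left end point of a cell, in multiples of the mesh size. -/
def cellInt (n H x : ℕ) : ℤ := if x < H then x else x - n

theorem cellLeft_eq (n H : ℕ) (h : ℝ) (x : ℕ) : cellLeft n H h x = cellInt n H x * h := by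
  unfold cellLeft cellInt
  split_ifs <;> push_cast <;> ring

theorem measurableSet_cell (n H : ℕ) (h : ℝ) (x : ℕ) : MeasurableSet (cell n H h x) :=
  measurableSet_Ioc

theorem mem_cell {n H : ℕ} {h : ℝ} {x : ℕ} {z : EReal} (hz : z ∈ cell n H h x) :
    ∃ r : ℝ, z = r ∧ cellLeft n H h x < r ∧ r ≤ cellLeft n H h x + h := by
  induction z with
  | bot => exact absurd hz.1 not_lt_bot
  | top => exact absurd hz.2 (not_le.2 (EReal.coe_lt_top _))
  | coe r => exact ⟨r, rfl, EReal.coe_lt_coe_iff.1 hz.1, EReal.coe_le_coe_iff.1 hz.2⟩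

theorem cell_inj {n H : ℕ} {h : ℝ} (hh : 0 < h) {x x' : ℕ} (hx : x < n) (hx' : x' < n)
    {z : EReal} (hz : z ∈ cell n H h x) (hz' : z ∈ cell n H h x') : x = x' := by
  obtain ⟨r, rfl, h1, h2⟩ := mem_cell hz
  obtain ⟨r', hr, h1', h2'⟩ := mem_cell hz'
  obtain rfl := EReal.coe_injective hr
  rw [cellLeft_eq] at h1 h2 h1' h2'
  have key : ∀ a b : ℤ, a * h < r → r ≤ b * h + h → a ≤ b := by
    intro a b ha hb
    have : (a : ℝ) < b + 1 := lt_of_mul_lt_mul_right (by linarith : a * h < (b + 1) * h) hh.le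
    have : a < b + 1 := by exact_mod_cast this
    omega
  have e := le_antisymm (key _ _ h1 h2') (key _ _ h1' h2)
  unfold cellInt at e
  split_ifs at e <;> omega

theorem iUnion_cell {n H : ℕ} {h : ℝ} (hh : 0 < h) (hn : n = 2 * H) :
    ⋃ x ∈ Finset.range n, cell n H h x = Set.Ioc ((-(H * h) : ℝ) : EReal) ((H * h : ℝ) : EReal) := by
  ext z
  simp only [Set.mem_iUnion, Finset.mem_range, exists_prop]
  constructor
  · rintro ⟨x, hx, hz⟩
    obtain ⟨r, rfl, h1, h2⟩ := mem_cell hz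
    rw [cellLeft_eq] at h1 h2
    have e1 : (-H : ℤ) ≤ cellInt n H x := by unfold cellInt; split_ifs <;> omega
    have e2 : cellInt n H x + 1 ≤ H := by unfold cellInt; split_ifs <;> omega
    have e1 : (-H : ℝ) ≤ cellInt n H x := by exact_mod_cast e1
    have e2 : (cellInt n H x : ℝ) + 1 ≤ H := by exact_mod_cast e2
    refine ⟨EReal.coe_lt_coe_iff.2 ?_, EReal.coe_le_coe_iff.2 ?_⟩ <;> nlinarith
  · intro hz
    induction z with
    | bot => exact absurd hz.1 not_lt_bot
    | top => exact absurd hz.2 (not_le.2 (EReal.coe_lt_top _))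
    | coe r =>
      have h1 := EReal.coe_lt_coe_iff.1 hz.1
      have h2 := EReal.coe_le_coe_iff.1 hz.2
      have c1 : r / h ≤ ⌈r / h⌉ := Int.le_ceil _
      have c2 : (⌈r / h⌉ : ℝ) < r / h + 1 := Int.ceil_lt_add_one _
      have e1 : (-H : ℤ) < ⌈r / h⌉ := by
        rw [Int.lt_ceil, lt_div_iff₀ hh]
        push_cast
        linarith
      have e2 : ⌈r / h⌉ ≤ (H : ℤ) := by
        rw [Int.ceil_le, div_le_iff₀ hh]
        exact_mod_cast h2
      rw [div_le_iff₀ hh] at c1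
      rw [← sub_lt_iff_lt_add, lt_div_iff₀ hh] at c2
      -- Cells are open on the left and closed on the right, to match the distribution function;
      -- hence the ceiling minus one rather than the floor.
      obtain ⟨x, hx, hxm⟩ : ∃ x < n, cellInt n H x = ⌈r / h⌉ - 1 := by
        unfold cellInt
        rcases lt_or_ge 0 ⌈r / h⌉ with hc | hc
        · refine ⟨(⌈r / h⌉ - 1).toNat, by omega, ?_⟩
          rw [if_pos (by omega)]
          omega
        · refine ⟨(⌈r / h⌉ - 1 + n).toNat, by omega, ?_⟩
          rw [if_neg (by omega)]
          omega
      have hl : cellLeft n H h x = (⌈r / h⌉ - 1) * h := by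
        rw [cellLeft_eq, hxm]
        push_cast
        ring
      refine ⟨x, hx, EReal.coe_lt_coe_iff.2 ?_, EReal.coe_le_coe_iff.2 ?_⟩
      · rw [hl]; exact c2
      · rw [hl]; linarith

theorem pairwiseDisjoint_cell {n H : ℕ} {h : ℝ} (hh : 0 < h) :
    Set.PairwiseDisjoint (Finset.range n : Set ℕ) (cell n H h) := by
  intro x hx x' hx' hne
  refine Set.disjoint_left.2 fun z hz hz' => hne ?_
  exact cell_inj hh (by simpa using hx) (by simpa using hx') hz hz'

variable {Y : Measure EReal} [IsProbabilityMeasure Y] {n H : ℕ} {h : ℝ}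

theorem cellMass_eq (hh : 0 < h) (x : ℕ) :
    cellMass (Oracle.ofLaw Y) n H h x = Y.real (cell n H h x) := by
  have hle : ((cellLeft n H h x : ℝ) : EReal) ≤ ((cellLeft n H h x + h : ℝ) : EReal) :=
    EReal.coe_le_coe_iff.2 (by linarith)
  rw [show cell n H h x = Set.Iic ((cellLeft n H h x + h : ℝ) : EReal) \
      Set.Iic ((cellLeft n H h x : ℝ) : EReal) by ext z; simp [cell, and_comm],
    measureReal_sdiff (Set.Iic_subset_Iic.2 hle) measurableSet_Iic]
  rfl

/-- The rounding error of the discretization. -/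
noncomputable def roundErr (n H : ℕ) (h y₀ : ℝ) (z : EReal) : ℝ :=
  ∑ x ∈ Finset.range n, (cell n H h x).indicator (fun z => z.toReal - cellLeft n H h x - y₀) z

theorem measurable_roundErr (n H : ℕ) (h y₀ : ℝ) : Measurable (roundErr n H h y₀) := by
  refine Finset.measurable_sum _ fun x _ => Measurable.indicator ?_ (measurableSet_cell n H h x)
  exact (measurable_ereal_toReal.sub_const _).sub_const _

theorem roundErr_of_mem (hh : 0 < h) {x : ℕ} (hx : x < n) {z : EReal} (hz : z ∈ cell n H h x)
    (y₀ : ℝ) : roundErr n H h y₀ z = z.toReal - cellLeft n H h x - y₀ := by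
  rw [roundErr, Finset.sum_eq_single x]
  · rw [Set.indicator_of_mem hz]
  · intro x' hx' hne
    rw [Set.indicator_of_notMem]
    exact fun hz' => hne (cell_inj hh (Finset.mem_range.1 hx') hx hz' hz)
  · intro hx'
    exact absurd (Finset.mem_range.2 hx) hx'

/-- Outside the window the error is 0, which also lies in the interval as 0 ≤ y₀ ≤ h. Its length h
is what enters Hoeffding's inequality. -/
theorem roundErr_mem (hh : 0 < h) {y₀ : ℝ} (h0 : 0 ≤ y₀) (h1 : y₀ ≤ h) (z : EReal) :
    roundErr n H h y₀ z ∈ Set.Icc (-y₀) (h - y₀) := by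
  by_cases hz : ∃ x < n, z ∈ cell n H h x
  · obtain ⟨x, hx, hz⟩ := hz
    rw [roundErr_of_mem hh hx hz]
    obtain ⟨r, rfl, h1, h2⟩ := mem_cell hz
    rw [EReal.toReal_coe]
    constructor <;> linarith
  · push Not at hz
    have : roundErr n H h y₀ z = 0 := by
      refine Finset.sum_eq_zero fun x hx => Set.indicator_of_notMem (hz x (Finset.mem_range.1 hx)) _
    rw [this]
    constructor <;> linarith

theorem integrableOn_toReal_cell (x : ℕ) :
    IntegrableOn (fun z : EReal => z.toReal) (cell n H h x) Y := by
  refine Measure.integrableOn_of_bounded (M := |cellLeft n H h x| + |h|) (measure_ne_top _ _)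
    measurable_ereal_toReal.aestronglyMeasurable ?_
  refine (ae_restrict_iff' (measurableSet_cell n H h x)).2 (ae_of_all _ fun z hz => ?_)
  obtain ⟨r, rfl, h1, h2⟩ := mem_cell hz
  rw [EReal.toReal_coe, Real.norm_eq_abs, abs_le]
  constructor
  · have := neg_abs_le (cellLeft n H h x)
    have := abs_nonneg h
    linarith
  · have := le_abs_self (cellLeft n H h x)
    have := le_abs_self h
    linarith

theorem truncMean_sub_eq (hh : 0 < h) (hn : n = 2 * H) :
    (Oracle.ofLaw Y).truncMean (H * h) -
        ∑ x ∈ Finset.range n, cellMass (Oracle.ofLaw Y) n H h x * cellLeft n H h x =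
      ∑ x ∈ Finset.range n, ∫ z in cell n H h x, (z.toReal - cellLeft n H h x) ∂Y := by
  have : (Oracle.ofLaw Y).truncMean (H * h) =
      ∑ x ∈ Finset.range n, ∫ z in cell n H h x, z.toReal ∂Y := by
    rw [← integral_biUnion_finset _ (fun x _ => measurableSet_cell n H h x)
      (pairwiseDisjoint_cell hh) (fun x _ => integrableOn_toReal_cell x), iUnion_cell hh hn]
    rfl
  rw [this, ← Finset.sum_sub_distrib]
  refine Finset.sum_congr rfl fun x _ => ?_
  rw [integral_sub (integrableOn_toReal_cell x) (integrable_const _), cellMass_eq hh]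
  simp

theorem integral_cell_mem (x : ℕ) :
    ∫ z in cell n H h x, (z.toReal - cellLeft n H h x) ∂Y ∈
      Set.Icc 0 (Y.real (cell n H h x) * h) := by
  have hint : IntegrableOn (fun z : EReal => z.toReal - cellLeft n H h x) (cell n H h x) Y :=
    (integrableOn_toReal_cell x).sub (integrable_const _)
  constructor
  · refine setIntegral_nonneg (measurableSet_cell n H h x) fun z hz => ?_
    obtain ⟨r, rfl, h1, h2⟩ := mem_cell hz
    rw [EReal.toReal_coe]
    linarith
  · calc ∫ z in cell n H h x, (z.toReal - cellLeft n H h x) ∂Y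
        ≤ ∫ _ in cell n H h x, h ∂Y := by
          refine setIntegral_mono_on hint (integrable_const _) (measurableSet_cell n H h x)
            fun z hz => ?_
          obtain ⟨r, rfl, h1, h2⟩ := mem_cell hz
          rw [EReal.toReal_coe]
          linarith
      _ = Y.real (cell n H h x) * h := by simp

theorem meanShift_mem (hh : 0 < h) (hn : n = 2 * H) :
    meanShift (Oracle.ofLaw Y) n H h ∈ Set.Icc 0 h := by
  rw [meanShift, truncMean_sub_eq hh hn]
  simp_rw [cellMass_eq hh]
  have h0 : 0 ≤ ∑ x ∈ Finset.range n, Y.real (cell n H h x) :=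
    Finset.sum_nonneg fun _ _ => measureReal_nonneg
  constructor
  · exact div_nonneg (Finset.sum_nonneg fun x _ => (integral_cell_mem x).1) h0
  · refine div_le_of_le_mul₀ h0 hh.le ?_
    rw [mul_comm, Finset.sum_mul]
    exact Finset.sum_le_sum fun x _ => (integral_cell_mem x).2

/-- The shift is the conditional mean, given the window, of the distance to the left end of the
cell; subtracting it on the window centres the error. -/
theorem integral_roundErr (hh : 0 < h) (hn : n = 2 * H) :
    ∫ z, roundErr n H h (meanShift (Oracle.ofLaw Y) n H h) z ∂Y = 0 := by
  set y₀ := meanShift (Oracle.ofLaw Y) n H h with hy₀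
  unfold roundErr
  have hint : ∀ x, IntegrableOn (fun z : EReal => z.toReal - cellLeft n H h x) (cell n H h x) Y :=
    fun x => (integrableOn_toReal_cell x).sub (integrable_const _)
  have hint' : ∀ x, IntegrableOn (fun z : EReal => z.toReal - cellLeft n H h x - y₀)
      (cell n H h x) Y := fun x => (hint x).sub (integrable_const _)
  rw [integral_finsetSum _ fun x _ => (hint' x).integrable_indicator (measurableSet_cell n H h x)]
  have e : ∀ x, ∫ z, (cell n H h x).indicator (fun z => z.toReal - cellLeft n H h x - y₀) z ∂Y =
      ∫ z in cell n H h x, (z.toReal - cellLeft n H h x) ∂Y - Y.real (cell n H h x) * y₀ := by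
    intro x
    rw [integral_indicator (measurableSet_cell n H h x), integral_sub (hint x) (integrable_const _)]
    simp
  simp_rw [e]
  rw [Finset.sum_sub_distrib, ← Finset.sum_mul, hy₀, meanShift, truncMean_sub_eq hh hn]
  simp_rw [cellMass_eq hh]
  -- If the window has no mass the shift is a division by zero, but then every cell integral
  -- vanishes anyway.
  rcases eq_or_ne (∑ x ∈ Finset.range n, Y.real (cell n H h x)) 0 with h0 | h0
  · rw [h0, zero_mul, sub_zero]
    refine Finset.sum_eq_zero fun x hx => ?_
    have := (Finset.sum_eq_zero_iff_of_nonneg fun _ _ => measureReal_nonneg).1 h0 x hx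
    have hm := integral_cell_mem (Y := Y) (n := n) (H := H) (h := h) x
    rw [this, zero_mul] at hm
    exact le_antisymm hm.2 hm.1
  · rw [mul_div_cancel₀ _ h0, sub_self]

/-- Hoeffding: a centred variable in an interval of length h is sub-Gaussian with parameter (h/2)²,
and k independent ones add up to kh²/4. -/
theorem measureReal_sum_roundErr_le (hh : 0 < h) (hn : n = 2 * H) (k : ℕ) {σ : ℝ} (hσ : 0 ≤ σ) :
    let e := fun z => roundErr n H h (meanShift (Oracle.ofLaw Y) n H h) z
    (Measure.pi fun _ : Fin k => Y).real {z | σ ≤ ∑ i, e (z i)} ≤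
        Real.exp (-(2 * σ ^ 2 / (k * h ^ 2))) ∧
      (Measure.pi fun _ : Fin k => Y).real {z | σ ≤ -∑ i, e (z i)} ≤
        Real.exp (-(2 * σ ^ 2 / (k * h ^ 2))) := by
  intro e
  have hm : Measurable e := measurable_roundErr _ _ _ _
  have hy := meanShift_mem (Y := Y) hh hn
  have hs : HasSubgaussianMGF e ((‖h‖₊ / 2) ^ 2) Y := by
    have := hasSubgaussianMGF_of_mem_Icc_of_integral_eq_zero (μ := Y) (X := e) hm.aemeasurable
      (ae_of_all _ fun z => roundErr_mem hh hy.1 hy.2 z) (integral_roundErr hh hn)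
    convert this using 3
    ring_nf
  have hpi : ∀ i : Fin k, HasSubgaussianMGF (fun z : Fin k → EReal => e (z i)) ((‖h‖₊ / 2) ^ 2)
      (Measure.pi fun _ : Fin k => Y) := by
    intro i
    have hmp := measurePreserving_eval (fun _ : Fin k => Y) i
    exact HasSubgaussianMGF.of_map (X := e) (Y := Function.eval i) hmp.measurable.aemeasurable
      (by rw [hmp.map_eq]; exact hs)
  have hind : iIndepFun (fun (i : Fin k) (z : Fin k → EReal) => e (z i))
      (Measure.pi fun _ : Fin k => Y) := iIndepFun_pi (X := fun _ => e) fun _ => hm.aemeasurable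
  have hind' : iIndepFun (fun (i : Fin k) (z : Fin k → EReal) => -e (z i))
      (Measure.pi fun _ : Fin k => Y) :=
    iIndepFun_pi (X := fun _ => -e) fun _ => hm.neg.aemeasurable
  have hexp : -σ ^ 2 / (2 * ∑ _i : Fin k, (((‖h‖₊ / 2) ^ 2 : NNReal) : ℝ)) =
      -(2 * σ ^ 2 / (k * h ^ 2)) := by
    simp only [Finset.sum_const, Finset.card_univ, Fintype.card_fin, nsmul_eq_mul, NNReal.coe_pow,
      NNReal.coe_div, coe_nnnorm, Real.norm_eq_abs, NNReal.coe_ofNat, div_pow, sq_abs]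
    rcases eq_or_ne k 0 with rfl | hk
    · simp
    · have : (k : ℝ) ≠ 0 := by exact_mod_cast hk
      field_simp
  have h1 := HasSubgaussianMGF.measure_sum_ge_le_of_iIndepFun hind (s := Finset.univ)
    (fun i _ => hpi i) hσ
  have h2 := HasSubgaussianMGF.measure_sum_ge_le_of_iIndepFun hind' (s := Finset.univ)
    (fun i _ => (hpi i).neg) hσ
  push_cast at h1 h2 hexp
  rw [hexp] at h1 h2
  refine ⟨h1, ?_⟩
  simpa only [Finset.sum_neg_distrib] using h2

end RealRAM

/-! ### The cyclic convolution as an integral over boxes of cells. -/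

namespace RealRAM

/-- The position, on the grid in `[-H * h, H * h)`, of a sum `d` of cell numbers. -/
noncomputable def gridPos (n H : ℕ) (h : ℝ) (l : ℕ) (y : ℝ) (d : ℕ) : ℝ :=
  y - H * h + ((d + l + H) % n : ℕ) * h

theorem sum_rotate {n H l : ℕ} (hn : n = 2 * H) (hl : l < n) (a φ : ℕ → ℝ) :
    ∑ i ∈ Finset.range n, a ((H + n - l + i) % n) * φ i =
      ∑ j ∈ Finset.range n, a j * φ ((j + l + H) % n) := by
  have hn0 : 0 < n := by omega
  refine Finset.sum_nbij' (fun i => (H + n - l + i) % n) (fun j => (j + l + H) % n) ?_ ?_ ?_ ?_ ?_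
  · exact fun i _ => Finset.mem_range.2 (Nat.mod_lt _ hn0)
  · exact fun i _ => Finset.mem_range.2 (Nat.mod_lt _ hn0)
  · intro i hi
    rw [Finset.mem_range] at hi
    rw [add_assoc, Nat.mod_add_mod, show H + n - l + i + (l + H) = i + 2 * n by omega,
      Nat.add_mul_mod_self_right, Nat.mod_eq_of_lt hi]
  · intro j hj
    rw [Finset.mem_range] at hj
    rw [Nat.add_mod_mod, show H + n - l + (j + l + H) = j + 2 * n by omega,
      Nat.add_mul_mod_self_right, Nat.mod_eq_of_lt hj]
  · intro i hi
    rw [Finset.mem_range] at hi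
    have : ((H + n - l + i) % n + l + H) % n = i := by
      rw [add_assoc, Nat.mod_add_mod, show H + n - l + i + (l + H) = i + 2 * n by omega,
        Nat.add_mul_mod_self_right, Nat.mod_eq_of_lt hi]
    simp only [this]

/-- Undoing the rotation leaves φ of `gridPos`, which is periodic in the sum of the cell numbers;
`FFT.sum_mul_periodic` then expands the power. -/
theorem IsTable.sum_eq {O : Oracle} {k n H : ℕ} {h δ u : ℝ} {s : State} {c : ℕ → ℂ} {w l N : ℕ}
    {y : ℝ} (ht : IsTable O k n H h δ u s c w l N y) (hn : n = 2 * H) (φ : ℝ → ℝ) :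
    ∑ i ∈ Finset.range n, (c ((H + n - l + i) % n)).re * φ (y - H * h + i * h) =
      ∑ f : Fin k → Fin n, (∏ i, cellMass O n H h (f i)) * φ (gridPos n H h l y (∑ i, (f i : ℕ))) := by
  have h1 := sum_rotate hn ht.lt_size (fun j => (c j).re) (fun i => φ (y - H * h + i * h))
  have h2 := FFT.sum_mul_periodic ht.dvd (fun d => (φ (gridPos n H h l y d) : ℂ)) (fun d => by
    rw [gridPos, gridPos, show d + n + l + H = d + l + H + n by ring, Nat.add_mod_right])
  rw [h1]
  have h3 := congrArg Complex.re h2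
  rw [Complex.re_sum, Complex.re_sum] at h3
  simp only [Complex.re_mul_ofReal] at h3
  refine h3.trans (Finset.sum_congr rfl fun f _ => ?_)
  rw [← Complex.ofReal_prod, Complex.ofReal_re]

/-- The product of the cells with the numbers `f`. -/
def box (n H : ℕ) (h : ℝ) {k : ℕ} (f : Fin k → Fin n) : Set (Fin k → EReal) :=
  Set.univ.pi fun i => cell n H h (f i)

theorem measurableSet_box (n H : ℕ) (h : ℝ) {k : ℕ} (f : Fin k → Fin n) :
    MeasurableSet (box n H h f) :=
  MeasurableSet.univ_pi fun i => measurableSet_cell n H h (f i)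

theorem box_inj {n H : ℕ} {h : ℝ} (hh : 0 < h) {k : ℕ} {f f' : Fin k → Fin n} {z : Fin k → EReal}
    (hz : z ∈ box n H h f) (hz' : z ∈ box n H h f') : f = f' := by
  funext i
  exact Fin.ext (cell_inj hh (f i).2 (f' i).2 (hz i trivial) (hz' i trivial))

/-- The function `φ` of the discretized sum, `0` where some variable is out of range. -/
noncomputable def gridFun (n H : ℕ) (h : ℝ) (k l : ℕ) (y : ℝ) (φ : ℝ → ℝ) (z : Fin k → EReal) :
    ENNReal :=
  ∑ f : Fin k → Fin n, (box n H h f).indicator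
    (fun _ => ENNReal.ofReal (φ (gridPos n H h l y (∑ i, (f i : ℕ))))) z

theorem measurable_gridFun (n H : ℕ) (h : ℝ) (k l : ℕ) (y : ℝ) (φ : ℝ → ℝ) :
    Measurable (gridFun n H h k l y φ) :=
  Finset.measurable_sum _ fun f _ => measurable_const.indicator (measurableSet_box n H h f)

theorem gridFun_of_mem {n H : ℕ} {h : ℝ} (hh : 0 < h) {k l : ℕ} {y : ℝ} {φ : ℝ → ℝ}
    {f : Fin k → Fin n} {z : Fin k → EReal} (hz : z ∈ box n H h f) :
    gridFun n H h k l y φ z = ENNReal.ofReal (φ (gridPos n H h l y (∑ i, (f i : ℕ)))) := by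
  rw [gridFun, Finset.sum_eq_single f]
  · rw [Set.indicator_of_mem hz]
  · intro f' _ hne
    rw [Set.indicator_of_notMem]
    exact fun hz' => hne (box_inj hh hz' hz)
  · exact fun hf => absurd (Finset.mem_univ f) hf

theorem gridFun_of_forall_notMem {n H : ℕ} {h : ℝ} {k l : ℕ} {y : ℝ} {φ : ℝ → ℝ}
    {z : Fin k → EReal} (hz : ∀ f : Fin k → Fin n, z ∉ box n H h f) :
    gridFun n H h k l y φ z = 0 :=
  Finset.sum_eq_zero fun f _ => Set.indicator_of_notMem (hz f) _

theorem exists_mem_box {n H : ℕ} {h : ℝ} (hh : 0 < h) (hn : n = 2 * H) {k : ℕ} {z : Fin k → EReal}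
    (h1 : ∀ i, ((-(H * h) : ℝ) : EReal) < z i) (h2 : ∀ i, z i ≤ ((H * h : ℝ) : EReal)) :
    ∃ f : Fin k → Fin n, z ∈ box n H h f := by
  have : ∀ i, ∃ x : Fin n, z i ∈ cell n H h x := by
    intro i
    have hi : z i ∈ Set.Ioc ((-(H * h) : ℝ) : EReal) ((H * h : ℝ) : EReal) := ⟨h1 i, h2 i⟩
    rw [← iUnion_cell hh hn] at hi
    simp only [Set.mem_iUnion, Finset.mem_range, exists_prop] at hi
    obtain ⟨x, hx, hz⟩ := hi
    exact ⟨⟨x, hx⟩, hz⟩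
  choose f hf using this
  exact ⟨f, fun i _ => hf i⟩

theorem lintegral_gridFun {Y : Measure EReal} [IsProbabilityMeasure Y] {n H : ℕ} {h : ℝ}
    (hh : 0 < h) {k l : ℕ} {y : ℝ} {φ : ℝ → ℝ} (hφ : ∀ x, 0 ≤ φ x) :
    ∫⁻ z, gridFun n H h k l y φ z ∂(Measure.pi fun _ : Fin k => Y) = ENNReal.ofReal
      (∑ f : Fin k → Fin n, (∏ i, cellMass (Oracle.ofLaw Y) n H h (f i)) *
        φ (gridPos n H h l y (∑ i, (f i : ℕ)))) := by
  have hp : ∀ x, 0 ≤ cellMass (Oracle.ofLaw Y) n H h x := fun x => by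
    rw [cellMass_eq hh]; exact measureReal_nonneg
  unfold gridFun
  rw [lintegral_finsetSum _ fun f _ => measurable_const.indicator (measurableSet_box n H h f),
    ENNReal.ofReal_sum_of_nonneg fun f _ => mul_nonneg (Finset.prod_nonneg fun i _ => hp _) (hφ _)]
  refine Finset.sum_congr rfl fun f _ => ?_
  rw [lintegral_indicator_const (measurableSet_box n H h f), box, Measure.pi_pi,
    ENNReal.ofReal_mul (Finset.prod_nonneg fun i _ => hp _),
    ENNReal.ofReal_prod_of_nonneg fun i _ => hp _, mul_comm]
  congr 1
  refine Finset.prod_congr rfl fun i _ => ?_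
  rw [cellMass_eq hh, ofReal_measureReal]

theorem cellInt_modEq (n H x : ℕ) : cellInt n H x ≡ x [ZMOD n] := by
  unfold cellInt
  split_ifs
  · rfl
  · exact (Int.modEq_iff_dvd.2 (by simp))

/-- The discretized sum does not wrap around unless it is out of range. -/
theorem IsTable.gridPos_eq {O : Oracle} {k n H : ℕ} {h δ u : ℝ} {s : State} {c : ℕ → ℂ}
    {w l N : ℕ} {y : ℝ} (ht : IsTable O k n H h δ u s c w l N y) (hn : n = 2 * H)
    (f : Fin k → Fin n)
    (h1 : -(H * h) ≤ (∑ i, cellLeft n H h (f i)) + k * meanShift O n H h)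
    (h2 : (∑ i, cellLeft n H h (f i)) + k * meanShift O n H h < H * h) :
    gridPos n H h l y (∑ i, (f i : ℕ)) =
      (∑ i, cellLeft n H h (f i)) + k * meanShift O n H h := by
  have hh : 0 < h := ht.shift_nonneg.trans_lt ht.shift_lt
  have hy0 := ht.shift_nonneg
  have hyh := ht.shift_lt
  -- The grid index of the sum before any reduction. The range hypotheses put it in [0, n), and it
  -- is congruent to the index that the cyclic convolution uses, so the two agree.
  set m : ℤ := (∑ i, cellInt n H (f i)) + w * n + l + H with hm
  have hZ : (∑ i, cellLeft n H h (f i)) + k * meanShift O n H h = m * h + y - H * h := by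
    simp_rw [ht.shift_eq, cellLeft_eq, ← Finset.sum_mul]
    rw [hm]
    push_cast
    ring
  rw [hZ] at h1 h2 ⊢
  have hnR : (n : ℝ) = 2 * H := by exact_mod_cast hn
  -- The range hypothesis gives only mh ≥ −y; as y < h and m is an integer, that is enough.
  have m0 : 0 ≤ m := by
    have : (-1 : ℝ) < m := lt_of_mul_lt_mul_right (by linarith : -1 * h < m * h) hh.le
    have : -1 < m := by exact_mod_cast this
    omega
  have mn : m < n := by
    have : (m : ℝ) < n := lt_of_mul_lt_mul_right (by rw [hnR]; linarith : m * h < n * h) hh.le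
    exact_mod_cast this
  have hmod : m ≡ ((∑ i, (f i : ℕ) + l + H : ℕ) : ℤ) [ZMOD n] := by
    rw [hm]
    push_cast
    refine Int.ModEq.add_right _ (Int.ModEq.add_right _ ?_)
    have : (w * n : ℤ) ≡ 0 [ZMOD n] := Int.modEq_zero_iff_dvd.2 (dvd_mul_left _ _)
    have hs : ∑ i, cellInt n H (f i) ≡ ∑ i, ((f i : ℕ) : ℤ) [ZMOD n] :=
      Int.ModEq.sum fun i _ => cellInt_modEq n H (f i)
    simpa using hs.add this
  have e : (((∑ i, (f i : ℕ) + l + H) % n : ℕ) : ℤ) = m := by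
    rw [Int.natCast_mod, ← hmod, Int.emod_eq_of_lt m0 mn]
  have e' : (((∑ i, (f i : ℕ) + l + H) % n : ℕ) : ℝ) = m := by
    have := congrArg (Int.cast : ℤ → ℝ) e
    rwa [Int.cast_natCast] at this
  rw [gridPos, e']
  ring

end RealRAM

/-! ### Pointwise comparison of the exact and the discretized function. -/

namespace DP

theorem lik_coe (r : ℝ) : lik (r : EReal) = ENNReal.ofReal (Real.exp (-r)) := by
  rw [lik, ← EReal.coe_neg, EReal.exp_coe]

theorem lik_le_lik {t t' : EReal} (h : t ≤ t') : lik t' ≤ lik t :=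
  EReal.exp_monotone (EReal.neg_le_neg_iff.2 h)

end DP

namespace RealRAM

open DP

variable {n H k : ℕ} {h : ℝ}

theorem likProd_of_mem_box {f : Fin k → Fin n} {z : Fin k → EReal} (hz : z ∈ box n H h f) :
    likProd z = ENNReal.ofReal (Real.exp (-∑ i, (z i).toReal)) := by
  rw [← Finset.sum_neg_distrib, Real.exp_sum, likProd,
    ENNReal.ofReal_prod_of_nonneg fun i _ => (Real.exp_pos _).le]
  refine Finset.prod_congr rfl fun i _ => ?_
  obtain ⟨r, hr, -, -⟩ := mem_cell (hz i trivial)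
  rw [hr, lik_coe, EReal.toReal_coe]

theorem sum_cellLeft_of_mem_box (hh : 0 < h) {f : Fin k → Fin n} {z : Fin k → EReal}
    (hz : z ∈ box n H h f) (y₀ : ℝ) :
    (∑ i, cellLeft n H h (f i)) + k * y₀ =
      ∑ i, (z i).toReal - ∑ i, roundErr n H h y₀ (z i) := by
  have : ∀ i, roundErr n H h y₀ (z i) = (z i).toReal - cellLeft n H h (f i) - y₀ :=
    fun i => roundErr_of_mem hh (f i).2 (hz i trivial) y₀
  simp_rw [this, Finset.sum_sub_distrib]
  simp
  ring

/-- On a box `likProd` is the exponential of minus the sum, so `h3` and `h4` confine the sum to [−v,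
v]; with a rounding error below σ it stays in the window and nothing wraps around. -/
theorem IsTable.gridPos_eq_of_mem {O : Oracle} {δ u : ℝ} {s : State} {c : ℕ → ℂ}
    {w l N : ℕ} {y : ℝ} (ht : IsTable O k n H h δ u s c w l N y) (hn : n = 2 * H)
    {f : Fin k → Fin n} {z : Fin k → EReal} (hz : z ∈ box n H h f) {σ v : ℝ}
    (h1 : ∑ i, roundErr n H h (meanShift O n H h) (z i) < σ)
    (h2 : -∑ i, roundErr n H h (meanShift O n H h) (z i) < σ) (hv : v + σ ≤ H * h)
    (h3 : ENNReal.ofReal (Real.exp (-v)) ≤ likProd z)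
    (h4 : likProd z ≤ ENNReal.ofReal (Real.exp v)) :
    gridPos n H h l y (∑ i, (f i : ℕ)) =
      ∑ i, (z i).toReal - ∑ i, roundErr n H h (meanShift O n H h) (z i) := by
  have hh : 0 < h := ht.shift_nonneg.trans_lt ht.shift_lt
  have e := sum_cellLeft_of_mem_box hh hz (meanShift O n H h)
  rw [likProd_of_mem_box hz, ENNReal.ofReal_le_ofReal_iff (Real.exp_pos _).le,
    Real.exp_le_exp] at h3 h4
  rw [← e]
  refine ht.gridPos_eq hn f ?_ ?_ <;> rw [e] <;> linarith

/-- The function `min(1, e^{ε - x})`, of whose mean a privacy curve is the complement. -/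
noncomputable def capExp (ε x : ℝ) : ℝ := min 1 (Real.exp (ε - x))

theorem capExp_nonneg (ε x : ℝ) : 0 ≤ capExp ε x := le_min zero_le_one (Real.exp_pos _).le

theorem capExp_le_one (ε x : ℝ) : capExp ε x ≤ 1 := min_le_left _ _

theorem capExp_mono {ε ε' x x' : ℝ} (hx : ε - x ≤ ε' - x') : capExp ε x ≤ capExp ε' x' :=
  min_le_min le_rfl (Real.exp_le_exp.2 hx)

theorem min_likProd_of_mem_box {f : Fin k → Fin n} {z : Fin k → EReal} (hz : z ∈ box n H h f)
    (ε : ℝ) : min 1 (ENNReal.ofReal (Real.exp ε) * likProd z) =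
      ENNReal.ofReal (capExp ε (∑ i, (z i).toReal)) := by
  rw [likProd_of_mem_box hz, ← ENNReal.ofReal_mul (Real.exp_pos _).le, ← Real.exp_add, capExp,
    ENNReal.ofReal_min, ENNReal.ofReal_one, sub_eq_add_neg]

/-- The event that the total rounding error is large. -/
def badRound (n H : ℕ) (h y₀ σ : ℝ) (k : ℕ) : Set (Fin k → EReal) :=
  {z | σ ≤ ∑ i, roundErr n H h y₀ (z i)} ∪ {z | σ ≤ -∑ i, roundErr n H h y₀ (z i)}

theorem measurableSet_badRound (n H : ℕ) (h y₀ σ : ℝ) (k : ℕ) :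
    MeasurableSet (badRound n H h y₀ σ k) := by
  have : Measurable fun z : Fin k → EReal => ∑ i, roundErr n H h y₀ (z i) :=
    Finset.measurable_sum _ fun i _ => (measurable_roundErr n H h y₀).comp (measurable_pi_apply i)
  exact (measurableSet_le measurable_const this).union (measurableSet_le measurable_const this.neg)

/-- Off the exceptional events the grid position is within σ of the true sum, which moving ε by σ
absorbs. Large losses are charged through e^ε `likProd` instead of 1, which later yields a factor
e^{-4}; very negative losses are charged 1. -/
theorem min_likProd_le {O : Oracle} {δ u : ℝ} {s : State} {c : ℕ → ℂ}
    {w l N : ℕ} {y : ℝ} (ht : IsTable O k n H h δ u s c w l N y) (hn : n = 2 * H) {σ v : ℝ}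
    (hσ : 0 < σ) (hv : v + σ ≤ H * h) (ε : ℝ) (z : Fin k → EReal) :
    min 1 (ENNReal.ofReal (Real.exp ε) * likProd z) ≤
      gridFun n H h k l y (capExp (ε + σ)) z +
      ((badRound n H h (meanShift O n H h) σ k).indicator 1 z +
      (∑ i, {z : Fin k → EReal | z i ∈ {t | ENNReal.ofReal (Real.exp v) < lik t}}.indicator 1 z +
      (∑ i, {z : Fin k → EReal | z i ∈ Set.Ioi ((H * h : ℝ) : EReal)}.indicator
        (fun z => ENNReal.ofReal (Real.exp ε) * likProd z) z +
      ({z : Fin k → EReal | likProd z < ENNReal.ofReal (Real.exp (-v))}.indicator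
        (fun _ => ENNReal.ofReal (Real.exp (ε - v))) z +
      {z : Fin k → EReal | ENNReal.ofReal (Real.exp v) < likProd z}.indicator 1 z)))) := by
  have hh : 0 < h := ht.shift_nonneg.trans_lt ht.shift_lt
  by_cases hb : z ∈ badRound n H h (meanShift O n H h) σ k
  · refine le_add_left (le_add_right ?_)
    rw [Set.indicator_of_mem hb]
    exact min_le_left _ _
  by_cases hA : ∃ i, ENNReal.ofReal (Real.exp v) < lik (z i)
  · obtain ⟨i, hi⟩ := hA
    refine le_add_left (le_add_left (le_add_right ?_))
    refine le_trans ?_ (Finset.single_le_sum (fun _ _ => zero_le) (Finset.mem_univ i))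
    rw [Set.indicator_of_mem (by exact hi)]
    exact min_le_left _ _
  by_cases hD : ∃ i, ((H * h : ℝ) : EReal) < z i
  · obtain ⟨i, hi⟩ := hD
    refine le_add_left (le_add_left (le_add_left (le_add_right ?_)))
    refine le_trans ?_ (Finset.single_le_sum (fun _ _ => zero_le) (Finset.mem_univ i))
    rw [Set.indicator_of_mem (by exact hi)]
    exact min_le_right _ _
  by_cases hG : likProd z < ENNReal.ofReal (Real.exp (-v))
  · refine le_add_left (le_add_left (le_add_left (le_add_left (le_add_right ?_))))
    rw [Set.indicator_of_mem (by exact hG), sub_eq_add_neg, Real.exp_add,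
      ENNReal.ofReal_mul (Real.exp_pos _).le]
    exact (min_le_right _ _).trans (mul_le_mul_right hG.le _)
  by_cases hG' : ENNReal.ofReal (Real.exp v) < likProd z
  · refine le_add_left (le_add_left (le_add_left (le_add_left (le_add_left ?_))))
    rw [Set.indicator_of_mem (by exact hG')]
    exact min_le_left _ _
  refine le_add_right ?_
  push Not at hA hD hG hG'
  -- A coordinate at or below −Hh would have likelihood ratio at least e^{Hh} > e^v, which `hA`
  -- excludes.
  have hlow : ∀ i, ((-(H * h) : ℝ) : EReal) < z i := by
    intro i
    by_contra! hi
    have := (lik_le_lik hi).trans (hA i)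
    rw [lik_coe, neg_neg, ENNReal.ofReal_le_ofReal_iff (Real.exp_pos _).le, Real.exp_le_exp] at this
    linarith
  obtain ⟨f, hf⟩ := exists_mem_box hh hn hlow hD
  simp only [badRound, Set.mem_union, Set.mem_ofPred_eq, not_or, not_le] at hb
  rw [gridFun_of_mem hh hf, min_likProd_of_mem_box hf,
    ht.gridPos_eq_of_mem hn hf hb.1 hb.2 hv hG hG']
  refine ENNReal.ofReal_le_ofReal (capExp_mono ?_)
  linarith [hb.2]

/-- In this direction single coordinates out of range cost nothing, since `gridFun` is 0 off the
boxes. A large total loss, however, is charged 1, because wrapped mass may land anywhere on the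
grid. -/
theorem gridFun_le {O : Oracle} {δ u : ℝ} {s : State} {c : ℕ → ℂ}
    {w l N : ℕ} {y : ℝ} (ht : IsTable O k n H h δ u s c w l N y) (hn : n = 2 * H) {σ v : ℝ}
    (hv : v + σ ≤ H * h) (ε : ℝ) (z : Fin k → EReal) :
    gridFun n H h k l y (capExp (ε - σ)) z ≤
      min 1 (ENNReal.ofReal (Real.exp ε) * likProd z) +
      ((badRound n H h (meanShift O n H h) σ k).indicator 1 z +
      ({z : Fin k → EReal | likProd z < ENNReal.ofReal (Real.exp (-v))}.indicator 1 z +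
      {z : Fin k → EReal | ENNReal.ofReal (Real.exp v) < likProd z}.indicator 1 z)) := by
  have hh : 0 < h := ht.shift_nonneg.trans_lt ht.shift_lt
  by_cases hf : ∃ f : Fin k → Fin n, z ∈ box n H h f
  swap
  · push Not at hf
    rw [gridFun_of_forall_notMem hf]
    exact zero_le
  obtain ⟨f, hf⟩ := hf
  have hle : gridFun n H h k l y (capExp (ε - σ)) z ≤ 1 := by
    rw [gridFun_of_mem hh hf]
    exact ENNReal.ofReal_le_one.2 (capExp_le_one _ _)
  by_cases hb : z ∈ badRound n H h (meanShift O n H h) σ k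
  · refine le_add_left (le_add_right ?_)
    rwa [Set.indicator_of_mem hb]
  by_cases hG : likProd z < ENNReal.ofReal (Real.exp (-v))
  · refine le_add_left (le_add_left (le_add_right ?_))
    rwa [Set.indicator_of_mem (by exact hG)]
  by_cases hG' : ENNReal.ofReal (Real.exp v) < likProd z
  · refine le_add_left (le_add_left (le_add_left ?_))
    rwa [Set.indicator_of_mem (by exact hG')]
  refine le_add_right ?_
  push Not at hG hG'
  simp only [badRound, Set.mem_union, Set.mem_ofPred_eq, not_or, not_le] at hb
  rw [gridFun_of_mem hh hf, min_likProd_of_mem_box hf,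
    ht.gridPos_eq_of_mem hn hf hb.1 hb.2 hv hG hG']
  refine ENNReal.ofReal_le_ofReal (capExp_mono ?_)
  linarith [hb.1]

end RealRAM

/-! ### Numerical tail bounds. -/

namespace DP

/-- The curve is read at u + 1, as it is controlled only strictly beyond u, and the tails start at u
+ 4. Then e³ ≥ 11 gives 1 − e^{-3} ≥ 10/11 for large losses and e^{u+4} − e^{u+1} ≥ 10 for very
negative ones. -/
theorem tail_bounds {Ω : Type*} [MeasurableSpace Ω] {Q : Measure Ω} [IsProbabilityMeasure Q]
    {l : Ω → ENNReal} {c : ℝ → ℝ} (hl : Measurable l) (hl1 : ∫⁻ x, l x ∂Q ≤ 1)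
    (hc0 : ∀ ε, 0 ≤ c ε)
    (hc : ∀ ε, ENNReal.ofReal (c ε) = ∫⁻ x, (1 - ENNReal.ofReal (Real.exp ε) * l x) ∂Q)
    (hneg : ∀ ε, c (-ε) ≤ 1 - Real.exp (-ε) + Real.exp (-ε) * c ε) {u d : ℝ} (hu : 0 ≤ u)
    (hd : c (u + 1) ≤ d) :
    Q.real {x | l x < ENNReal.ofReal (Real.exp (-(u + 4)))} ≤ 11 / 10 * d ∧
      Q.real {x | ENNReal.ofReal (Real.exp (u + 4)) < l x} ≤ d / 10 := by
  have e1 : (2.7 : ℝ) ≤ Real.exp 1 := by linarith [Real.exp_one_gt_d9]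
  have e3 : (11 : ℝ) ≤ Real.exp 3 := by
    rw [show (3 : ℝ) = 1 + 1 + 1 by norm_num, Real.exp_add, Real.exp_add]
    nlinarith [mul_nonneg (sub_nonneg.2 e1) (sub_nonneg.2 e1)]
  constructor
  · have h := (measureReal_lt_exp_neg_le (w := u + 4) hl (hc0 _) (hc (u + 1)) (by linarith)).trans hd
    have e : Real.exp (u + 1 - (u + 4)) ≤ 11⁻¹ := by
      rw [show u + 1 - (u + 4) = -3 by ring, Real.exp_neg]
      exact inv_anti₀ (by norm_num) e3
    have hm : 0 ≤ Q.real {x | l x < ENNReal.ofReal (Real.exp (-(u + 4)))} := measureReal_nonneg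
    nlinarith
  · have h := (measureReal_exp_lt_le (w := u + 4) hl hl1 hc0 hc (hneg (u + 1))
      (by linarith)).trans hd
    have e : (10 : ℝ) ≤ Real.exp (u + 4) - Real.exp (u + 1) := by
      rw [show u + 4 = u + 1 + 3 by ring, Real.exp_add (u + 1) 3]
      nlinarith [Real.one_le_exp (by linarith : 0 ≤ u + 1)]
    have hm : 0 ≤ Q.real {x | ENNReal.ofReal (Real.exp (u + 4)) < l x} := measureReal_nonneg
    nlinarith

end DP

/-! ### The error terms, integrated. -/

namespace RealRAM

open DP

variable {n H k : ℕ} {h : ℝ} {Y : Measure EReal}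

section

variable [IsProbabilityMeasure Y]

theorem measure_badRound_le (hh : 0 < h) (hn : n = 2 * H) {σ δ : ℝ} (hσ : 0 ≤ σ)
    (hexp : Real.exp (-(2 * σ ^ 2 / (k * h ^ 2))) = δ / 12) :
    (Measure.pi fun _ : Fin k => Y)
      (badRound n H h (meanShift (Oracle.ofLaw Y) n H h) σ k) ≤ ENNReal.ofReal (δ / 6) := by
  have hb := measureReal_sum_roundErr_le (Y := Y) hh hn k hσ
  simp only [hexp] at hb
  rw [← ofReal_measureReal]
  refine ENNReal.ofReal_le_ofReal ((measureReal_union_le _ _).trans ?_)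
  linarith [hb.1, hb.2]

theorem lintegral_min_likProd_le {δ u : ℝ} {s : State} {c : ℕ → ℂ}
    {w l N : ℕ} {y : ℝ} (ht : IsTable (Oracle.ofLaw Y) k n H h δ u s c w l N y) (hn : n = 2 * H)
    {σ v : ℝ} (hσ : 0 < σ) (hv : v + σ ≤ H * h) (ε : ℝ) :
    ∫⁻ z, min 1 (ENNReal.ofReal (Real.exp ε) * likProd z) ∂(Measure.pi fun _ : Fin k => Y) ≤
      ∫⁻ z, gridFun n H h k l y (capExp (ε + σ)) z ∂(Measure.pi fun _ : Fin k => Y) +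
      ((Measure.pi fun _ : Fin k => Y)
        (badRound n H h (meanShift (Oracle.ofLaw Y) n H h) σ k) +
      (k * Y {t | ENNReal.ofReal (Real.exp v) < lik t} +
      (∑ i : Fin k, ENNReal.ofReal (Real.exp ε) *
        ∫⁻ z in {z : Fin k → EReal | z i ∈ Set.Ioi ((H * h : ℝ) : EReal)}, likProd z
          ∂(Measure.pi fun _ : Fin k => Y) +
      (ENNReal.ofReal (Real.exp (ε - v)) * (Measure.pi fun _ : Fin k => Y)
        {z | likProd z < ENNReal.ofReal (Real.exp (-v))} +
      (Measure.pi fun _ : Fin k => Y) {z | ENNReal.ofReal (Real.exp v) < likProd z})))) := by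
  have m1 := measurable_gridFun n H h k l y (capExp (ε + σ))
  have m2 : MeasurableSet (badRound n H h (meanShift (Oracle.ofLaw Y) n H h) σ k) :=
    measurableSet_badRound _ _ _ _ _ _
  have mS : MeasurableSet {t | ENNReal.ofReal (Real.exp v) < lik t} :=
    measurableSet_lt measurable_const measurable_lik
  have m3 : ∀ i : Fin k, MeasurableSet
      {z : Fin k → EReal | z i ∈ {t | ENNReal.ofReal (Real.exp v) < lik t}} := fun i =>
    measurable_pi_apply i mS
  have m4 : ∀ i : Fin k, MeasurableSet {z : Fin k → EReal | z i ∈ Set.Ioi ((H * h : ℝ) : EReal)} :=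
    fun i => measurable_pi_apply i measurableSet_Ioi
  have m5 : MeasurableSet {z : Fin k → EReal | likProd z < ENNReal.ofReal (Real.exp (-v))} :=
    measurableSet_lt measurable_likProd measurable_const
  have m6 : MeasurableSet {z : Fin k → EReal | ENNReal.ofReal (Real.exp v) < likProd z} :=
    measurableSet_lt measurable_const measurable_likProd
  have ml : Measurable fun z : Fin k → EReal => ENNReal.ofReal (Real.exp ε) * likProd z :=
    measurable_likProd.const_mul _
  have m1' : Measurable (1 : (Fin k → EReal) → ENNReal) := measurable_const
  refine (lintegral_mono (min_likProd_le ht hn hσ hv ε)).trans_eq ?_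
  rw [lintegral_add_left m1, lintegral_add_left (m1'.indicator m2),
    lintegral_add_left (Finset.measurable_sum _ fun i _ => m1'.indicator (m3 i)),
    lintegral_add_left (Finset.measurable_sum _ fun i _ => ml.indicator (m4 i)),
    lintegral_add_left (measurable_const.indicator m5),
    lintegral_finsetSum _ fun i _ => m1'.indicator (m3 i),
    lintegral_finsetSum _ fun i _ => ml.indicator (m4 i), lintegral_indicator_one m2,
    lintegral_indicator_one m6, lintegral_indicator_const m5]
  have e3 : ∀ i : Fin k, ∫⁻ z, {z : Fin k → EReal | z i ∈ {t | ENNReal.ofReal (Real.exp v) <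
      lik t}}.indicator 1 z ∂(Measure.pi fun _ : Fin k => Y) =
      Y {t | ENNReal.ofReal (Real.exp v) < lik t} := by
    intro i
    rw [lintegral_indicator_one (m3 i)]
    exact (measurePreserving_eval (fun _ : Fin k => Y) i).measure_preimage mS.nullMeasurableSet
  have e4 : ∀ i : Fin k, ∫⁻ z, {z : Fin k → EReal | z i ∈ Set.Ioi ((H * h : ℝ) : EReal)}.indicator
        (fun z => ENNReal.ofReal (Real.exp ε) * likProd z) z ∂(Measure.pi fun _ : Fin k => Y) =
      ENNReal.ofReal (Real.exp ε) *
        ∫⁻ z in {z : Fin k → EReal | z i ∈ Set.Ioi ((H * h : ℝ) : EReal)}, likProd z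
          ∂(Measure.pi fun _ : Fin k => Y) := by
    intro i
    rw [lintegral_indicator (m4 i), lintegral_const_mul _ measurable_likProd]
  simp_rw [e3, e4]
  simp

end

theorem lintegral_gridFun_le {δ u : ℝ} {s : State} {c : ℕ → ℂ}
    {w l N : ℕ} {y : ℝ} (ht : IsTable (Oracle.ofLaw Y) k n H h δ u s c w l N y) (hn : n = 2 * H)
    {σ v : ℝ} (hv : v + σ ≤ H * h) (ε : ℝ) :
    ∫⁻ z, gridFun n H h k l y (capExp (ε - σ)) z ∂(Measure.pi fun _ : Fin k => Y) ≤
      ∫⁻ z, min 1 (ENNReal.ofReal (Real.exp ε) * likProd z) ∂(Measure.pi fun _ : Fin k => Y) +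
      ((Measure.pi fun _ : Fin k => Y)
        (badRound n H h (meanShift (Oracle.ofLaw Y) n H h) σ k) +
      ((Measure.pi fun _ : Fin k => Y) {z | likProd z < ENNReal.ofReal (Real.exp (-v))} +
      (Measure.pi fun _ : Fin k => Y) {z | ENNReal.ofReal (Real.exp v) < likProd z})) := by
  have m2 : MeasurableSet (badRound n H h (meanShift (Oracle.ofLaw Y) n H h) σ k) :=
    measurableSet_badRound _ _ _ _ _ _
  have m5 : MeasurableSet {z : Fin k → EReal | likProd z < ENNReal.ofReal (Real.exp (-v))} :=
    measurableSet_lt measurable_likProd measurable_const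
  have m6 : MeasurableSet {z : Fin k → EReal | ENNReal.ofReal (Real.exp v) < likProd z} :=
    measurableSet_lt measurable_const measurable_likProd
  have m1' : Measurable (1 : (Fin k → EReal) → ENNReal) := measurable_const
  refine (lintegral_mono (gridFun_le ht hn hv ε)).trans_eq ?_
  rw [lintegral_add_left (measurable_const.min (measurable_likProd.const_mul _)),
    lintegral_add_left (m1'.indicator m2), lintegral_add_left (m1'.indicator m5),
    lintegral_indicator_one m2, lintegral_indicator_one m6, lintegral_indicator_one m5]

/-- Beyond `W` the likelihood ratio is below e^{-(u+4)}, so for ε ≤ u the tail probability comes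
with a factor e^{-4}. This keeps the sum over the k coordinates a small multiple of δ_error. -/
theorem lintegral_likProd_gt_le [IsProbabilityMeasure Y] {δ : ℝ → ℝ} {X : Measure EReal} (hP : IsPRV δ X Y) (i : Fin k)
    {ε u W d : ℝ} (hε : ε ≤ u) (hW : u + 4 < W)
    (hd : Y.real {t | lik t < ENNReal.ofReal (Real.exp (-(u + 4)))} ≤ d) :
    ENNReal.ofReal (Real.exp ε) * ∫⁻ z in {z : Fin k → EReal | z i ∈ Set.Ioi (W : EReal)},
        likProd z ∂(Measure.pi fun _ : Fin k => Y) ≤ ENNReal.ofReal (Real.exp (-4) * d) := by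
  calc ENNReal.ofReal (Real.exp ε) * ∫⁻ z in {z : Fin k → EReal | z i ∈ Set.Ioi (W : EReal)},
        likProd z ∂(Measure.pi fun _ : Fin k => Y)
      ≤ ENNReal.ofReal (Real.exp ε) * ∫⁻ t in Set.Ioi (W : EReal), lik t ∂Y := by
        gcongr
        exact hP.setLIntegral_likProd_le i measurableSet_Ioi
    _ ≤ ENNReal.ofReal (Real.exp ε) *
          ∫⁻ _ in Set.Ioi (W : EReal), ENNReal.ofReal (Real.exp (-(u + 4))) ∂Y := by
        gcongr 1
        refine setLIntegral_mono measurable_const fun t ht => ?_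
        refine (lik_le_lik (le_of_lt ht)).trans ?_
        rw [lik_coe]
        exact ENNReal.ofReal_le_ofReal (Real.exp_le_exp.2 (by linarith))
    _ = ENNReal.ofReal (Real.exp (ε - u - 4)) * Y (Set.Ioi (W : EReal)) := by
        rw [setLIntegral_const, ← mul_assoc, ← ENNReal.ofReal_mul (Real.exp_pos _).le,
          ← Real.exp_add]
        ring_nf
    _ ≤ ENNReal.ofReal (Real.exp (-4)) * ENNReal.ofReal d := by
        gcongr
        · linarith
        · refine le_trans ?_ (ENNReal.ofReal_le_ofReal hd)
          rw [ofReal_measureReal]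
          refine measure_mono fun t ht => ?_
          refine (lik_le_lik (le_of_lt ht)).trans_lt ?_
          rw [lik_coe]
          exact (ENNReal.ofReal_lt_ofReal_iff (Real.exp_pos _)).2 (Real.exp_lt_exp.2 (by linarith))
    _ = ENNReal.ofReal (Real.exp (-4) * d) := (ENNReal.ofReal_mul (Real.exp_pos _).le).symm

end RealRAM

/-! ### The approximation guarantee. -/

namespace RealRAM

open DP

theorem lintegral_min_likProd {δ : ℝ → ℝ} {X Y : Measure EReal} (hP : IsPRV δ X Y) (k : ℕ) (ε : ℝ) :
    ∫⁻ z, min 1 (ENNReal.ofReal (Real.exp ε) * likProd z) ∂(Measure.pi fun _ : Fin k => Y) =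
      ENNReal.ofReal (1 - composedCurve k X Y ε) ∧ composedCurve k X Y ε ≤ 1 := by
  have := hP.prob_right
  have hT0 : 0 ≤ composedCurve k X Y ε := privacyCurve_nonneg _ _ _
  have h1 : ∫⁻ z, min 1 (ENNReal.ofReal (Real.exp ε) * likProd z)
      ∂(Measure.pi fun _ : Fin k => Y) + ENNReal.ofReal (composedCurve k X Y ε) = 1 := by
    rw [hP.ofReal_composedCurve,
      ← lintegral_add_left (measurable_const.min (measurable_likProd.const_mul _))]
    have : ∀ a : ENNReal, min 1 a + (1 - a) = 1 := by
      intro a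
      rcases le_total a 1 with ha | ha
      · rw [min_eq_right ha, add_tsub_cancel_of_le ha]
      · rw [min_eq_left ha, tsub_eq_zero_of_le ha, add_zero]
    simp [this]
  have hT1 : composedCurve k X Y ε ≤ 1 := by
    rw [← ENNReal.ofReal_le_one, ← h1]
    exact le_add_self
  refine ⟨?_, hT1⟩
  rw [ENNReal.ofReal_sub _ hT0, ENNReal.ofReal_one]
  exact ENNReal.eq_sub_of_add_eq ENNReal.ofReal_ne_top h1

/-- The budget, in units of δ. The exact mean exceeds the discretized one by at most 1/6 (rounding)
+ 1/10 (very negative coordinates) + 11/320 (large coordinates) + 11/320 (large sum) + 1/10 (very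
negative sum) < 1/2. The reverse excess is at most 1/6 + 11/10 + 1/10 < 3/2. Adding δ/2 to the
output makes both fit within δ. -/
theorem IsTable.approx {𝒟 A Ω : Type*} [MeasurableSpace A] [MeasurableSpace Ω]
    {nbr : 𝒟 → 𝒟 → Prop} (hnbr : ∀ D D', nbr D D' → nbr D' D) {M : 𝒟 → Kernel A Ω}
    [∀ D, IsMarkovKernel (M D)] {X Y : Measure EReal} (hP : IsPRV (auxCurve nbr M) X Y)
    {n H k : ℕ} {h δ u σ : ℝ} {s : State} {c : ℕ → ℂ} {w l N : ℕ} {y : ℝ}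
    (ht : IsTable (Oracle.ofLaw Y) k n H h δ u s c w l N y) (hn : n = 2 * H) (hk : 1 ≤ k)
    (hδ : 0 < δ) (hu : 0 ≤ u) (hσ : h < σ) (hW : u + 4 + σ < H * h)
    (hexp : Real.exp (-(2 * σ ^ 2 / (k * h ^ 2))) = δ / 12)
    (hT : ∀ ε, u < ε → composedCurve k X Y ε ≤ δ) (hA : ∀ ε, u < ε → auxCurve nbr M ε ≤ δ / k)
    (ε : ℝ) : s.outputCurve (ε + σ) - δ ≤ composedCurve k X Y ε ∧
      composedCurve k X Y ε ≤ s.outputCurve (ε - σ) + δ := by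
  have hprob := hP.prob_right
  have hprob' := hP.prob_left
  have hh : 0 < h := ht.shift_nonneg.trans_lt ht.shift_lt
  have hσ0 : 0 < σ := hh.trans hσ
  have hkR : (0 : ℝ) < k := by exact_mod_cast hk
  have hT0 : ∀ ε, 0 ≤ composedCurve k X Y ε := fun ε => privacyCurve_nonneg _ _ _
  have hA0 : ∀ ε, 0 ≤ auxCurve nbr M ε := fun ε => by
    rw [← hP.curve]; exact privacyCurve_nonneg _ _ _
  obtain ⟨a1, a2⟩ := tail_bounds measurable_lik hP.lintegral_lik_le hA0 hP.ofReal_curve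
    (fun ε => auxCurve_neg_le hnbr M (by rw [← hP.curve]; exact one_sub_exp_le_privacyCurve X Y ε))
    hu (hA (u + 1) (by linarith))
  obtain ⟨b1, b2⟩ := tail_bounds measurable_likProd (hP.lintegral_likProd_le k) hT0
    (hP.ofReal_composedCurve k) (hP.composedCurve_neg_le hnbr k) hu (hT (u + 1) (by linarith))
  have hS : ∀ ε', ∫⁻ z, gridFun n H h k l y (capExp ε') z ∂(Measure.pi fun _ : Fin k => Y) =
      ENNReal.ofReal (∑ i ∈ Finset.range n, (c ((H + n - l + i) % n)).re *
        capExp ε' (y - H * h + i * h)) := fun ε' => by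
    rw [lintegral_gridFun hh (capExp_nonneg ε'), ← ht.sum_eq hn]
  have hS0 : ∀ ε', 0 ≤ ∑ i ∈ Finset.range n, (c ((H + n - l + i) % n)).re *
        capExp ε' (y - H * h + i * h) := fun ε' => by
    rw [ht.sum_eq hn]
    refine Finset.sum_nonneg fun f _ => mul_nonneg (Finset.prod_nonneg fun i _ => ?_)
      (capExp_nonneg _ _)
    rw [cellMass_eq hh]
    exact measureReal_nonneg
  obtain ⟨e1, e2⟩ := lintegral_min_likProd hP k ε
  have hbad := measure_badRound_le (Y := Y) (k := k) hh hn hσ0.le hexp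
  have hexp4 : Real.exp (-4) ≤ 1 / 32 := by
    rw [Real.exp_neg, one_div]
    refine inv_anti₀ (by norm_num) ?_
    rw [show (4 : ℝ) = 1 + 1 + 1 + 1 by norm_num, Real.exp_add, Real.exp_add, Real.exp_add]
    have : (5 / 2 : ℝ) ≤ Real.exp 1 := by linarith [Real.exp_one_gt_d9]
    have : (5 / 2 * (5 / 2) * (5 / 2) * (5 / 2) : ℝ) ≤ Real.exp 1 * Real.exp 1 * Real.exp 1 * Real.exp 1 := by gcongr
    linarith
  have hG : (Measure.pi fun _ : Fin k => Y) {z | ENNReal.ofReal (Real.exp (u + 4)) < likProd z} ≤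
      ENNReal.ofReal (δ / 10) := by
    rw [← ofReal_measureReal]
    exact ENNReal.ofReal_le_ofReal b2
  have hG' : (Measure.pi fun _ : Fin k => Y)
      {z | likProd z < ENNReal.ofReal (Real.exp (-(u + 4)))} ≤ ENNReal.ofReal (11 / 10 * δ) := by
    rw [← ofReal_measureReal]
    exact ENNReal.ofReal_le_ofReal b1
  constructor
  · by_cases hN : ∃ i < N, ε + σ < y - H * h + i * h
    · rw [ht.outputCurve_eq hN]
      -- Breakpoints lie below u, so a nonzero piece is in use only for such ε; the factors e^{-4}
      -- depend on this.
      have hεu : ε ≤ u := by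
        obtain ⟨i, hi, hi'⟩ := hN
        linarith [ht.breaks_lt i hi]
      have key := lintegral_min_likProd_le ht hn hσ0 hW.le ε
      rw [e1, hS] at key
      have hk1 : (k : ENNReal) * Y {t | ENNReal.ofReal (Real.exp (u + 4)) < lik t} ≤
          ENNReal.ofReal (δ / 10) := by
        calc (k : ENNReal) * Y {t | ENNReal.ofReal (Real.exp (u + 4)) < lik t}
            ≤ ENNReal.ofReal k * ENNReal.ofReal (δ / k / 10) := by
              rw [ENNReal.ofReal_natCast]
              gcongr
              rw [← ofReal_measureReal]
              exact ENNReal.ofReal_le_ofReal a2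
          _ = ENNReal.ofReal (δ / 10) := by
              rw [← ENNReal.ofReal_mul hkR.le]
              congr 1
              field_simp
      have hk2 : ∑ i : Fin k, ENNReal.ofReal (Real.exp ε) *
          ∫⁻ z in {z : Fin k → EReal | z i ∈ Set.Ioi ((H * h : ℝ) : EReal)}, likProd z
          ∂(Measure.pi fun _ : Fin k => Y) ≤ ENNReal.ofReal (11 / 320 * δ) := by
        calc _ ≤ ∑ i : Fin k, ENNReal.ofReal (Real.exp (-4) * (11 / 10 * (δ / k))) :=
              Finset.sum_le_sum fun i _ =>
                lintegral_likProd_gt_le hP i hεu (by linarith) a1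
          _ = ENNReal.ofReal (k * (Real.exp (-4) * (11 / 10 * (δ / k)))) := by
              rw [ENNReal.ofReal_mul hkR.le, ENNReal.ofReal_natCast]
              simp
          _ ≤ ENNReal.ofReal (11 / 320 * δ) := by
              refine ENNReal.ofReal_le_ofReal ?_
              have : k * (Real.exp (-4) * (11 / 10 * (δ / k))) = Real.exp (-4) * (11 / 10 * δ) := by
                field_simp
              rw [this]
              nlinarith
      have hk3 : ENNReal.ofReal (Real.exp (ε - (u + 4))) * (Measure.pi fun _ : Fin k => Y)
          {z | likProd z < ENNReal.ofReal (Real.exp (-(u + 4)))} ≤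
          ENNReal.ofReal (11 / 320 * δ) := by
        calc _ ≤ ENNReal.ofReal (Real.exp (-4)) * ENNReal.ofReal (11 / 10 * δ) := by
              gcongr
              linarith
          _ ≤ ENNReal.ofReal (11 / 320 * δ) := by
              rw [← ENNReal.ofReal_mul (Real.exp_pos _).le]
              refine ENNReal.ofReal_le_ofReal ?_
              nlinarith
      have key' := key.trans (add_le_add_right (add_le_add hbad (add_le_add hk1
        (add_le_add hk2 (add_le_add hk3 hG)))) _)
      rw [← ENNReal.ofReal_add (by positivity) (by positivity),
        ← ENNReal.ofReal_add (by positivity) (by positivity),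
        ← ENNReal.ofReal_add (by positivity) (by positivity),
        ← ENNReal.ofReal_add (by positivity) (by positivity),
        ← ENNReal.ofReal_add (hS0 _) (by positivity),
        ENNReal.ofReal_le_ofReal_iff (add_nonneg (hS0 _) (by positivity))] at key'
      simp only [capExp] at key'
      linarith
    · push Not at hN
      rw [ht.outputCurve_eq_zero hN]
      linarith [hT0 ε]
  · by_cases hN : ∃ i < N, ε - σ < y - H * h + i * h
    · rw [ht.outputCurve_eq hN]
      have key := lintegral_gridFun_le ht hn hW.le ε
      rw [e1, hS] at key
      have key' := key.trans (add_le_add_right (add_le_add hbad (add_le_add hG' hG)) _)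
      rw [← ENNReal.ofReal_add (by positivity) (by positivity),
        ← ENNReal.ofReal_add (by positivity) (by positivity),
        ← ENNReal.ofReal_add (by linarith) (by positivity),
        ENNReal.ofReal_le_ofReal_iff (add_nonneg (by linarith) (by positivity))] at key'
      simp only [capExp] at key'
      linarith
    · push Not at hN
      rw [ht.outputCurve_eq_zero hN]
      -- An empty table would put u at or below the first grid point y − Hh, which is negative.
      have hN0 : N ≠ 0 := by
        rintro rfl
        have := ht.le_break
        have := ht.shift_lt
        push_cast at *
        linarith
      obtain ⟨N', rfl⟩ := Nat.exists_eq_succ_of_ne_zero hN0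
      -- The last breakpoint is at least u − h and at most ε − σ; since h < σ this forces ε > u,
      -- where the curve is at most δ and the output 0 is good enough.
      have h1 := hN N' (Nat.lt_succ_self _)
      have h2 := ht.le_break
      push_cast at h2
      have := hT ε (by linarith)
      linarith

end RealRAM

/-! ### Constants and step counts. -/

namespace RealRAM

open DP

theorem log_twelve_bounds : 23 / 10 ≤ Real.log 12 ∧ Real.log 12 ≤ 4 * Real.log 2 := by
  have h3 : 1 ≤ Real.log 3 := by
    rw [Real.le_log_iff_exp_le (by norm_num)]
    linarith [Real.exp_one_lt_d9]
  constructor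
  · rw [show (12 : ℝ) = 2 * 2 * 3 by norm_num, Real.log_mul (by norm_num) (by norm_num),
      Real.log_mul (by norm_num) (by norm_num)]
    linarith [Real.log_two_gt_d9]
  · rw [show (4 : ℝ) * Real.log 2 = Real.log (2 ^ 4) by rw [Real.log_pow]; norm_num]
    exact Real.log_le_log (by norm_num) (by norm_num)

theorem mul_le_half_mul_log {k : ℕ} (hk : 1 ≤ k) {δ : ℝ} (hδ : 0 < δ) (hδ1 : δ < 1) :
    23 / 20 * (k : ℝ) ≤ k / 2 * Real.log (12 / δ) := by
  have hkR : (1 : ℝ) ≤ k := by exact_mod_cast hk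
  have : Real.log 12 ≤ Real.log (12 / δ) :=
    Real.log_le_log (by norm_num) (by rw [le_div_iff₀ hδ]; linarith)
  nlinarith [log_twelve_bounds.1]

theorem exp_hoeffding {k : ℕ} (hk : 1 ≤ k) {σ δ h : ℝ} (hσ : 0 < σ) (hδ : 0 < δ) (hδ1 : δ < 1)
    (hh : h = σ / √((k : ℝ) / 2 * Real.log (12 / δ))) :
    Real.exp (-(2 * σ ^ 2 / (k * h ^ 2))) = δ / 12 := by
  have hkR : (1 : ℝ) ≤ k := by exact_mod_cast hk
  have hp := mul_le_half_mul_log hk hδ hδ1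
  have hq0 : 0 < (k : ℝ) / 2 * Real.log (12 / δ) := by linarith
  have hlog : 0 < Real.log (12 / δ) := by
    by_contra! h0
    nlinarith
  have : 2 * σ ^ 2 / (k * h ^ 2) = Real.log (12 / δ) := by
    rw [hh, div_pow, Real.sq_sqrt hq0.le]
    field_simp
  rw [this, Real.exp_neg, Real.exp_log (by positivity), inv_div]

/-- The lower bound on x keeps log x ≥ 1/16, so additive constants are absorbed: T + 1 ≤ 5 + log x /
log 2 ≤ 82 log x, and 4000 · 16 · 82 < 6000000. -/
theorem steps_le {T n : ℕ} {x : ℝ} (hnT : n = 2 ^ T) (hx : 23 / 20 ≤ x ^ 2) (hx0 : 0 < x)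
    (hn : (n : ℝ) < 16 * x) {t : ℕ} (ht : t ≤ 4000 * (n * (T + 1))) :
    (t : ℝ) ≤ 6000000 * (x * Real.log x) := by
  have hl : 1 / 16 ≤ Real.log x := by
    have h1 := Real.one_sub_inv_le_log_of_pos (by positivity : 0 < x ^ 2)
    rw [Real.log_pow] at h1
    have h2 : (x ^ 2)⁻¹ ≤ (23 / 20)⁻¹ := inv_anti₀ (by norm_num) hx
    norm_num at h1 h2
    linarith
  have hT : (T : ℝ) * Real.log 2 ≤ 4 * Real.log 2 + Real.log x := by
    have h1 : Real.log n ≤ Real.log (16 * x) :=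
      Real.log_le_log (by rw [hnT]; positivity) hn.le
    rw [hnT, Nat.cast_pow, Real.log_pow, Real.log_mul (by norm_num) hx0.ne',
      show (16 : ℝ) = 2 ^ 4 by norm_num, Real.log_pow] at h1
    exact_mod_cast h1
  have hT' : (T : ℝ) + 1 ≤ 82 * Real.log x := by
    nlinarith [Real.log_two_gt_d9, Real.log_two_lt_d9]
  have ht' : (t : ℝ) ≤ 4000 * (n * (T + 1)) := by exact_mod_cast ht
  have h1 : (n : ℝ) * (T + 1) ≤ 16 * x * (82 * Real.log x) := by gcongr
  have h2 : 0 ≤ x * Real.log x := by positivity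
  nlinarith

/-- With 2 + σ + u ≤ 4u and log(12/δ) ≤ 5 log(1/δ), the ratio x = (2 + σ + u)/h is at most 7√k R,
where R ≤ k^a. As log 7 ≤ 3 log 2 ≤ 3 log k, this gives log x ≤ 7/2 · (1 + a) log k, and 7 · 7/2 <
25. -/
theorem mul_log_le {k : ℕ} (hk : 2 ≤ k) {σ δ u a h : ℝ} (hσ : 0 < σ) (hδ : 0 < δ) (hδ1 : δ ≤ 1 / 2)
    (hu : 1 ≤ u) (hσu : σ ≤ u) (ha : 0 ≤ a)
    (hh : h = σ / √((k : ℝ) / 2 * Real.log (12 / δ)))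
    (hka : u * √(Real.log (1 / δ)) / σ ≤ (k : ℝ) ^ a) :
    (2 + σ + u) / h * Real.log ((2 + σ + u) / h) ≤
      25 * ((1 + a) * (u * √(k : ℝ) * Real.log k * √(Real.log (1 / δ)) / σ)) := by
  have hkR : (2 : ℝ) ≤ k := by exact_mod_cast hk
  have hΛ : Real.log 2 ≤ Real.log (1 / δ) :=
    Real.log_le_log (by norm_num) (by rw [le_div_iff₀ hδ]; linarith)
  have hl2 := Real.log_two_gt_d9
  have hΛ0 : 0 < Real.log (1 / δ) := by linarith
  have hlk : Real.log 2 ≤ Real.log k := Real.log_le_log (by norm_num) hkR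
  have hlam : Real.log (12 / δ) ≤ 5 * Real.log (1 / δ) := by
    rw [div_eq_mul_one_div, Real.log_mul (by norm_num) (by positivity)]
    linarith [log_twelve_bounds.2]
  set R := u * √(Real.log (1 / δ)) / σ with hR
  have hR0 : 0 < R := by positivity
  have hk0 : 0 < √(k : ℝ) := Real.sqrt_pos.2 (by linarith)
  have hp := mul_le_half_mul_log (by omega : 1 ≤ k) hδ (by linarith)
  have hq0 : 0 < √((k : ℝ) / 2 * Real.log (12 / δ)) := Real.sqrt_pos.2 (by linarith)
  have hq : √((k : ℝ) / 2 * Real.log (12 / δ)) ≤ 7 / 4 * (√(k : ℝ) * √(Real.log (1 / δ))) := by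
    rw [Real.sqrt_le_left (by positivity), mul_pow, mul_pow, Real.sq_sqrt (by linarith),
      Real.sq_sqrt hΛ0.le]
    nlinarith [mul_le_mul_of_nonneg_left hlam (by linarith : (0 : ℝ) ≤ k),
      mul_pos (by linarith : (0 : ℝ) < k) hΛ0]
  set x := (2 + σ + u) / h with hx
  have hxeq : x = (2 + σ + u) * √((k : ℝ) / 2 * Real.log (12 / δ)) / σ := by
    rw [hx, hh]
    field_simp
  have hx0 : 0 < x := by rw [hxeq]; positivity
  have hx7 : x ≤ 7 * (√(k : ℝ) * R) := by
    rw [hxeq, hR]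
    calc (2 + σ + u) * √((k : ℝ) / 2 * Real.log (12 / δ)) / σ
        ≤ (4 * u) * (7 / 4 * (√(k : ℝ) * √(Real.log (1 / δ)))) / σ := by
          gcongr
          linarith
      _ = 7 * (√(k : ℝ) * (u * √(Real.log (1 / δ)) / σ)) := by ring
  have hlogR : Real.log R ≤ a * Real.log k := by
    rw [← Real.log_rpow (by linarith)]
    exact Real.log_le_log hR0 hka
  have hlogx : Real.log x ≤ 7 / 2 * ((1 + a) * Real.log k) := by
    have h1 := Real.log_le_log hx0 hx7
    rw [Real.log_mul (by norm_num) (by positivity), Real.log_mul hk0.ne' hR0.ne',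
      Real.log_sqrt (by linarith)] at h1
    have h7 : Real.log 7 ≤ 3 * Real.log 2 := by
      rw [show (3 : ℝ) * Real.log 2 = Real.log (2 ^ 3) by rw [Real.log_pow]; norm_num]
      exact Real.log_le_log (by norm_num) (by norm_num)
    have : 0 ≤ a * Real.log k := mul_nonneg ha (by linarith)
    linarith
  have hpos : 0 ≤ (1 + a) * Real.log k := mul_nonneg (by linarith) (by linarith)
  calc x * Real.log x ≤ x * (7 / 2 * ((1 + a) * Real.log k)) := by gcongr
    _ ≤ 7 * (√(k : ℝ) * R) * (7 / 2 * ((1 + a) * Real.log k)) := by gcongr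
    _ = 49 / 2 * (√(k : ℝ) * R * ((1 + a) * Real.log k)) := by ring
    _ ≤ 25 * (√(k : ℝ) * R * ((1 + a) * Real.log k)) := by gcongr; norm_num
    _ = 25 * ((1 + a) * (u * √(k : ℝ) * Real.log k * √(Real.log (1 / δ)) / σ)) := by
      rw [hR]; ring

theorem composePRV_spec {𝒟 A Ω : Type*} [MeasurableSpace A] [MeasurableSpace Ω]
    {nbr : 𝒟 → 𝒟 → Prop} (hnbr : ∀ D D', nbr D D' → nbr D' D) {M : 𝒟 → Kernel A Ω}
    [∀ D, IsMarkovKernel (M D)] {X Y : Measure EReal} (hP : IsPRV (auxCurve nbr M) X Y)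
    {k : ℕ} (hk : 1 ≤ k) {σ δ u h : ℝ} (hσ : 0 < σ) (hδ : 0 < δ) (hδ1 : δ < 1)
    (hmax : max (epsOf (composedCurve k X Y) δ) (epsOf (auxCurve nbr M) (δ / k)) ≤ (u : EReal))
    (hh : h = σ / √((k : ℝ) / 2 * Real.log (12 / δ))) :
    ∃ s t, Exec (Oracle.ofLaw Y) composePRV (State.input k σ δ u) s t ∧ s.Sorted ∧
      (∀ ε, s.outputCurve (ε + σ) - δ ≤ composedCurve k X Y ε ∧
        composedCurve k X Y ε ≤ s.outputCurve (ε - σ) + δ) ∧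
      (t : ℝ) ≤ 6000000 * ((2 + σ + u) / h * Real.log ((2 + σ + u) / h)) := by
  have hprob := hP.prob_right
  have hprob' := hP.prob_left
  have hkR : (1 : ℝ) ≤ k := by exact_mod_cast hk
  have h1 := (le_max_left _ _).trans hmax
  have h2 := (le_max_right _ _).trans hmax
  have hu : 0 ≤ u := nonneg_of_epsOf_le h1
  have hT : ∀ ε, u < ε → composedCurve k X Y ε ≤ δ := fun ε hε =>
    le_of_epsOf_le (privacyCurve_antitone _ _) h1 hε
  have hA : ∀ ε, u < ε → auxCurve nbr M ε ≤ δ / k := fun ε hε =>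
    le_of_epsOf_le (by
      rw [← funext hP.curve]
      exact privacyCurve_antitone _ _) h2 hε
  have hp := mul_le_half_mul_log hk hδ hδ1
  set q := √((k : ℝ) / 2 * Real.log (12 / δ)) with hqdef
  have hq2 : q ^ 2 = (k : ℝ) / 2 * Real.log (12 / δ) := Real.sq_sqrt (by linarith)
  have hq0 : 0 < q := Real.sqrt_pos.2 (by linarith)
  -- This is h < σ; it holds because log 12 > 2 makes the radicand exceed k ≥ 1.
  have hq1 : 1 < q := by nlinarith
  have hh0 : 0 < h := by rw [hh]; positivity
  have hσq : σ = h * q := by rw [hh]; field_simp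
  have hhσ : h < σ := by rw [hσq]; nlinarith
  set x := (2 + σ + u) / h with hx
  have hxh : x * h = 2 + σ + u := by rw [hx]; field_simp
  have hqx : q ≤ x := by
    rw [hx, le_div_iff₀ hh0]
    nlinarith
  have hx0 : 0 < x := hq0.trans_le hqx
  have hx2 : 23 / 20 * (k : ℝ) ≤ x ^ 2 := by nlinarith
  have hex : ∃ T : ℕ, 8 * (2 + σ + u) ≤ (2 : ℝ) ^ T * h := by
    obtain ⟨T, hT⟩ := pow_unbounded_of_one_lt (8 * x) (by norm_num : (1 : ℝ) < 2)
    refine ⟨T, ?_⟩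
    nlinarith
  classical
  obtain ⟨T, hle, hlt⟩ : ∃ T : ℕ, 8 * (2 + σ + u) ≤ (2 : ℝ) ^ T * h ∧
      ∀ j < T, (2 : ℝ) ^ j * h < 8 * (2 + σ + u) :=
    ⟨Nat.find hex, Nat.find_spec hex, fun j hj => not_le.1 (Nat.find_min hex hj)⟩
  have h8 : 8 * x ≤ (2 : ℝ) ^ T := by
    refine le_of_mul_le_mul_right ?_ hh0
    linarith
  -- As x > 1, the size 2^T exceeds 8. In particular half of it is at least 2, as the hand-written
  -- twiddle factors require.
  have hT4 : 4 ≤ T := by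
    by_contra! hlt4
    have : (2 : ℝ) ^ T ≤ 2 ^ 3 := pow_le_pow_right₀ (by norm_num) (by omega)
    linarith
  obtain ⟨T', rfl⟩ : ∃ T', T = T' + 1 := ⟨T - 1, by omega⟩
  -- The doubling stopped at the first sufficient power, so half the size was still too small.
  have h16 : (2 : ℝ) ^ (T' + 1) < 16 * x := by
    have := hlt T' (by omega)
    have : (2 : ℝ) ^ T' < 8 * x := by
      refine lt_of_mul_lt_mul_right ?_ hh0.le
      linarith
    rw [pow_succ]
    linarith
  have hn : 2 ^ (T' + 1) = 2 * 2 ^ T' := by ring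
  have hH : 2 ≤ 2 ^ T' := by
    calc 2 = 2 ^ 1 := by norm_num
      _ ≤ 2 ^ T' := Nat.pow_le_pow_right (by norm_num) (by omega)
  -- The size is at least 8x, and x² ≥ 23k/20.
  have hkn : k < 2 ^ (T' + 1) * 2 ^ (T' + 1) := by
    have : (k : ℝ) < (2 : ℝ) ^ (T' + 1) * 2 ^ (T' + 1) := by nlinarith
    exact_mod_cast this
  have hHh : 4 * (2 + σ + u) ≤ ((2 ^ T' : ℕ) : ℝ) * h := by
    rw [pow_succ] at hle
    push_cast
    linarith
  have hm := meanShift_mem (Y := Y) hh0 hn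
  obtain ⟨s, t, he, ⟨c, w, l, N, y, ht⟩, hst⟩ := wp_composePRV (O := Oracle.ofLaw Y) hh hlt hle rfl
    hn hH hh0 hkn hm.1 hm.2 (by linarith)
  refine ⟨s, t, he, ht.sorted, fun ε => ?_, ?_⟩
  · exact ht.approx hnbr hP hn hk hδ hu hhσ (by linarith) (exp_hoeffding hk hσ hδ hδ1 hh) hT hA ε
  · exact steps_le rfl (by linarith) hx0 (by exact_mod_cast h16) hst

end RealRAM

theorem mainTheorem2 :
    ∃ (prog : RealRAM.Cmd) (C : ℝ),
      ∀ (𝒟 A Ω : Type*) [MeasurableSpace A] [MeasurableSpace Ω]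
        [MeasurableSpace.CountablyGenerated Ω]
        (nbr : 𝒟 → 𝒟 → Prop) (_ : ∀ D D', nbr D D' → nbr D' D)
        (M : 𝒟 → Kernel A Ω) (_ : ∀ D, IsMarkovKernel (M D))
        (X Y : Measure EReal) (_ : DP.IsPRV (DP.auxCurve nbr M) X Y)
        (k : ℕ) (_ : 1 ≤ k)
        (pick : ∀ n : ℕ, (Fin n → Ω) → A) (hpick : ∀ n, Measurable (pick n)),
        -- the composed algorithm has the privacy curve `δ_M ⊗ ⋯ ⊗ δ_M`
        (∀ ε : ℝ, DP.IsDP nbr (fun D => DP.adaptiveComp M pick hpick D k) ε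
          (DP.composedCurve k X Y ε)) ∧
        -- which is exact if some pair of neighbours is a worst case for `M`
        ((∃ D D' : 𝒟, nbr D D' ∧
            ∀ (a : A) (ε : ℝ), DP.privacyCurve (M D' a) (M D a) ε = DP.auxCurve nbr M ε) →
          ∀ ε : ℝ, DP.dpCurve nbr (fun D => DP.adaptiveComp M pick hpick D k) ε =
            DP.composedCurve k X Y ε) ∧
        -- and which the program approximates
        ∀ (εerr δerr εup : ℝ), 0 < εerr → 0 < δerr → δerr < 1 →
          max (DP.epsOf (DP.composedCurve k X Y) δerr)
              (DP.epsOf (DP.auxCurve nbr M) (δerr / k)) ≤ (εup : EReal) →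
          ∃ (out : RealRAM.State) (steps : ℕ),
            RealRAM.Exec (RealRAM.Oracle.ofLaw Y) prog
              (RealRAM.State.input k εerr δerr εup) out steps ∧
            out.Sorted ∧
            (∀ ε : ℝ, out.outputCurve (ε + εerr) - δerr ≤ DP.composedCurve k X Y ε ∧
              DP.composedCurve k X Y ε ≤ out.outputCurve (ε - εerr) + δerr) ∧
            (let L : ℝ := 2 + εerr + εup
             let h : ℝ := εerr / √((k : ℝ) / 2 * Real.log (12 / δerr))
             (steps : ℝ) ≤ C * (L / h * Real.log (L / h))) ∧
            (∀ a : ℝ, 0 ≤ a → 2 ≤ k → 1 ≤ εup → εerr ≤ εup → δerr ≤ 1 / 2 →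
              εup * √(Real.log (1 / δerr)) / εerr ≤ (k : ℝ) ^ a →
              (steps : ℝ) ≤ C * (1 + a) *
                (εup * √(k : ℝ) * Real.log k * √(Real.log (1 / δerr)) / εerr)) := by
  -- 25 · 6000000, from `mul_log_le` and `composePRV_spec`.
  refine ⟨RealRAM.composePRV, 150000000, ?_⟩
  intro 𝒟 A Ω _ _ _ nbr hnbr M hM X Y hP k hk pick hpick
  refine ⟨DP.isDP_adaptiveComp nbr M hP k pick hpick,
    fun ⟨D, D', hD, hworst⟩ => DP.dpCurve_adaptiveComp nbr M hP k pick hpick hD hworst, ?_⟩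
  intro σ δ u hσ hδ hδ1 hmax
  obtain ⟨s, t, he, hs, happ, ht⟩ := RealRAM.composePRV_spec hnbr hP hk hσ hδ hδ1 hmax rfl
  refine ⟨s, t, he, hs, happ, ?_, ?_⟩
  · intro L h
    have h0 : (0 : ℝ) ≤ t := t.cast_nonneg
    change (t : ℝ) ≤ 6000000 * (L / h * Real.log (L / h)) at ht
    linarith
  · intro a ha hk2 hu hσu hδ2 hka
    have := RealRAM.mul_log_le hk2 hσ hδ hδ2 hu hσu ha rfl hka
    linarith
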